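/- Write $L(s,\chi)$ for the (meromorphically continued) Dirichlet $L$-function of a Dirichlet character $\chi$ (principal characters, including the one modulo $1$ with $L(s,\chi)=\zeta(s)$, are allowed). Assume the generalized Lindelöf hypothesis (GLH) in the following form: for every $\varepsilon>0$ there is a constant $C_\varepsilon>0$ such that for every $q\ge 1$, every Dirichlet character $\chi$ modulo $q$, and every $s=\sigma+it$ with $\sigma\ge 1/2$ and $|s-1|\ge 1/2$, $$|L(\sigma+it,\chi)|\le C_\varepsilon\,(q(1+|t|))^{\varepsilon}.$$ For a Dirichlet character $\chi$ let $N(\alpha,T,\chi)$ denote the number of zeros $\rho=\beta+i\gamma$ of $L(s,\chi)$ with $\beta\ge\alpha$ and $|\gamma|\le T$, counted with multiplicity. For an integer $k\ge 1$ and real numbers $Q,T\ge 1$ define $$N(\alpha,k,Q,T)=\sum_{\substack{1\le q\le Q\\ (q,k)=1}}\ \sum_{\substack{\psi \bmod q\\ \psi\ \mathrm{primitive}}}\ \sum_{\xi \bmod k} N(\alpha,T,\xi\psi),$$ where $q$ runs over integers, $\xi$ runs over all Dirichlet characters modulo $k$, and $\xi\psi$ is regarded as a character modulo $kq$. Then for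 every $\varepsilon>0$ there is a constant $C'_\varepsilon>0$, depending only on $\varepsilon$, such that for all integers $k\ge 1$, all real $Q\ge 1$, $T\ge 1$, and all $1/2\le\alpha\le 1$, $$N(\alpha,k,Q,T)\le C'_\varepsilon\,(kQ^2T)^{2(1-\alpha)+\varepsilon}.$$ -/

import Mathlib

open scoped ENNReal

/-- The generalized Lindelöf hypothesis for Dirichlet `L`-functions: for every `ε > 0`, uniformly
over all moduli `q`, all characters `χ` modulo `q` and all `s` with `Re s ≥ 1/2`, `|s - 1| ≥ 1/2`,
one has `L(s, χ) ≪_ε (q (1 + |Im s|)) ^ ε`. -/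
def GeneralizedLindelofHypothesis : Prop :=
  ∀ ε : ℝ, 0 < ε → ∃ C : ℝ, 0 < C ∧
    ∀ (q : ℕ) [NeZero q] (χ : DirichletCharacter ℂ q) (s : ℂ),
      1 / 2 ≤ s.re → 1 / 2 ≤ ‖s - 1‖ →
        ‖DirichletCharacter.LFunction χ s‖ ≤ C * ((q : ℝ) * (1 + |s.im|)) ^ ε

/-- `N(α, T, χ)`: the number of zeros `ρ` of `L(s, χ)` with `Re ρ ≥ α` and `|Im ρ| ≤ T`, counted
with multiplicity, as an element of `[0, ∞]`. For principal `χ` the pole `s = 1` contributes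
nothing whatever the value assigned there, since `analyticOrderAt` is `0` at points where the
function is not analytic. -/
noncomputable def zeroCount {ℓ : ℕ} [NeZero ℓ] (α T : ℝ) (χ : DirichletCharacter ℂ ℓ) : ℝ≥0∞ :=
  ∑' ρ : {ρ : ℂ // DirichletCharacter.LFunction χ ρ = 0 ∧ α ≤ ρ.re ∧ |ρ.im| ≤ T},
    (analyticOrderAt (DirichletCharacter.LFunction χ) (ρ : ℂ) : ℝ≥0∞)

/-- The product `ξψ` of a character `ξ` modulo `k` and a character `ψ` modulo `q`, as a character
modulo `kq`. -/
noncomputable def charProd {k q : ℕ} (ξ : DirichletCharacter ℂ k) (ψ : DirichletCharacter ℂ q) :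
    DirichletCharacter ℂ (k * q) :=
  DirichletCharacter.changeLevel (Dvd.intro q rfl) ξ *
    DirichletCharacter.changeLevel (Dvd.intro_left k rfl) ψ

open scoped Classical in
/-- `N(α, k, Q, T)`: the sum of `N(α, T, ξψ)` over the integers `1 ≤ q ≤ Q` coprime to `k`, the
primitive characters `ψ` modulo `q` and all characters `ξ` modulo `k`. The moduli are written
`q = j + 1` with `0 ≤ j < ⌊Q⌋`. -/
noncomputable def zeroCountSum (α : ℝ) (k : ℕ) [NeZero k] (Q T : ℝ) : ℝ≥0∞ :=
  ∑ j ∈ Finset.range ⌊Q⌋₊ with (j + 1).Coprime k,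
    ∑ ψ : DirichletCharacter ℂ (j + 1) with ψ.IsPrimitive,
      ∑ ξ : DirichletCharacter ℂ k, zeroCount α T (charProd ξ ψ)

/-!
A zero-density estimate with the exponent of the density hypothesis, by zero detection and large
values of Dirichlet polynomials. Write `D = k Q² T`; the family of characters `ξψ` has about `k Q²`
members, each of modulus at most `D`.

*Detection.* Let `M(s)` be the partial sum of length `X = D ^ x` of the Dirichlet series of
`1 / L(s, χ)`. The coefficients of `L(s, χ) M(s)` are `1` at `n = 1` and vanish for `1 < n ≤ X`. The
Perron formula with the weight `max (1 - n / Y) 0`, centred at a zero `ρ` with `Re ρ ≥ 1 / 2 + θ`, has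
an integrand without pole at `ρ`, so the line of integration can be moved to `Re s = 1 / 2`. There the
Lindelöf hypothesis makes the integral small, even for `Y` an arbitrarily small power of `D`
(`norm_sum_mollCoeff_le`, `exists_half_le_norm_LSeries`). Hence the part of the sum over
`X < n ≤ Y` is at least `1 / 2` in absolute value at every zero. Only the low zeros of the principal
character escape, because of the pole at `1`. The principal character occurs once in the family, so
these zeros are few.

*Large values.* One dyadic block of that sum is large, of length `N ≤ Y`. Since `N` lies between two
fixed powers of `D`, a bounded power of the block has length `N ^ (h + 1)` between `D ^ (1 + g)` and
`D ^ (1 + 2 g)` (`exists_card_mul_pow_le_of_short`). At this length the points are almost orthogonal: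
by duality the number of large values is governed by smooth sums of `χ χ̄' (n) n ^ (-z)`
(`exists_large_values`), whose moduli times heights are at most about `D`. By Poisson summation
(`exists_norm_tsum_char_twist_le`) these are negligible unless `χ χ̄'` is principal and the two ordinates
are close. Primitivity of `ψ` and coprimality of the modulus to `k` force `χ = χ'` when the quotient
is principal (`charQuot_eq_one`), and Jensen's inequality bounds the number of zeros of one
`L`-function in a short segment (`exists_card_zeros_le`). What remains is the diagonal, which gives
`(D ^ (1 + 2 g)) ^ (2 - 2 α)` up to small powers of `D`.

Multiplicities are bounded by powers of `log D`, again by Jensen's inequality.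
-/

open Complex MeasureTheory Set Filter Topology Asymptotics
open scoped ContDiff FourierTransform ComplexConjugate

/-! ### `L`-functions to the left of the half-plane of convergence -/

/-- `s ↦ (s - 1) L(s, χ)` extends to an entire function. -/
lemma exists_entire_eq_sub_one_mul_LFunction {q : ℕ} [NeZero q] (χ : DirichletCharacter ℂ q) :
    ∃ g : ℂ → ℂ, Differentiable ℂ g ∧ ∀ s, s ≠ 1 → g s = (s - 1) * χ.LFunction s := by
  by_cases h : χ = 1
  · subst h
    exact ⟨_, DirichletCharacter.differentiable_LFunctionTrivChar₁ q, fun s hs => by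
      simp [DirichletCharacter.LFunctionTrivChar₁, DirichletCharacter.LFunctionTrivChar, hs]⟩
  · refine ⟨fun s => (s - 1) * χ.LFunction s, ?_, fun s _ => rfl⟩
    exact (differentiable_id.sub_const 1).mul (DirichletCharacter.differentiable_LFunction h)

/-- The mean value `q⁻¹ ∑_{a ≤ q} χ(a)` of a Dirichlet character. -/
noncomputable def charMean {q : ℕ} (χ : DirichletCharacter ℂ q) : ℂ :=
  (∑ k ∈ Finset.Icc 1 q, χ k) / q

lemma norm_sum_Icc_char_le {q : ℕ} (χ : DirichletCharacter ℂ q) (n : ℕ) :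
    ‖∑ k ∈ Finset.Icc 1 n, χ k‖ ≤ n := by
  refine (norm_sum_le _ _).trans ?_
  refine (Finset.sum_le_sum (g := fun _ => (1 : ℝ)) (fun k _ => χ.norm_le_one _)).trans ?_
  simp

lemma norm_charMean_le {q : ℕ} [NeZero q] (χ : DirichletCharacter ℂ q) : ‖charMean χ‖ ≤ 1 := by
  have hq : (0 : ℝ) < q := by exact_mod_cast NeZero.pos q
  rw [charMean, norm_div, Complex.norm_natCast, div_le_one hq]
  exact norm_sum_Icc_char_le χ q

lemma norm_sum_Icc_char_sub_le {q : ℕ} [NeZero q] (χ : DirichletCharacter ℂ q) (n : ℕ) :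
    ‖∑ k ∈ Finset.Icc 1 n, χ k - charMean χ * n‖ ≤ 2 * q := by
  have hq : (q : ℂ) ≠ 0 := by exact_mod_cast NeZero.ne q
  set F : ℕ → ℂ := fun n => ∑ k ∈ Finset.Icc 1 n, χ k - charMean χ * n with hF
  -- Subtracting the mean makes the partial sums periodic.
  have hper : Function.Periodic F q := by
    intro n
    induction n with
    | zero =>
      simp only [hF, charMean, zero_add]
      rw [div_mul_cancel₀ _ hq]
      simp
    | succ n ih =>
      have h1 : F (n + 1 + q) = F (n + q) + χ ((n + 1 : ℕ) : ZMod q) - charMean χ := by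
        simp only [hF]
        rw [show n + 1 + q = (n + q) + 1 by ring, Finset.sum_Icc_succ_top (by omega)]
        push_cast
        simp only [CharP.cast_eq_zero, add_zero]
        ring
      have h2 : F (n + 1) = F n + χ ((n + 1 : ℕ) : ZMod q) - charMean χ := by
        simp only [hF]
        rw [Finset.sum_Icc_succ_top (by omega)]
        push_cast
        ring
      rw [h1, h2, ih]
  have h := hper.map_mod_nat n
  change ‖F n‖ ≤ _
  rw [← h]
  have hlt : n % q < q := Nat.mod_lt _ (NeZero.pos q)
  have hle : ((n % q : ℕ) : ℝ) ≤ q := by exact_mod_cast hlt.le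
  calc ‖F (n % q)‖ ≤ ‖∑ k ∈ Finset.Icc 1 (n % q), χ k‖ + ‖charMean χ * (n % q : ℕ)‖ := norm_sub_le _ _
    _ ≤ (n % q : ℕ) + 1 * (n % q : ℕ) := by
        refine add_le_add (norm_sum_Icc_char_le χ _) ?_
        rw [norm_mul, Complex.norm_natCast]
        gcongr
        exact norm_charMean_le χ
    _ ≤ 2 * q := by linarith

/-- The error term in the summatory function of `χ`, cut off to `t > 1`. -/
noncomputable def charErr {q : ℕ} (χ : DirichletCharacter ℂ q) : ℝ → ℂ :=
  Set.indicator (Ioi 1) fun t => ∑ k ∈ Finset.Icc 1 ⌊t⌋₊, χ k - charMean χ * t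

lemma norm_charErr_le {q : ℕ} [NeZero q] (χ : DirichletCharacter ℂ q) (t : ℝ) :
    ‖charErr χ t‖ ≤ 3 * q := by
  have hq : (1 : ℝ) ≤ q := by exact_mod_cast NeZero.pos q
  unfold charErr
  by_cases ht : t ∈ Ioi (1 : ℝ)
  · rw [indicator_of_mem ht]
    have ht0 : (0 : ℝ) ≤ t := by have := ht.out; linarith
    have h1 := norm_sum_Icc_char_sub_le χ ⌊t⌋₊
    have h2 : ‖charMean χ * ((⌊t⌋₊ : ℕ) : ℂ) - charMean χ * t‖ ≤ 1 := by
      rw [← mul_sub, norm_mul]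
      have : ‖((⌊t⌋₊ : ℕ) : ℂ) - t‖ ≤ 1 := by
        have e : ((⌊t⌋₊ : ℕ) : ℂ) - t = (((⌊t⌋₊ : ℕ) : ℝ) - t : ℝ) := by push_cast; rfl
        rw [e, Complex.norm_real, Real.norm_eq_abs, abs_le]
        constructor <;> linarith [Nat.floor_le ht0, Nat.lt_floor_add_one t]
      calc _ ≤ 1 * 1 := mul_le_mul (norm_charMean_le χ) this (norm_nonneg _) (by norm_num)
        _ = 1 := by norm_num
    calc _ = ‖(∑ k ∈ Finset.Icc 1 ⌊t⌋₊, χ k - charMean χ * (⌊t⌋₊ : ℕ)) +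
          (charMean χ * (⌊t⌋₊ : ℕ) - charMean χ * t)‖ := by congr 1; ring
      _ ≤ 2 * q + 1 := (norm_add_le _ _).trans (add_le_add h1 h2)
      _ ≤ 3 * q := by linarith
  · rw [indicator_of_notMem ht]; simp

lemma measurable_charErr {q : ℕ} (χ : DirichletCharacter ℂ q) : Measurable (charErr χ) := by
  unfold charErr
  refine Measurable.indicator ?_ measurableSet_Ioi
  refine Measurable.sub ?_ (by fun_prop)
  exact (measurable_from_nat (f := fun n : ℕ => ∑ k ∈ Finset.Icc 1 n, χ k)).comp Nat.measurable_floor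

lemma differentiableAt_mellin_charErr {q : ℕ} [NeZero q] (χ : DirichletCharacter ℂ q) {s : ℂ}
    (hs : s.re < 0) : DifferentiableAt ℂ (mellin (charErr χ)) s := by
  refine mellin_differentiableAt_of_isBigO_rpow (a := 0) (b := s.re - 1) ?_ ?_ hs ?_ (by linarith)
  · refine LocallyIntegrable.locallyIntegrableOn ?_ _
    refine (locallyIntegrable_const (3 * q : ℝ)).mono (measurable_charErr χ).aestronglyMeasurable ?_
    refine Eventually.of_forall fun t => ?_
    simp only [norm_mul, Real.norm_ofNat, RCLike.norm_natCast]
    exact norm_charErr_le χ t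
  · simp only [neg_zero, Real.rpow_zero]
    exact IsBigO.of_bound (3 * q) (Eventually.of_forall fun t => by simpa using norm_charErr_le χ t)
  · refine (Asymptotics.IsBigO.trans (g := fun _ => (0 : ℝ)) ?_ (isBigO_zero _ _))
    refine IsBigO.of_bound 1 ?_
    filter_upwards [Ioo_mem_nhdsGT (show (0 : ℝ) < 1 by norm_num)] with t ht
    simp only [charErr]
    rw [indicator_of_notMem (by simpa using ht.2.le)]
    simp

lemma mellin_charErr {q : ℕ} (χ : DirichletCharacter ℂ q) (s : ℂ) :
    mellin (charErr χ) s =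
      ∫ t in Ioi (1 : ℝ), (∑ k ∈ Finset.Icc 1 ⌊t⌋₊, χ k - charMean χ * t) * (t : ℂ) ^ (s - 1) := by
  have hsub : Ioi (1 : ℝ) ⊆ Ioi 0 := Ioi_subset_Ioi zero_le_one
  rw [mellin]
  have e : ∀ t : ℝ, (t : ℂ) ^ (s - 1) • charErr χ t = Set.indicator (Ioi (1 : ℝ))
      (fun t : ℝ => (∑ k ∈ Finset.Icc 1 ⌊t⌋₊, χ k - charMean χ * t) * (t : ℂ) ^ (s - 1)) t := by
    intro t
    simp only [charErr, smul_eq_mul]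
    by_cases ht : t ∈ Ioi (1 : ℝ)
    · rw [indicator_of_mem ht, indicator_of_mem ht, mul_comm]
    · rw [indicator_of_notMem ht, indicator_of_notMem ht, mul_zero]
  simp_rw [e]
  rw [setIntegral_indicator measurableSet_Ioi, inter_eq_right.mpr hsub]

lemma norm_mellin_charErr_le {q : ℕ} [NeZero q] (χ : DirichletCharacter ℂ q) {s : ℂ}
    (hs : s.re < 0) : ‖mellin (charErr χ) s‖ ≤ 3 * q / (-s.re) := by
  rw [mellin_charErr]
  have hint : IntegrableOn (fun t : ℝ => 3 * (q : ℝ) * t ^ (s.re - 1)) (Ioi 1) :=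
    (integrableOn_Ioi_rpow_of_lt (by linarith) zero_lt_one).const_mul _
  refine (norm_integral_le_of_norm_le hint ?_).trans ?_
  · refine (ae_restrict_mem measurableSet_Ioi).mono fun t ht => ?_
    rw [norm_mul, Complex.norm_cpow_eq_rpow_re_of_pos (by have := ht.out; linarith)]
    have := norm_charErr_le χ t
    simp only [charErr] at this
    rw [indicator_of_mem ht] at this
    simp only [sub_re, one_re]
    gcongr
    exact Real.rpow_nonneg (by have := ht.out; linarith) _
  · rw [integral_const_mul, integral_Ioi_rpow_of_lt (by linarith) zero_lt_one]
    simp only [sub_add_cancel, Real.one_rpow]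
    apply le_of_eq
    have : s.re ≠ 0 := hs.ne
    field_simp

/-- Partial summation: the sum function of `χ` is a linear main term plus `charErr χ`, and the Mellin
transform of the bounded error at `-s` converges whenever `Re s > 0`. -/
lemma LFunction_eq_mellin_of_one_lt {q : ℕ} [NeZero q] (χ : DirichletCharacter ℂ q) {s : ℂ}
    (hs : 1 < s.re) :
    (s - 1) * χ.LFunction s = charMean χ * s + s * (s - 1) * mellin (charErr χ) (-s) := by
  have hs1 : s - 1 ≠ 0 := by
    intro h
    have : s = 1 := by linear_combination h
    simp [this] at hs
  have hO : (fun n : ℕ ↦ ∑ k ∈ Finset.Icc 1 n, χ k) =O[atTop] fun n ↦ (n : ℝ) ^ (1 : ℝ) := by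
    refine IsBigO.of_bound 1 (Eventually.of_forall fun n => ?_)
    simpa using norm_sum_Icc_char_le χ n
  rw [χ.LFunction_eq_LSeries hs, LSeries_eq_mul_integral _ zero_le_one hs
    (χ.LSeriesSummable_of_one_lt_re hs) hO]
  have hI2 : IntegrableOn (fun t : ℝ => (charMean χ * t) * (t : ℂ) ^ (-s - 1)) (Ioi 1) := by
    have : IntegrableOn (fun t : ℝ => charMean χ * (t : ℂ) ^ (-s)) (Ioi 1) :=
      (integrableOn_Ioi_cpow_of_lt (by simp; linarith) zero_lt_one).const_mul _
    refine this.congr_fun (fun t ht => ?_) measurableSet_Ioi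
    have ht0 : (t : ℂ) ≠ 0 := by
      have : (0 : ℝ) < t := by have := ht.out; linarith
      exact_mod_cast this.ne'
    have e : (t : ℂ) ^ (-s) = (t : ℂ) ^ (-s - 1) * t := by
      rw [cpow_sub _ _ ht0, cpow_one, div_mul_cancel₀ _ ht0]
    simp only [e]
    ring
  have hI1 : IntegrableOn (fun t : ℝ => (∑ k ∈ Finset.Icc 1 ⌊t⌋₊, χ k - charMean χ * t)
      * (t : ℂ) ^ (-s - 1)) (Ioi 1) := by
    have hint : IntegrableOn (fun t : ℝ => 3 * (q : ℝ) * t ^ (-s.re - 1)) (Ioi 1) :=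
      (integrableOn_Ioi_rpow_of_lt (by linarith) zero_lt_one).const_mul _
    refine Integrable.mono' hint ?_ ?_
    · refine Measurable.aestronglyMeasurable ?_
      refine Measurable.mul ?_ (by fun_prop)
      refine Measurable.sub ?_ (by fun_prop)
      exact (measurable_from_nat (f := fun n : ℕ => ∑ k ∈ Finset.Icc 1 n, χ k)).comp
        Nat.measurable_floor
    · refine (ae_restrict_mem measurableSet_Ioi).mono fun t ht => ?_
      rw [norm_mul, Complex.norm_cpow_eq_rpow_re_of_pos (by have := ht.out; linarith)]
      have := norm_charErr_le χ t
      simp only [charErr] at this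
      rw [indicator_of_mem ht] at this
      simp only [sub_re, one_re, neg_re]
      gcongr
      exact Real.rpow_nonneg (by have := ht.out; linarith) _
  have hmain : ∫ t in Set.Ioi (1 : ℝ), (∑ k ∈ Finset.Icc 1 ⌊t⌋₊, χ k) * (t : ℂ) ^ (-(s + 1)) =
      mellin (charErr χ) (-s) + charMean χ / (s - 1) := by
    have e2 : ∫ t in Ioi (1 : ℝ), (charMean χ * t) * (t : ℂ) ^ (-s - 1) = charMean χ / (s - 1) := by
      have : ∫ t in Ioi (1 : ℝ), charMean χ * (t : ℂ) ^ (-s) = charMean χ / (s - 1) := by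
        rw [integral_const_mul, integral_Ioi_cpow_of_lt (by simp; linarith) zero_lt_one]
        have : -s + 1 ≠ 0 := fun h => hs1 (by linear_combination -h)
        simp only [ofReal_one, one_cpow]
        field_simp
        ring
      rw [← this]
      refine setIntegral_congr_fun measurableSet_Ioi fun t ht => ?_
      have ht0 : (t : ℂ) ≠ 0 := by
        have : (0 : ℝ) < t := by have := ht.out; linarith
        exact_mod_cast this.ne'
      have e : (t : ℂ) ^ (-s) = (t : ℂ) ^ (-s - 1) * t := by
        rw [cpow_sub _ _ ht0, cpow_one, div_mul_cancel₀ _ ht0]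
      simp only [e]
      ring
    rw [mellin_charErr, ← e2, ← integral_add hI1 hI2]
    refine setIntegral_congr_fun measurableSet_Ioi fun t ht => ?_
    rw [show -(s + 1) = -s - 1 by ring]
    ring
  rw [hmain]
  field_simp
  ring

/-- Polynomial bound for `(s - 1) L(s, χ)` to the left of the critical line. -/
lemma norm_entire_LFunction_le {q : ℕ} [NeZero q] (χ : DirichletCharacter ℂ q) {g : ℂ → ℂ}
    (hg : Differentiable ℂ g) (hgL : ∀ s, s ≠ 1 → g s = (s - 1) * χ.LFunction s) {s : ℂ}
    (hs : 1 / 4 ≤ s.re) : ‖g s‖ ≤ 13 * q * (‖s‖ + 1) ^ 2 := by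
  have hopen : IsOpen {z : ℂ | 0 < z.re} := isOpen_lt continuous_const continuous_re
  have hG : AnalyticOnNhd ℂ (fun s => charMean χ * s + s * (s - 1) * mellin (charErr χ) (-s))
      {z : ℂ | 0 < z.re} := by
    refine DifferentiableOn.analyticOnNhd (fun z hz => DifferentiableAt.differentiableWithinAt ?_)
      hopen
    have : DifferentiableAt ℂ (fun s => mellin (charErr χ) (-s)) z :=
      DifferentiableAt.comp (g := mellin (charErr χ)) (f := fun s => -s) z
        (differentiableAt_mellin_charErr χ (by simpa using hz)) differentiableAt_id.neg
    fun_prop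
  -- The identity for `Re z > 1` continues to `Re z > 0`.
  have heq := AnalyticOnNhd.eqOn_of_preconnected_of_eventuallyEq
    (hg.differentiableOn.analyticOnNhd hopen) hG
    (convex_halfSpace_re_gt 0).isPreconnected (z₀ := 2) (by simp) (by
      have : {z : ℂ | 1 < z.re} ∈ 𝓝 (2 : ℂ) :=
        (isOpen_lt continuous_const continuous_re).mem_nhds (by simp)
      filter_upwards [this] with z hz
      have hz1 : z ≠ 1 := by rintro rfl; simp at hz
      rw [hgL z hz1, LFunction_eq_mellin_of_one_lt χ hz])
  have hq : (1 : ℝ) ≤ q := by exact_mod_cast NeZero.pos q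
  rw [heq (show s ∈ {z : ℂ | 0 < z.re} from lt_of_lt_of_le (by norm_num) hs)]
  have h1 : ‖mellin (charErr χ) (-s)‖ ≤ 12 * q := by
    refine (norm_mellin_charErr_le χ (by simp; linarith)).trans ?_
    simp only [neg_re, neg_neg]
    rw [div_le_iff₀ (by linarith)]
    nlinarith
  have h2 : ‖s - 1‖ ≤ ‖s‖ + 1 := (norm_sub_le _ _).trans (by simp)
  have h0 := norm_nonneg s
  calc _ ≤ ‖charMean χ * s‖ + ‖s * (s - 1) * mellin (charErr χ) (-s)‖ := norm_add_le _ _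
    _ ≤ 1 * ‖s‖ + ‖s‖ * (‖s‖ + 1) * (12 * q) := by
      rw [norm_mul, norm_mul, norm_mul]
      gcongr
      exact norm_charMean_le χ
    _ ≤ 13 * q * (‖s‖ + 1) ^ 2 := by
      have : ‖s‖ * (‖s‖ + 1) ≤ (‖s‖ + 1) ^ 2 := by nlinarith
      have h3 : ‖s‖ ≤ (‖s‖ + 1) ^ 2 := by nlinarith
      nlinarith [mul_le_mul_of_nonneg_left this (by linarith : (0 : ℝ) ≤ 12 * q),
        mul_le_mul hq h3 h0 (by linarith)]

/-! ### Zeros of one `L`-function -/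

lemma norm_term_le_one_div_sq {f : ℕ → ℂ} (hf : ∀ n, ‖f n‖ ≤ 1) {s : ℂ} (hs : 2 ≤ s.re)
    (n : ℕ) : ‖LSeries.term f s n‖ ≤ 1 / (n : ℝ) ^ 2 := by
  rcases eq_or_ne n 0 with rfl | hn
  · simp
  have hn0 : 1 ≤ (n : ℝ) := by exact_mod_cast Nat.one_le_iff_ne_zero.mpr hn
  rw [LSeries.norm_term_eq, if_neg hn]
  refine div_le_div₀ zero_le_one (hf n) (by positivity) ?_
  rw [← Real.rpow_natCast]
  exact Real.rpow_le_rpow_of_exponent_le hn0 (by simpa using hs)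

lemma LSeriesSummable_of_norm_le_one {f : ℕ → ℂ} (hf : ∀ n, ‖f n‖ ≤ 1) {s : ℂ} (hs : 2 ≤ s.re) :
    LSeriesSummable f s :=
  Summable.of_norm_bounded hasSum_zeta_two.summable (norm_term_le_one_div_sq hf hs)

lemma tsum_norm_term_le_two {f : ℕ → ℂ} (hf : ∀ n, ‖f n‖ ≤ 1) {s : ℂ} (hs : 2 ≤ s.re) :
    ∑' n, ‖LSeries.term f s n‖ ≤ 2 := by
  have h := Summable.tsum_le_tsum (norm_term_le_one_div_sq hf hs)
    (LSeriesSummable_of_norm_le_one hf hs).norm hasSum_zeta_two.summable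
  rw [hasSum_zeta_two.tsum_eq] at h
  have := Real.pi_lt_d2
  have := Real.pi_pos
  nlinarith

lemma norm_LSeries_le_two {f : ℕ → ℂ} (hf : ∀ n, ‖f n‖ ≤ 1) {s : ℂ} (hs : 2 ≤ s.re) :
    ‖LSeries f s‖ ≤ 2 :=
  (norm_tsum_le_tsum_norm (LSeriesSummable_of_norm_le_one hf hs).norm).trans
    (tsum_norm_term_le_two hf hs)

lemma norm_LFunction_le_two {q : ℕ} [NeZero q] (χ : DirichletCharacter ℂ q) {s : ℂ}
    (hs : 2 ≤ s.re) : ‖χ.LFunction s‖ ≤ 2 := by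
  rw [χ.LFunction_eq_LSeries (by linarith)]
  exact norm_LSeries_le_two (fun n => χ.norm_le_one _) hs

lemma half_le_norm_LFunction {q : ℕ} [NeZero q] (χ : DirichletCharacter ℂ q) {s : ℂ}
    (hs : 2 ≤ s.re) : 1 / 2 ≤ ‖χ.LFunction s‖ := by
  have h := DirichletCharacter.LSeries.mul_mu_eq_one χ (s := s) (by linarith)
  rw [← χ.LFunction_eq_LSeries (by linarith)] at h
  have h2 : ‖LSeries ((fun n : ℕ => χ n) * fun n : ℕ => (ArithmeticFunction.moebius n : ℂ)) s‖
      ≤ 2 := by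
    refine norm_LSeries_le_two (fun n => ?_) hs
    rw [Pi.mul_apply, norm_mul]
    refine mul_le_one₀ (χ.norm_le_one _) (norm_nonneg _) ?_
    have := ArithmeticFunction.abs_moebius_le_one (n := n)
    rw [Complex.norm_intCast]
    exact_mod_cast this
  have h3 := congrArg norm h
  rw [norm_mul, norm_one] at h3
  nlinarith [norm_nonneg (χ.LFunction s)]

/-- The zeros of `L(s, χ)` and of its entire multiple agree, with multiplicity, away from
`s = 1`. -/
lemma analyticOrderAt_LFunction_eq {q : ℕ} [NeZero q] (χ : DirichletCharacter ℂ q) {g : ℂ → ℂ}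
    (hgL : ∀ s, s ≠ 1 → g s = (s - 1) * χ.LFunction s) {ρ : ℂ} (hρ : ρ ≠ 1) :
    analyticOrderAt g ρ = analyticOrderAt χ.LFunction ρ := by
  have hopen : ({1}ᶜ : Set ℂ) ∈ 𝓝 ρ := isOpen_compl_singleton.mem_nhds hρ
  have hL : AnalyticAt ℂ χ.LFunction ρ :=
    DifferentiableOn.analyticAt (s := {1}ᶜ) (fun z hz =>
      (χ.differentiableAt_LFunction z (Or.inl hz)).differentiableWithinAt) hopen
  have he : g =ᶠ[𝓝 ρ] (fun s => s - 1) * χ.LFunction := by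
    filter_upwards [hopen] with z hz
    exact hgL z hz
  have h1 : AnalyticAt ℂ (fun s : ℂ => s - 1) ρ := by fun_prop
  rw [analyticOrderAt_congr he, analyticOrderAt_mul h1 hL,
    h1.analyticOrderAt_eq_zero.mpr (sub_ne_zero.mpr hρ), zero_add]

/-- **Zeros in a unit box.** The zeros `ρ ≠ 1` of `L(s, χ)` with `Re ρ ≥ 1/2` and
`|Im ρ - t| ≤ 1/2` number, with multiplicity, `O(log (q (|t| + 2)))`. -/
lemma exists_sum_order_le_log : ∃ C : ℝ, 0 < C ∧ ∀ (q : ℕ) [NeZero q] (χ : DirichletCharacter ℂ q)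
    (t : ℝ) (F : Finset ℂ), (∀ ρ ∈ F, χ.LFunction ρ = 0 ∧ ρ ≠ 1 ∧ 1 / 2 ≤ ρ.re ∧
      |ρ.im - t| ≤ 1 / 2) →
    (∀ ρ ∈ F, analyticOrderAt χ.LFunction ρ ≠ ⊤ ∧ 1 ≤ analyticOrderNatAt χ.LFunction ρ) ∧
    ((∑ ρ ∈ F, analyticOrderNatAt χ.LFunction ρ : ℕ) : ℝ) ≤ C * Real.log (q * (|t| + 2)) := by
  have hl : 0 < Real.log ((7 / 4) / (8 / 5)) := Real.log_pos (by norm_num)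
  refine ⟨10 / Real.log ((7 / 4) / (8 / 5)), by positivity, ?_⟩
  intro q _ χ t F hF
  obtain ⟨g, hg, hgL⟩ := exists_entire_eq_sub_one_mul_LFunction χ
  set c : ℂ := 2 + t * I with hc
  have hcre : c.re = 2 := by simp [hc]
  have hcim : c.im = t := by simp [hc]
  have hgc : 1 / 2 ≤ ‖g c‖ := by
    rw [hgL c (by intro h; rw [h] at hcre; simp at hcre), norm_mul]
    have h1 : 1 ≤ ‖c - 1‖ := by
      refine le_trans ?_ (Complex.abs_re_le_norm _)
      rw [sub_re, hcre]; norm_num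
    have := half_le_norm_LFunction χ (s := c) hcre.ge
    nlinarith
  have hgc0 : g c ≠ 0 := by
    intro h; rw [h] at hgc; norm_num at hgc
  have hq : (1 : ℝ) ≤ q := by exact_mod_cast NeZero.pos q
  have ht := abs_nonneg t
  set M : ℝ := 13 * q * (|t| + 5) ^ 2 with hM
  have hM1 : 1 ≤ M := by
    have : (1 : ℝ) ≤ (|t| + 5) ^ 2 := by nlinarith
    rw [hM]; nlinarith
  have hgan : ∀ U, AnalyticOnNhd ℂ g U := fun U z _ => hg.analyticAt z
  have hbd : ∀ z ∈ Metric.sphere c |(7 / 4 : ℝ)|, ‖g z‖ ≤ M := by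
    intro z hz
    rw [abs_of_pos (by norm_num), mem_sphere_iff_norm] at hz
    have h1 : 1 / 4 ≤ z.re := by
      have := (Complex.abs_re_le_norm (z - c)).trans hz.le
      rw [sub_re, hcre, abs_le] at this
      linarith
    have h2 : ‖z‖ ≤ |t| + 4 := by
      have h3 : ‖c‖ ≤ 2 + |t| := by
        refine (norm_add_le _ _).trans ?_
        simp
      have : ‖z‖ ≤ ‖z - c‖ + ‖c‖ := by simpa using norm_add_le (z - c) c
      linarith
    refine (norm_entire_LFunction_le χ hg hgL h1).trans ?_
    have h4 : (‖z‖ + 1) ^ 2 ≤ (|t| + 5) ^ 2 :=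
      pow_le_pow_left₀ (by positivity) (by linarith) 2
    rw [hM]
    gcongr
  -- Jensen's inequality on discs about `2 + t I` that contain the box.
  have hJ := AnalyticOnNhd.sum_divisor_le (c := c) (r := 8 / 5) (R := 7 / 4) (M := M) (f := g)
    (by norm_num) (by rw [abs_of_pos, abs_of_pos] <;> norm_num) hM1 (hgan _) hgc0 hbd
  rw [abs_of_pos (by norm_num : (0 : ℝ) < 8 / 5)] at hJ
  have hball : ∀ ρ ∈ F, ρ ∈ Metric.closedBall c (8 / 5) := by
    intro ρ hρ
    obtain ⟨h0, h1, h2, h3⟩ := hF ρ hρ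
    rw [mem_closedBall_iff_norm]
    have hre1 : ρ.re < 1 := by
      by_contra h
      exact χ.LFunction_ne_zero_of_one_le_re (Or.inr h1) (not_lt.mp h) h0
    refine abs_le_of_sq_le_sq' ?_ (by norm_num) |>.2
    rw [← Complex.normSq_eq_norm_sq, Complex.normSq_apply, sub_re, sub_im, hcre, hcim]
    rw [abs_le] at h3
    nlinarith
  have htop : ∀ ρ : ℂ, analyticOrderAt g ρ ≠ ⊤ := by
    intro ρ h
    have h1 := (hgan univ).analyticOrderAt_ne_top_of_isPreconnected isPreconnected_univ
      (x := c) (y := ρ) (mem_univ _) (mem_univ _)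
      (by rw [(hg.analyticAt c).analyticOrderAt_eq_zero.mpr hgc0]; simp)
    exact h1 h
  have hord : ∀ ρ ∈ F, analyticOrderAt g ρ = analyticOrderAt χ.LFunction ρ := fun ρ hρ =>
    analyticOrderAt_LFunction_eq χ hgL (hF ρ hρ).2.1
  refine ⟨fun ρ hρ => ⟨hord ρ hρ ▸ htop ρ, ?_⟩, ?_⟩
  · rw [analyticOrderNatAt, ← hord ρ hρ, Nat.one_le_iff_ne_zero, Ne, ENat.toNat_eq_zero, not_or]
    refine ⟨?_, htop ρ⟩
    change analyticOrderAt g ρ ≠ 0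
    rw [(hg.analyticAt ρ).analyticOrderAt_ne_zero, hgL ρ (hF ρ hρ).2.1, (hF ρ hρ).1, mul_zero]
  · have hdiv : ∀ ρ ∈ F, MeromorphicOn.divisor g (Metric.closedBall c (8 / 5)) ρ =
        analyticOrderNatAt χ.LFunction ρ := by
      intro ρ hρ
      rw [MeromorphicOn.AnalyticOnNhd.divisor_apply (hgan _) (hball ρ hρ), analyticOrderNatAt,
        ← hord ρ hρ]
      obtain ⟨n, hn⟩ := ENat.ne_top_iff_exists.mp (htop ρ)
      rw [← hn]
      simp
    have hsum : ((∑ ρ ∈ F, analyticOrderNatAt χ.LFunction ρ : ℕ) : ℤ) ≤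
        ∑ᶠ u, MeromorphicOn.divisor g (Metric.closedBall c (8 / 5)) u := by
      have hfin : (Function.support (MeromorphicOn.divisor g
          (Metric.closedBall c (8 / 5)))).Finite :=
        (MeromorphicOn.divisor g (Metric.closedBall c (8 / 5))).finiteSupport
          (isCompact_closedBall c (8 / 5))
      rw [finsum_eq_sum _ hfin]
      push_cast
      have hsub : F ⊆ hfin.toFinset ∪ F := Finset.subset_union_right
      have e : ∑ u ∈ hfin.toFinset, MeromorphicOn.divisor g (Metric.closedBall c (8 / 5)) u =
          ∑ u ∈ hfin.toFinset ∪ F, MeromorphicOn.divisor g (Metric.closedBall c (8 / 5)) u := by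
        refine Finset.sum_subset Finset.subset_union_left fun x _ hx => ?_
        simpa using hx
      rw [e, ← Finset.sum_congr rfl hdiv]
      refine Finset.sum_le_sum_of_subset_of_nonneg hsub fun u _ _ => ?_
      exact MeromorphicOn.AnalyticOnNhd.divisor_nonneg (hgan _) u
    have hsum' : ((∑ ρ ∈ F, analyticOrderNatAt χ.LFunction ρ : ℕ) : ℝ) ≤
        ((∑ᶠ u, MeromorphicOn.divisor g (Metric.closedBall c (8 / 5)) u : ℤ) : ℝ) := by
      exact_mod_cast hsum
    refine hsum'.trans (hJ.trans ?_)
    rw [div_mul_eq_mul_div]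
    refine div_le_div_of_nonneg_right ?_ hl.le
    set x : ℝ := q * (|t| + 2) with hx
    have hx2 : 2 ≤ x := by nlinarith
    rw [show (10 : ℝ) * Real.log x = Real.log (x ^ 10) by rw [Real.log_pow]; norm_num]
    refine Real.log_le_log (by positivity) ?_
    rw [div_le_iff₀ (by positivity)]
    have hx10 : x ^ 2 * 2 ^ 8 ≤ x ^ 10 := by
      have : (2 : ℝ) ^ 8 ≤ x ^ 8 := pow_le_pow_left₀ (by norm_num) hx2 8
      nlinarith [sq_nonneg x]
    have hx3 : q * (|t| + 2) ^ 2 ≤ x ^ 2 := by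
      rw [hx, mul_pow]
      have : (q : ℝ) ≤ (q : ℝ) ^ 2 := by nlinarith
      exact mul_le_mul_of_nonneg_right this (sq_nonneg _)
    have h5 : (|t| + 5) ^ 2 ≤ 25 / 4 * (|t| + 2) ^ 2 := by nlinarith
    have h6 : M ≤ 13 * 25 / 4 * x ^ 2 := by
      rw [hM]
      nlinarith [mul_le_mul_of_nonneg_left h5 (by linarith : (0 : ℝ) ≤ 13 * q)]
    have h7 : x ^ 10 * (1 / 2) ≤ x ^ 10 * ‖g c‖ :=
      mul_le_mul_of_nonneg_left hgc (by positivity)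
    nlinarith [sq_nonneg x]

/-- **Zeros in a vertical strip segment.** In a segment of height `2H` up to height `V` the
number of distinct zeros is `O(H log (q (V + 4)))`, and each has multiplicity
`O(log (q (V + 4)))`. -/
lemma exists_card_zeros_le : ∃ C : ℝ, 0 < C ∧ ∀ (q : ℕ) [NeZero q] (χ : DirichletCharacter ℂ q)
    (t H V : ℝ) (F : Finset ℂ), 1 ≤ H → 0 ≤ V → (∀ ρ ∈ F, χ.LFunction ρ = 0 ∧ ρ ≠ 1 ∧
      1 / 2 ≤ ρ.re ∧ |ρ.im - t| ≤ H ∧ |ρ.im| ≤ V) →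
    (F.card : ℝ) ≤ C * H * Real.log (q * (V + 4)) ∧
    ∀ ρ ∈ F, analyticOrderAt χ.LFunction ρ ≠ ⊤ ∧
      (analyticOrderNatAt χ.LFunction ρ : ℝ) ≤ C * Real.log (q * (V + 4)) := by
  obtain ⟨C, hC, h⟩ := exists_sum_order_le_log
  refine ⟨4 * C, by positivity, ?_⟩
  intro q _ χ t H V F hH hV hF
  have hq : (1 : ℝ) ≤ q := by exact_mod_cast NeZero.pos q
  have hlog : 0 ≤ Real.log (q * (V + 4)) := Real.log_nonneg (by nlinarith)
  have hmono : ∀ u : ℝ, |u| ≤ V + 2 → C * Real.log (q * (|u| + 2)) ≤ C * Real.log (q * (V + 4)) := by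
    intro u hu
    have : 0 ≤ |u| := abs_nonneg u
    exact mul_le_mul_of_nonneg_left (Real.log_le_log (by positivity)
      (mul_le_mul_of_nonneg_left (by linarith) (by linarith))) hC.le
  constructor
  · have hfib : ∀ b ∈ F.image (fun ρ : ℂ => ⌊ρ.im⌋),
        (F.filter fun ρ : ℂ => ⌊ρ.im⌋ = b).card ≤ ⌊C * Real.log (q * (V + 4))⌋₊ := by
      intro b hb
      obtain ⟨ρ₀, hρ₀, hb⟩ := Finset.mem_image.mp hb
      have key : ∀ ρ : ℂ, ⌊ρ.im⌋ = b → |ρ.im - (b + 1 / 2)| ≤ 1 / 2 := by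
        intro ρ hρ
        have h1 := Int.floor_le ρ.im
        have h2 := Int.lt_floor_add_one ρ.im
        rw [hρ] at h1 h2
        rw [abs_le]; constructor <;> linarith
      obtain ⟨h1, h2⟩ := h q χ (b + 1 / 2) (F.filter fun ρ : ℂ => ⌊ρ.im⌋ = b) (by
        intro ρ hρ
        rw [Finset.mem_filter] at hρ
        obtain ⟨a1, a2, a3, a4, a5⟩ := hF ρ hρ.1
        exact ⟨a1, a2, a3, key ρ hρ.2⟩)
      rw [Nat.le_floor_iff (by positivity)]
      have h3 : (F.filter fun ρ : ℂ => ⌊ρ.im⌋ = b).card ≤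
          ∑ ρ ∈ F.filter (fun ρ : ℂ => ⌊ρ.im⌋ = b), analyticOrderNatAt χ.LFunction ρ := by
        rw [Finset.card_eq_sum_ones]
        exact Finset.sum_le_sum fun ρ hρ => (h1 ρ hρ).2
      refine le_trans (by exact_mod_cast h3) (h2.trans (hmono _ ?_))
      have a5 := (hF ρ₀ hρ₀).2.2.2.2
      have a6 := key ρ₀ hb
      rw [abs_le] at a5 a6 ⊢
      constructor <;> linarith
    have h1 := Finset.card_le_mul_card_image F _ hfib
    have h2 : (F.image (fun ρ : ℂ => ⌊ρ.im⌋)).card ≤ (Finset.Icc ⌊t - H⌋ ⌊t + H⌋).card := by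
      refine Finset.card_le_card fun b hb => ?_
      obtain ⟨ρ, hρ, rfl⟩ := Finset.mem_image.mp hb
      have := (hF ρ hρ).2.2.2.1
      rw [abs_le] at this
      rw [Finset.mem_Icc]
      exact ⟨Int.floor_le_floor (by linarith), Int.floor_le_floor (by linarith)⟩
    have h3 : ((Finset.Icc ⌊t - H⌋ ⌊t + H⌋).card : ℝ) ≤ 4 * H := by
      rw [Int.card_Icc]
      have a1 := Int.floor_le (t + H)
      have a2 := Int.lt_floor_add_one (t - H)
      have a3 : ⌊t - H⌋ ≤ ⌊t + H⌋ := Int.floor_le_floor (by linarith)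
      have a4 : (((⌊t + H⌋ + 1 - ⌊t - H⌋).toNat : ℤ) : ℝ) = ((⌊t + H⌋ + 1 - ⌊t - H⌋ : ℤ) : ℝ) := by
        rw [Int.toNat_of_nonneg (by linarith)]
      push_cast at a4 ⊢
      rw [a4]
      linarith
    calc (F.card : ℝ) ≤ (⌊C * Real.log (q * (V + 4))⌋₊ : ℝ) *
          ((F.image (fun ρ : ℂ => ⌊ρ.im⌋)).card : ℝ) := by exact_mod_cast h1
      _ ≤ (C * Real.log (q * (V + 4))) * (4 * H) := by
        gcongr
        · exact Nat.floor_le (by positivity)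
        · exact le_trans (by exact_mod_cast h2) h3
      _ = 4 * C * H * Real.log (q * (V + 4)) := by ring
  · intro ρ hρ
    obtain ⟨a1, a2, a3, a4, a5⟩ := hF ρ hρ
    obtain ⟨h1, h2⟩ := h q χ ρ.im {ρ} (by
      intro z hz
      rw [Finset.mem_singleton] at hz
      subst hz
      exact ⟨a1, a2, a3, by simp⟩)
    refine ⟨(h1 ρ (by simp)).1, ?_⟩
    rw [Finset.sum_singleton] at h2
    refine h2.trans ((hmono _ (by linarith)).trans ?_)
    nlinarith [mul_nonneg hC.le hlog]

/-! ### Smooth character sums -/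

/-- Smooth functions on `ℝ` that vanish outside `[a, b]`. -/
structure IsBumpOn (a b : ℝ) (w : ℝ → ℂ) : Prop where
  smooth : ContDiff ℝ ∞ w
  zero : ∀ x, x ∉ Icc a b → w x = 0

namespace IsBumpOn

variable {a b : ℝ} {w : ℝ → ℂ}

lemma eventually_zero (hw : IsBumpOn a b w) {x : ℝ} (hx : x ∉ Icc a b) : w =ᶠ[𝓝 x] 0 := by
  filter_upwards [isClosed_Icc.isOpen_compl.mem_nhds hx] with y hy
  exact hw.zero y hy

lemma deriv (hw : IsBumpOn a b w) : IsBumpOn a b (deriv w) where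
  smooth := by
    have := hw.smooth.iterate_deriv 1
    simpa using this
  zero x hx := by
    rw [(hw.eventually_zero hx).deriv_eq]
    simp

lemma iteratedDeriv (hw : IsBumpOn a b w) (n : ℕ) : IsBumpOn a b (iteratedDeriv n w) := by
  induction n with
  | zero => simpa using hw
  | succ n ih => rw [iteratedDeriv_succ]; exact ih.deriv

lemma hasCompactSupport (hw : IsBumpOn a b w) : HasCompactSupport w :=
  HasCompactSupport.intro isCompact_Icc hw.zero

lemma integrable (hw : IsBumpOn a b w) : Integrable w :=
  hw.smooth.continuous.integrable_of_hasCompactSupport hw.hasCompactSupport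

lemma exists_bound (hw : IsBumpOn a b w) : ∃ C : ℝ, 0 ≤ C ∧ ∀ x, ‖w x‖ ≤ C := by
  obtain ⟨C, hC⟩ := hw.hasCompactSupport.exists_bound_of_continuous hw.smooth.continuous
  exact ⟨max C 0, le_max_right _ _, fun x => (hC x).trans (le_max_left _ _)⟩

lemma integral_norm_le (hw : IsBumpOn a b w) (hab : a ≤ b) {C : ℝ} (hC : ∀ x, ‖w x‖ ≤ C) :
    ∫ x, ‖w x‖ ≤ (b - a) * C := by
  have h : ∫ x in Icc a b, ‖w x‖ = ∫ x, ‖w x‖ :=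
    setIntegral_eq_integral_of_forall_compl_eq_zero fun x hx => by rw [hw.zero x hx, norm_zero]
  rw [← h]
  have := norm_setIntegral_le_of_norm_le_const (μ := volume) (s := Icc a b)
    (f := fun x => ‖w x‖) (C := C) (by simp) (fun x _ => by simpa using hC x)
  rw [Real.norm_of_nonneg (integral_nonneg fun x => norm_nonneg _)] at this
  rw [Real.volume_real_Icc_of_le hab] at this
  linarith

lemma mul_of_contDiffAt (ha : 0 < a) (hw : IsBumpOn a b w) {f : ℝ → ℂ}
    (hf : ∀ x, x ≠ 0 → ContDiffAt ℝ ∞ f x) : IsBumpOn a b (fun x => f x * w x) where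
  smooth := by
    rw [contDiff_iff_contDiffAt]
    intro x
    rcases eq_or_ne x 0 with rfl | hx
    · have h0 : (0 : ℝ) ∉ Icc a b := fun h => absurd h.1 (not_le.mpr ha)
      refine ContDiffAt.congr_of_eventuallyEq (contDiffAt_const (c := (0 : ℂ))) ?_
      filter_upwards [hw.eventually_zero h0] with y hy
      simp [hy]
    · exact (hf x hx).mul hw.smooth.contDiffAt
  zero x hx := by simp [hw.zero x hx]

end IsBumpOn

/-- `twist z w x = x ^ (-z) w(x)` for `x > 0`, written with the real logarithm. -/
noncomputable def twist (z : ℂ) (w : ℝ → ℂ) (x : ℝ) : ℂ := exp (-z * Real.log x) * w x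

namespace IsBumpOn

variable {a b : ℝ} {w : ℝ → ℂ}

lemma twist (ha : 0 < a) (hw : IsBumpOn a b w) (z : ℂ) : IsBumpOn a b (twist z w) := by
  refine hw.mul_of_contDiffAt ha fun x hx => ?_
  have h1 : ContDiffAt ℝ ∞ (fun x : ℝ => ((Real.log x : ℝ) : ℂ)) x :=
    Complex.ofRealCLM.contDiff.contDiffAt.comp x (Real.contDiffAt_log.mpr hx)
  exact (contDiffAt_const.mul h1).cexp

lemma div_id (ha : 0 < a) (hw : IsBumpOn a b w) : IsBumpOn a b (fun x => (x : ℂ)⁻¹ * w x) := by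
  refine hw.mul_of_contDiffAt ha fun x hx => ?_
  have h1 : ContDiffAt ℝ ∞ (fun x : ℝ => (x : ℂ)) x := Complex.ofRealCLM.contDiff.contDiffAt
  exact h1.inv (by exact_mod_cast hx)

lemma id_mul (ha : 0 < a) (hw : IsBumpOn a b w) : IsBumpOn a b (fun x => (x : ℂ) * w x) :=
  hw.mul_of_contDiffAt ha fun _ _ => Complex.ofRealCLM.contDiff.contDiffAt

lemma hasDerivAt_twist (ha : 0 < a) (hw : IsBumpOn a b w) (z : ℂ) (x : ℝ) :
    HasDerivAt (_root_.twist z w)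
      (-z * _root_.twist z (fun x => (x : ℂ)⁻¹ * w x) x + _root_.twist z (_root_.deriv w) x) x := by
  by_cases hx : x ∈ Icc a b
  · have hx0 : x ≠ 0 := by have := hx.1; linarith
    have h1 : HasDerivAt (fun x : ℝ => ((Real.log x : ℝ) : ℂ)) ((x⁻¹ : ℝ) : ℂ) x :=
      (Real.hasDerivAt_log hx0).ofReal_comp
    have h2 := ((h1.const_mul (-z)).cexp).mul
      ((hw.smooth.differentiable (by simp)) x).hasDerivAt
    refine h2.congr_deriv ?_
    simp only [_root_.twist]
    push_cast
    ring
  · have h0 : _root_.twist z w =ᶠ[𝓝 x] fun _ => 0 := (hw.twist ha z).eventually_zero hx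
    refine ((hasDerivAt_const x (0 : ℂ)).congr_of_eventuallyEq h0).congr_deriv ?_
    simp only [_root_.twist]
    rw [hw.zero x hx, hw.deriv.zero x hx]
    simp

lemma norm_twist_le {a b : ℝ} {w : ℝ → ℂ} (ha : 0 < a) (hw : IsBumpOn a b w) {C : ℝ}
    (hC : ∀ x, ‖w x‖ ≤ C) {z : ℂ} (hz0 : 0 ≤ z.re) (hz2 : z.re ≤ 2) (x : ℝ) :
    ‖_root_.twist z w x‖ ≤ Real.exp (2 * (|Real.log a| + |Real.log b|)) * C := by
  have hC0 : 0 ≤ C := (norm_nonneg _).trans (hC 0)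
  by_cases hx : x ∈ Icc a b
  · rw [_root_.twist, norm_mul, Complex.norm_exp]
    refine mul_le_mul (Real.exp_le_exp.mpr ?_) (hC x) (norm_nonneg _) (Real.exp_pos _).le
    simp only [neg_mul, neg_re, mul_re, ofReal_re, ofReal_im, mul_zero, sub_zero]
    have h1 : Real.log a ≤ Real.log x := Real.log_le_log ha hx.1
    have h3 := neg_abs_le (Real.log a)
    have h5 := abs_nonneg (Real.log a)
    have h6 := abs_nonneg (Real.log b)
    nlinarith [mul_le_mul_of_nonneg_left h1 hz0]
  · rw [(hw.twist ha z).zero x hx, norm_zero]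
    positivity

/-- Differentiating `x ^ (-z) w(x)` costs a factor `1 + |z|` each time. -/
lemma exists_norm_iteratedDeriv_twist_le (ha : 0 < a) (A : ℕ) :
    ∀ {w : ℝ → ℂ}, IsBumpOn a b w → ∃ C : ℝ, 0 ≤ C ∧ ∀ z : ℂ, 0 ≤ z.re → z.re ≤ 2 → ∀ x,
      ‖_root_.iteratedDeriv A (_root_.twist z w) x‖ ≤ C * (1 + ‖z‖) ^ A := by
  induction A with
  | zero =>
    intro w hw
    obtain ⟨C, hC0, hC⟩ := hw.exists_bound
    refine ⟨Real.exp (2 * (|Real.log a| + |Real.log b|)) * C, by positivity, fun z h0 h2 x => ?_⟩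
    simpa using hw.norm_twist_le ha hC h0 h2 x
  | succ A ih =>
    intro w hw
    obtain ⟨C1, hC1, h1⟩ := ih (hw.div_id ha)
    obtain ⟨C2, hC2, h2⟩ := ih hw.deriv
    refine ⟨C1 + C2, by positivity, fun z hz0 hz2 x => ?_⟩
    have hd : _root_.deriv (_root_.twist z w) = fun x =>
        -z * _root_.twist z (fun x => (x : ℂ)⁻¹ * w x) x + _root_.twist z (_root_.deriv w) x :=
      funext fun x => (hw.hasDerivAt_twist ha z x).deriv
    have s1 : ContDiffAt ℝ A (_root_.twist z (fun x => (x : ℂ)⁻¹ * w x)) x :=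
      (((hw.div_id ha).twist ha z).smooth.of_le (by exact_mod_cast le_top)).contDiffAt
    have s2 : ContDiffAt ℝ A (_root_.twist z (_root_.deriv w)) x :=
      ((hw.deriv.twist ha z).smooth.of_le (by exact_mod_cast le_top)).contDiffAt
    rw [iteratedDeriv_succ', hd, iteratedDeriv_fun_add (contDiffAt_const.mul s1) s2,
      iteratedDeriv_const_mul _ s1]
    refine (norm_add_le _ _).trans ?_
    rw [norm_mul, norm_neg]
    have hz := norm_nonneg z
    calc _ ≤ ‖z‖ * (C1 * (1 + ‖z‖) ^ A) + C2 * (1 + ‖z‖) ^ A := by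
          gcongr
          · exact h1 z hz0 hz2 x
          · exact h2 z hz0 hz2 x
      _ ≤ (C1 + C2) * (1 + ‖z‖) ^ (A + 1) := by
          rw [pow_succ]
          have : 0 ≤ (1 + ‖z‖) ^ A := by positivity
          nlinarith [mul_nonneg hC1 this, mul_nonneg (mul_nonneg hC2 this) hz]

/-- `∫ x ^ (-z) w(x) dx` decays faster than any power of `|z|`, by repeated partial integration. -/
lemma exists_norm_integral_twist_le (ha : 0 < a) (hab : a ≤ b) (A : ℕ) :
    ∀ {w : ℝ → ℂ}, IsBumpOn a b w → ∃ C : ℝ, 0 ≤ C ∧ ∀ z : ℂ, 0 ≤ z.re → z.re ≤ 2 →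
      ‖z‖ ^ A * ‖∫ x, _root_.twist z w x‖ ≤ C := by
  induction A with
  | zero =>
    intro w hw
    obtain ⟨C, hC0, hC⟩ := hw.exists_bound
    refine ⟨(b - a) * (Real.exp (2 * (|Real.log a| + |Real.log b|)) * C),
      mul_nonneg (by linarith) (by positivity), fun z h0 h2 => ?_⟩
    rw [pow_zero, one_mul]
    exact (norm_integral_le_integral_norm _).trans
      ((hw.twist ha z).integral_norm_le hab (hw.norm_twist_le ha hC h0 h2))
  | succ A ih =>
    intro w hw
    have hW := hw.id_mul ha
    obtain ⟨C, hC0, hC⟩ := ih hW.deriv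
    refine ⟨C, hC0, fun z hz0 hz2 => ?_⟩
    have e1 : ∀ x : ℝ, (x : ℂ)⁻¹ * ((x : ℂ) * w x) = w x := by
      intro x
      rcases eq_or_ne x 0 with rfl | hx
      · have h0 : (0 : ℝ) ∉ Icc a b := fun h => absurd h.1 (not_le.mpr ha)
        simp [hw.zero 0 h0]
      · rw [inv_mul_cancel_left₀ (by exact_mod_cast hx)]
    have i1 := (hw.twist ha z).integrable
    have i2 := (hW.deriv.twist ha z).integrable
    have h := integral_eq_zero_of_hasDerivAt_of_integrable
      (fun x => hW.hasDerivAt_twist ha z x)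
      (by simp_rw [e1]; exact (i1.const_mul (-z)).add i2) (hW.twist ha z).integrable
    simp_rw [e1] at h
    rw [integral_add (i1.const_mul _) i2, integral_const_mul] at h
    have h' : z * ∫ x, _root_.twist z w x =
        ∫ x, _root_.twist z (_root_.deriv fun x => (x : ℂ) * w x) x := by
      linear_combination -h
    rw [pow_succ, mul_assoc, ← norm_mul, h']
    exact hC z hz0 hz2

lemma exists_norm_integral_twist_le_div (ha : 0 < a) (hab : a ≤ b) (A : ℕ) (hw : IsBumpOn a b w) :
    ∃ C : ℝ, 0 ≤ C ∧ ∀ z : ℂ, 0 ≤ z.re → z.re ≤ 2 →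
      ‖∫ x, _root_.twist z w x‖ ≤ C / (1 + ‖z‖) ^ A := by
  obtain ⟨C1, h1, H1⟩ := exists_norm_integral_twist_le ha hab A hw
  obtain ⟨C2, h2, H2⟩ := exists_norm_integral_twist_le ha hab 0 hw
  refine ⟨2 ^ A * (C1 + C2), by positivity, fun z hz0 hz2 => ?_⟩
  rw [le_div_iff₀ (by positivity)]
  have hz := norm_nonneg z
  have k1 := H1 z hz0 hz2
  have k2 := H2 z hz0 hz2
  rw [pow_zero, one_mul] at k2
  have h3 : (1 + ‖z‖) ^ A ≤ 2 ^ A * (‖z‖ ^ A + 1) := by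
    rcases le_total ‖z‖ 1 with h | h
    · calc (1 + ‖z‖) ^ A ≤ 2 ^ A := pow_le_pow_left₀ (by positivity) (by linarith) A
        _ ≤ 2 ^ A * (‖z‖ ^ A + 1) := le_mul_of_one_le_right (by positivity)
            (by have : 0 ≤ ‖z‖ ^ A := by positivity
                linarith)
    · calc (1 + ‖z‖) ^ A ≤ (2 * ‖z‖) ^ A := pow_le_pow_left₀ (by positivity) (by linarith) A
        _ = 2 ^ A * ‖z‖ ^ A := mul_pow _ _ _
        _ ≤ 2 ^ A * (‖z‖ ^ A + 1) := by gcongr; linarith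
  calc _ ≤ ‖∫ x, _root_.twist z w x‖ * (2 ^ A * (‖z‖ ^ A + 1)) := by gcongr
    _ = 2 ^ A * (‖z‖ ^ A * ‖∫ x, _root_.twist z w x‖ + ‖∫ x, _root_.twist z w x‖) := by ring
    _ ≤ 2 ^ A * (C1 + C2) := by gcongr

end IsBumpOn

/-- **Poisson summation**, as an estimate: a sum over a shifted lattice differs from the
corresponding integral by at most the `L¹` norm of a high derivative. -/
lemma exists_norm_tsum_sub_integral_le : ∃ K : ℝ, 0 ≤ K ∧ ∀ (a b : ℝ) (g : ℝ → ℂ),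
    IsBumpOn a b g → ∀ (A : ℕ), 2 ≤ A → ∀ (l : ℝ), 0 < l → ∀ y : ℝ,
      ‖∑' n : ℤ, g (l * (y + n)) - (l : ℂ)⁻¹ * ∫ x, g x‖ ≤
        K * l⁻¹ * l ^ A * ∫ x, ‖iteratedDeriv A g x‖ := by
  refine ⟨∑' n : ℤ, 1 / |(n : ℝ)| ^ 2, tsum_nonneg fun n => by positivity, ?_⟩
  intro a b g hg A hA l hl y
  set F : ℝ → ℂ := fun x => g (l * x) with hF
  have hFb : IsBumpOn (a / l) (b / l) F := by
    refine ⟨hg.smooth.comp (contDiff_const.mul contDiff_id), fun x hx => hg.zero _ fun h => hx ?_⟩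
    rw [mem_Icc] at h ⊢
    rw [div_le_iff₀ hl, le_div_iff₀ hl]
    constructor <;> linarith [h.1, h.2]
  set f : SchwartzMap ℝ ℂ := hFb.hasCompactSupport.toSchwartzMap hFb.smooth with hf
  have hfF : ∀ x, f x = F x := fun x => rfl
  have hFf : ∀ x : ℝ, (𝓕 f) x = 𝓕 F x := by
    intro x
    rw [SchwartzMap.fourier_coe]
    rfl
  have h0 : 𝓕 F 0 = (l : ℂ)⁻¹ * ∫ x, g x := by
    rw [Real.fourier_real_eq]
    simp only [mul_zero, neg_zero, AddChar.map_zero_eq_one, one_smul]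
    have := Measure.integral_comp_mul_left g l
    rw [hF, this, abs_of_pos (inv_pos.mpr hl), real_smul]
    push_cast
    rfl
  have hderiv : ∀ x, iteratedDeriv A F x = (l : ℂ) ^ A * iteratedDeriv A g (l * x) := by
    intro x
    have := iteratedDeriv_comp_const_smul (n := A) (f := g)
      (hg.smooth.of_le (by exact_mod_cast le_top)) l
    have := congrFun this x
    rw [hF, this, real_smul]
    push_cast
    rfl
  have hL1 : ∫ x, ‖iteratedDeriv A F x‖ = l⁻¹ * l ^ A * ∫ x, ‖iteratedDeriv A g x‖ := by
    simp_rw [hderiv, norm_mul, norm_pow, Complex.norm_real, Real.norm_of_nonneg hl.le]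
    rw [integral_const_mul, Measure.integral_comp_mul_left (fun x => ‖iteratedDeriv A g x‖) l,
      abs_of_pos (inv_pos.mpr hl), smul_eq_mul]
    ring
  set J := ∫ x, ‖iteratedDeriv A F x‖ with hJ
  have hJ0 : 0 ≤ J := integral_nonneg fun x => norm_nonneg _
  have hfour : ∀ n : ℤ, n ≠ 0 → ‖(𝓕 f) n‖ ≤ J * (1 / |(n : ℝ)| ^ 2) := by
    intro n hn
    have h1 := congrFun (Real.fourier_iteratedDeriv (f := F) (N := ⊤) (n := A) hFb.smooth
      (fun n _ => (hFb.iteratedDeriv n).integrable) le_top) (n : ℝ)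
    have h2 : ‖𝓕 (iteratedDeriv A F) (n : ℝ)‖ ≤ J :=
      VectorFourier.norm_fourierIntegral_le_integral_norm _ _ _ _ _
    rw [h1, norm_smul, norm_pow] at h2
    have hn1 : 1 ≤ |(n : ℝ)| := by exact_mod_cast Int.one_le_abs hn
    have h3 : |(n : ℝ)| ≤ ‖2 * (Real.pi : ℂ) * I * ((n : ℝ) : ℂ)‖ := by
      rw [norm_mul, norm_mul, norm_mul, Complex.norm_real, Complex.norm_real, norm_I,
        Complex.norm_ofNat, Real.norm_eq_abs, Real.norm_eq_abs, abs_of_pos Real.pi_pos]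
      nlinarith [Real.pi_gt_three]
    have h4 : |(n : ℝ)| ^ 2 ≤ ‖2 * (Real.pi : ℂ) * I * ((n : ℝ) : ℂ)‖ ^ A :=
      (pow_le_pow_right₀ hn1 hA).trans (pow_le_pow_left₀ (abs_nonneg _) h3 A)
    rw [hFf, mul_one_div, le_div_iff₀ (by positivity), mul_comm]
    exact (mul_le_mul_of_nonneg_right h4 (norm_nonneg _)).trans h2
  have hsumm : Summable fun n : ℤ => 1 / |(n : ℝ)| ^ 2 := by
    have := (Real.summable_one_div_int_pow (p := 2)).mpr one_lt_two
    refine this.congr fun n => ?_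
    rw [sq_abs]
  set T : ℤ → ℂ := fun n => 𝓕 f n * fourier n (y : UnitAddCircle) with hT
  have hTn : ∀ n : ℤ, ‖if n = 0 then 0 else T n‖ ≤ J * (1 / |(n : ℝ)| ^ 2) := by
    intro n
    split_ifs with h
    · rw [norm_zero]; positivity
    · rw [hT]
      simp only [norm_mul]
      have : ‖fourier n (y : UnitAddCircle)‖ = 1 := by
        rw [fourier_apply]; exact Circle.norm_coe _
      rw [this, mul_one]
      exact hfour n h
  have hTs0 : Summable fun n : ℤ => if n = 0 then 0 else T n :=
    Summable.of_norm_bounded (hsumm.mul_left J) hTn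
  have hTs : Summable T := by
    refine (summable_congr_cofinite ?_).mp hTs0
    have : ({0}ᶜ : Set ℤ) ∈ cofinite := (finite_singleton 0).compl_mem_cofinite
    filter_upwards [this] with n hn
    exact if_neg hn
  have hP := SchwartzMap.tsum_eq_tsum_fourier f y
  have e1 : ∑' n : ℤ, g (l * (y + n)) = ∑' n : ℤ, T n := hP
  rw [e1, hTs.tsum_eq_add_tsum_ite 0]
  have e2 : T 0 = (l : ℂ)⁻¹ * ∫ x, g x := by
    rw [← h0, hT]
    simp [hFf]
  rw [e2, add_sub_cancel_left]
  refine (norm_tsum_le_tsum_norm hTs0.norm).trans ?_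
  refine (Summable.tsum_le_tsum hTn hTs0.norm (hsumm.mul_left J)).trans ?_
  rw [tsum_mul_left, hL1]
  apply le_of_eq
  ring

/-- **Smooth character sums.** A smooth sum of `χ(n) n ^ (-z)` over `n ≍ M` is negligible as soon as
`M` exceeds `m (1 + |z|)` by a positive power, unless `χ` is principal and `z` is small. -/
lemma exists_norm_tsum_char_twist_le {a b : ℝ} {w : ℝ → ℂ} (ha : 0 < a) (hab : a ≤ b)
    (hw : IsBumpOn a b w) (A : ℕ) (hA : 2 ≤ A) : ∃ C : ℝ, 0 ≤ C ∧ ∀ (m : ℕ) [NeZero m]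
    (χ : DirichletCharacter ℂ m) (M : ℝ) (z : ℂ), 0 < M → 0 ≤ z.re → z.re ≤ 2 →
      ‖∑' n : ℕ, χ n * twist z w (n / M)‖ ≤
        C * M * ((m * (1 + ‖z‖) / M) ^ A + (if χ = 1 then 1 / (1 + ‖z‖) ^ A else 0)) := by
  obtain ⟨C1, hC1, H1⟩ := IsBumpOn.exists_norm_iteratedDeriv_twist_le ha A hw
  obtain ⟨C2, hC2, H2⟩ := hw.exists_norm_integral_twist_le_div ha hab A
  obtain ⟨K, hK, HK⟩ := exists_norm_tsum_sub_integral_le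
  refine ⟨K * ((b - a) * C1) + C2, by have : 0 ≤ b - a := by linarith
                                      positivity, ?_⟩
  intro m _ χ M z hM hz0 hz2
  have hm : (0 : ℝ) < m := by exact_mod_cast NeZero.pos m
  have hMc : (M : ℂ) ≠ 0 := by exact_mod_cast hM.ne'
  have hmc : (m : ℂ) ≠ 0 := by exact_mod_cast NeZero.ne m
  have hg := hw.twist ha z
  set g := twist z w with hgdef
  set l : ℝ := m / M with hl
  have hl0 : 0 < l := by positivity
  have hneg : ∀ x : ℝ, x ≤ 0 → g x = 0 := fun x hx =>
    hg.zero x fun h => absurd (h.1.trans hx) (not_le.mpr ha)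
  have hsum : Summable fun n : ℕ => χ n * g (n / M) := by
    refine summable_of_hasFiniteSupport ?_
    refine (Set.finite_Iic ⌈b * M⌉₊).subset fun n hn => ?_
    rw [Function.mem_support] at hn
    by_contra h
    refine hn ?_
    rw [mem_Iic, not_le] at h
    rw [hg.zero, mul_zero]
    intro h'
    have h2 := h'.2
    rw [div_le_iff₀ hM] at h2
    exact absurd (Nat.le_ceil (b * M)) (not_le.mpr (lt_of_lt_of_le (by exact_mod_cast h) h2))
  -- Each residue class is a shifted lattice; its negative part lies outside the support of `g`.
  have hclass : ∀ j : ZMod m, ∑' i : ℕ, χ ((j.val + m * i : ℕ) : ZMod m) *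
      g ((j.val + m * i : ℕ) / M) = χ j * ∑' n : ℤ, g (l * ((j.val : ℝ) / m + n)) := by
    intro j
    have e1 : ∀ i : ℕ, χ ((j.val + m * i : ℕ) : ZMod m) * g ((j.val + m * i : ℕ) / M) =
        χ j * g (l * ((j.val : ℝ) / m + ((i : ℤ) : ℝ))) := by
      intro i
      congr 2
      · simp
      · rw [hl]
        push_cast
        field_simp
    simp_rw [e1]
    rw [tsum_mul_left]
    congr 1
    refine Function.Injective.tsum_eq (g := fun i : ℕ => (i : ℤ)) Nat.cast_injective
      (f := fun n : ℤ => g (l * ((j.val : ℝ) / m + n))) ?_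
    intro n hn
    rw [Function.mem_support] at hn
    by_contra hr
    refine hn (hneg _ ?_)
    have hn1 : n ≤ -1 := by
      by_contra h
      exact hr ⟨n.toNat, Int.toNat_of_nonneg (by omega)⟩
    have h1 : (j.val : ℝ) / m ≤ 1 := by
      rw [div_le_one hm]
      exact_mod_cast (ZMod.val_lt j).le
    have h2 : (n : ℝ) ≤ -1 := by exact_mod_cast hn1
    exact mul_nonpos_of_nonneg_of_nonpos hl0.le (by linarith)
  rw [Nat.sumByResidueClasses hsum m]
  simp_rw [hclass]
  set Ig := ∫ x, g x with hIg
  have hI : ‖Ig‖ ≤ C2 / (1 + ‖z‖) ^ A := H2 z hz0 hz2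
  have hL1 : ∫ x, ‖iteratedDeriv A g x‖ ≤ (b - a) * (C1 * (1 + ‖z‖) ^ A) :=
    (hg.iteratedDeriv A).integral_norm_le hab (H1 z hz0 hz2)
  have hdecomp : ∑ j : ZMod m, χ j * ∑' n : ℤ, g (l * ((j.val : ℝ) / m + n)) =
      ∑ j : ZMod m, χ j * (∑' n : ℤ, g (l * ((j.val : ℝ) / m + n)) - (l : ℂ)⁻¹ * Ig) +
        (∑ j : ZMod m, χ j) * ((l : ℂ)⁻¹ * Ig) := by
    rw [Finset.sum_mul, ← Finset.sum_add_distrib]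
    exact Finset.sum_congr rfl fun j _ => by ring
  rw [hdecomp]
  have hz : 0 < 1 + ‖z‖ := by have := norm_nonneg z; linarith
  have hlinv : l⁻¹ = M / m := by rw [hl, inv_div]
  have hpart1 : ‖∑ j : ZMod m, χ j *
      (∑' n : ℤ, g (l * ((j.val : ℝ) / m + n)) - (l : ℂ)⁻¹ * Ig)‖ ≤
      K * ((b - a) * C1) * M * (m * (1 + ‖z‖) / M) ^ A := by
    have hb : ∀ j ∈ (Finset.univ : Finset (ZMod m)), ‖χ j *
        (∑' n : ℤ, g (l * ((j.val : ℝ) / m + n)) - (l : ℂ)⁻¹ * Ig)‖ ≤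
        K * l⁻¹ * l ^ A * ((b - a) * (C1 * (1 + ‖z‖) ^ A)) := by
      intro j _
      rw [norm_mul]
      calc _ ≤ 1 * (K * l⁻¹ * l ^ A * ∫ x, ‖iteratedDeriv A g x‖) := by
            gcongr
            · exact χ.norm_le_one j
            · exact HK a b g hg A hA l hl0 _
        _ ≤ _ := by
            rw [one_mul]
            gcongr
    refine (norm_sum_le_of_le _ hb).trans (le_of_eq ?_)
    rw [Finset.sum_const, Finset.card_univ, ZMod.card, nsmul_eq_mul, hlinv, hl, div_pow, div_pow,
      mul_pow]
    field_simp
  have hpart2 : ‖(∑ j : ZMod m, χ j) * ((l : ℂ)⁻¹ * Ig)‖ ≤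
      C2 * M * (if χ = 1 then 1 / (1 + ‖z‖) ^ A else 0) := by
    split_ifs with h
    · rw [norm_mul, norm_mul]
      have h1 : ‖∑ j : ZMod m, χ j‖ ≤ m := by
        refine (norm_sum_le_of_le _ (fun j _ => χ.norm_le_one j)).trans ?_
        simp [ZMod.card]
      rw [norm_inv, Complex.norm_real, Real.norm_of_nonneg hl0.le]
      calc _ ≤ m * (l⁻¹ * (C2 / (1 + ‖z‖) ^ A)) := by gcongr
        _ = C2 * M * (1 / (1 + ‖z‖) ^ A) := by
          rw [hlinv]
          field_simp
    · rw [MulChar.sum_eq_zero_of_ne_one h]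
      simp
  refine (norm_add_le _ _).trans ((add_le_add hpart1 hpart2).trans ?_)
  have t1 : 0 ≤ (m * (1 + ‖z‖) / M) ^ A := by positivity
  have t2 : (0 : ℝ) ≤ (if χ = 1 then 1 / (1 + ‖z‖) ^ A else 0) := by
    split_ifs <;> positivity
  have k1 : 0 ≤ K * ((b - a) * C1) := by
    have : 0 ≤ b - a := by linarith
    positivity
  nlinarith [mul_nonneg (mul_nonneg k1 hM.le) t2, mul_nonneg (mul_nonneg hC2 hM.le) t1]

/-! ### Quotients of characters of the family -/

lemma changeLevel_natCast {m d : ℕ} [NeZero m] (h : d ∣ m) (χ : DirichletCharacter ℂ d) {n : ℕ}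
    (hn : n.Coprime m) : DirichletCharacter.changeLevel h χ (n : ZMod m) = χ (n : ZMod d) := by
  have := DirichletCharacter.changeLevel_eq_cast_of_dvd' χ h (a := (n : ℤ))
    (Nat.isCoprime_iff_coprime.mpr hn)
  simpa using this

lemma dirichletCharacter_natCast_eq_zero {m : ℕ} (χ : DirichletCharacter ℂ m) {n : ℕ}
    (hn : ¬ n.Coprime m) : χ (n : ZMod m) = 0 := by
  have := (DirichletCharacter.apply_eq_zero_iff χ (n : ℤ)).mpr
    (fun h => hn (Nat.isCoprime_iff_coprime.mp h))
  simpa using this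

/-- The character modulo `k q q'` with values `(ξψ)(n) * conj ((ξ'ψ')(n))`. -/
noncomputable def charQuot {k q q' : ℕ} (ξ ξ' : DirichletCharacter ℂ k)
    (ψ : DirichletCharacter ℂ q) (ψ' : DirichletCharacter ℂ q') :
    DirichletCharacter ℂ (k * (q * q')) :=
  DirichletCharacter.changeLevel (mul_dvd_mul_left k (Dvd.intro q' rfl)) (charProd ξ ψ) *
    (DirichletCharacter.changeLevel (mul_dvd_mul_left k (Dvd.intro_left q rfl)) (charProd ξ' ψ'))⁻¹

lemma charQuot_natCast {k q q' : ℕ} [NeZero k] [NeZero q] [NeZero q']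
    (ξ ξ' : DirichletCharacter ℂ k) (ψ : DirichletCharacter ℂ q) (ψ' : DirichletCharacter ℂ q')
    (n : ℕ) : charQuot ξ ξ' ψ ψ' (n : ZMod (k * (q * q'))) =
      charProd ξ ψ (n : ZMod (k * q)) * conj (charProd ξ' ψ' (n : ZMod (k * q'))) := by
  by_cases hn : n.Coprime (k * (q * q'))
  · rw [charQuot, MulChar.mul_apply, ← MulChar.star_apply', changeLevel_natCast _ _ hn,
      changeLevel_natCast _ _ hn]
    rfl
  · rw [dirichletCharacter_natCast_eq_zero _ hn]
    have : ¬ n.Coprime (k * q) ∨ ¬ n.Coprime (k * q') := by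
      by_contra h
      push Not at h
      refine hn (Nat.Coprime.mul_right (Nat.Coprime.coprime_mul_right_right h.1) ?_)
      exact Nat.Coprime.mul_right (Nat.Coprime.coprime_mul_left_right h.1)
        (Nat.Coprime.coprime_mul_left_right h.2)
    rcases this with h | h
    · rw [dirichletCharacter_natCast_eq_zero (charProd ξ ψ) h, zero_mul]
    · rw [dirichletCharacter_natCast_eq_zero (charProd ξ' ψ') h, map_zero, mul_zero]

/-- Characters `ξψ` with `ψ` primitive of modulus prime to `k` determine `ξ` and `ψ`: the quotient
of two of them is principal only if they come from the same data. The `ξ`-part has conductor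
dividing `k`, the `ψ`-part has conductor dividing `q q'`, so both are trivial. -/
lemma charQuot_eq_one {k q q' : ℕ} [NeZero k] [NeZero q] [NeZero q']
    {ξ ξ' : DirichletCharacter ℂ k} {ψ : DirichletCharacter ℂ q} {ψ' : DirichletCharacter ℂ q'}
    (hq : q.Coprime k) (hq' : q'.Coprime k) (hψ : ψ.IsPrimitive) (hψ' : ψ'.IsPrimitive)
    (h : charQuot ξ ξ' ψ ψ' = 1) : ξ = ξ' ∧ q = q' ∧ ψ ≍ ψ' := by
  have dk : k ∣ k * (q * q') := Dvd.intro _ rfl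
  have dqq : q * q' ∣ k * (q * q') := Dvd.intro_left _ rfl
  have dq : q ∣ q * q' := Dvd.intro _ rfl
  have dq' : q' ∣ q * q' := Dvd.intro_left _ rfl
  set Θ := DirichletCharacter.changeLevel dk (ξ * ξ'⁻¹) with hΘ
  set Φ := DirichletCharacter.changeLevel dqq (DirichletCharacter.changeLevel dq ψ *
    (DirichletCharacter.changeLevel dq' ψ')⁻¹) with hΦ
  have hX : charQuot ξ ξ' ψ ψ' = Θ * Φ := by
    rw [charQuot, charProd, charProd, hΘ, hΦ]
    simp only [map_mul, map_inv, mul_inv, ← DirichletCharacter.changeLevel_trans]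
    exact mul_mul_mul_comm _ _ _ _
  have hΘΦ : Θ = Φ⁻¹ := by rw [eq_inv_iff_mul_eq_one, ← hX, h]
  have c1 : Θ.conductor ∣ k := by
    rw [hΘ, DirichletCharacter.conductor_changeLevel]
    exact DirichletCharacter.conductor_dvd_level _
  have c2 : Θ.conductor ∣ q * q' := by
    rw [hΘΦ, DirichletCharacter.conductor_inv, hΦ, DirichletCharacter.conductor_changeLevel]
    exact DirichletCharacter.conductor_dvd_level _
  have hΘ1 : Θ = 1 := by
    rw [DirichletCharacter.eq_one_iff_conductor_eq_one]
    exact Nat.eq_one_of_dvd_coprimes (Nat.Coprime.mul_left hq hq').symm c1 c2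
  have hΦ1 : Φ = 1 := by rw [hΘ1] at hΘΦ; exact inv_eq_one.mp hΘΦ.symm
  rw [hΘ, DirichletCharacter.changeLevel_eq_one_iff, mul_inv_eq_one] at hΘ1
  rw [hΦ, DirichletCharacter.changeLevel_eq_one_iff, mul_inv_eq_one] at hΦ1
  have hqq : q = q' := by
    have := congrArg DirichletCharacter.conductor hΦ1
    rw [DirichletCharacter.conductor_changeLevel, DirichletCharacter.conductor_changeLevel] at this
    rwa [(DirichletCharacter.isPrimitive_def _).mp hψ,
      (DirichletCharacter.isPrimitive_def _).mp hψ'] at this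
  refine ⟨hΘ1, hqq, ?_⟩
  subst hqq
  exact heq_of_eq (DirichletCharacter.changeLevel_injective dq hΦ1)

/-! ### Large values of Dirichlet polynomials -/

/-- **Duality.** A large values inequality for sums `∑ b(n) φ_r(n)` follows from a bound for the row
sums of the Gram matrix of the `φ_r` in a weighted `ℓ²` space. -/
lemma sum_norm_sq_le_of_gram {ι : Type*} (R : Finset ι) (S : Finset ℕ) (b : ℕ → ℂ)
    (φ : ι → ℕ → ℂ) (w : ℕ → ℝ) (hw0 : ∀ n ∈ S, 0 ≤ w n) (hw1 : ∀ n ∈ S, b n ≠ 0 → 1 ≤ w n)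
    {B : ℝ} (hB : 0 ≤ B) (h : ∀ r ∈ R, ∑ s ∈ R, ‖∑ n ∈ S, (w n : ℂ) * (φ r n * conj (φ s n))‖ ≤ B) :
    ∑ r ∈ R, ‖∑ n ∈ S, b n * φ r n‖ ^ 2 ≤ (∑ n ∈ S, ‖b n‖ ^ 2) * B := by
  set A : ι → ℂ := fun r => ∑ n ∈ S, b n * φ r n with hA
  set E : ℝ := ∑ r ∈ R, ‖A r‖ ^ 2 with hE
  set V : ℕ → ℂ := fun n => ∑ r ∈ R, conj (A r) * φ r n with hV
  set G : ι → ι → ℝ := fun r s => ‖∑ n ∈ S, (w n : ℂ) * (φ r n * conj (φ s n))‖ with hG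
  have hE0 : 0 ≤ E := Finset.sum_nonneg fun r _ => by positivity
  have hb0 : 0 ≤ ∑ n ∈ S, ‖b n‖ ^ 2 := Finset.sum_nonneg fun r _ => by positivity
  have hGsymm : ∀ r s, G r s = G s r := by
    intro r s
    simp only [hG]
    rw [← Complex.norm_conj, map_sum]
    congr 1
    refine Finset.sum_congr rfl fun n _ => ?_
    simp only [map_mul, Complex.conj_conj, Complex.conj_ofReal]
    ring
  have e1 : (E : ℂ) = ∑ n ∈ S, b n * V n := by
    simp only [hV, Finset.mul_sum]
    rw [Finset.sum_comm, hE]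
    push_cast
    refine Finset.sum_congr rfl fun r _ => ?_
    rw [← Complex.ofReal_pow, ← Complex.normSq_eq_norm_sq, Complex.normSq_eq_conj_mul_self]
    conv_lhs => rw [hA]
    rw [Finset.mul_sum]
    exact Finset.sum_congr rfl fun n _ => by simp only [hA]; ring
  have e2 : ((∑ n ∈ S, w n * ‖V n‖ ^ 2 : ℝ) : ℂ) = ∑ r ∈ R, ∑ s ∈ R, conj (A r) * A s *
      ∑ n ∈ S, (w n : ℂ) * (φ r n * conj (φ s n)) := by
    push_cast
    have : ∀ n ∈ S, (w n : ℂ) * (‖V n‖ : ℂ) ^ 2 = ∑ r ∈ R, ∑ s ∈ R,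
        conj (A r) * A s * ((w n : ℂ) * (φ r n * conj (φ s n))) := by
      intro n _
      rw [← Complex.ofReal_pow, ← Complex.normSq_eq_norm_sq, ← Complex.mul_conj]
      simp only [hV, map_sum, map_mul, Complex.conj_conj]
      rw [Finset.sum_mul_sum, Finset.mul_sum]
      refine Finset.sum_congr rfl fun r _ => ?_
      rw [Finset.mul_sum]
      exact Finset.sum_congr rfl fun s _ => by ring
    rw [Finset.sum_congr rfl this, Finset.sum_comm]
    refine Finset.sum_congr rfl fun r _ => ?_
    rw [Finset.sum_comm]
    exact Finset.sum_congr rfl fun s _ => (Finset.mul_sum _ _ _).symm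
  have e3 : ∑ n ∈ S, w n * ‖V n‖ ^ 2 ≤ E * B := by
    have hn : 0 ≤ ∑ n ∈ S, w n * ‖V n‖ ^ 2 :=
      Finset.sum_nonneg fun n hn => mul_nonneg (hw0 n hn) (by positivity)
    have h1 : ∑ n ∈ S, w n * ‖V n‖ ^ 2 ≤ ∑ r ∈ R, ∑ s ∈ R, ‖A r‖ * ‖A s‖ * G r s := by
      calc _ = ‖((∑ n ∈ S, w n * ‖V n‖ ^ 2 : ℝ) : ℂ)‖ := by
            rw [Complex.norm_real, Real.norm_of_nonneg hn]
        _ ≤ _ := by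
            rw [e2]
            refine (norm_sum_le _ _).trans (Finset.sum_le_sum fun r _ => ?_)
            refine (norm_sum_le _ _).trans (Finset.sum_le_sum fun s _ => ?_)
            rw [norm_mul, norm_mul, Complex.norm_conj]
    have h2 : ∑ r ∈ R, ∑ s ∈ R, ‖A r‖ * ‖A s‖ * G r s ≤
        ∑ r ∈ R, ∑ s ∈ R, (‖A r‖ ^ 2 / 2 * G r s + ‖A s‖ ^ 2 / 2 * G r s) := by
      refine Finset.sum_le_sum fun r _ => Finset.sum_le_sum fun s _ => ?_
      have hGn : 0 ≤ G r s := norm_nonneg _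
      rw [← add_mul]
      refine mul_le_mul_of_nonneg_right ?_ hGn
      nlinarith [sq_nonneg (‖A r‖ - ‖A s‖)]
    have h3 : ∑ r ∈ R, ∑ s ∈ R, ‖A s‖ ^ 2 / 2 * G r s = ∑ r ∈ R, ∑ s ∈ R, ‖A r‖ ^ 2 / 2 * G r s := by
      rw [Finset.sum_comm]
      exact Finset.sum_congr rfl fun r _ => Finset.sum_congr rfl fun s _ => by rw [hGsymm]
    have h4 : ∑ r ∈ R, ∑ s ∈ R, ‖A r‖ ^ 2 / 2 * G r s ≤ E * B / 2 := by
      rw [hE, Finset.sum_mul, Finset.sum_div]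
      refine Finset.sum_le_sum fun r hr => ?_
      rw [← Finset.mul_sum]
      calc _ ≤ ‖A r‖ ^ 2 / 2 * B := mul_le_mul_of_nonneg_left (h r hr) (by positivity)
        _ = _ := by ring
    simp only [Finset.sum_add_distrib] at h2
    linarith
  have e4 : E ≤ ∑ n ∈ S, ‖b n‖ * (Real.sqrt (w n) * ‖V n‖) := by
    calc E = ‖(E : ℂ)‖ := by rw [Complex.norm_real, Real.norm_of_nonneg hE0]
      _ ≤ _ := by
        rw [e1]
        refine (norm_sum_le _ _).trans (Finset.sum_le_sum fun n hn => ?_)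
        rw [norm_mul]
        by_cases hbn : b n = 0
        · simp [hbn]
        · have : 1 ≤ Real.sqrt (w n) := Real.one_le_sqrt.mpr (hw1 n hn hbn)
          exact mul_le_mul_of_nonneg_left (le_mul_of_one_le_left (norm_nonneg _) this)
            (norm_nonneg _)
  have e5 : E ^ 2 ≤ (∑ n ∈ S, ‖b n‖ ^ 2) * (E * B) := by
    calc E ^ 2 ≤ (∑ n ∈ S, ‖b n‖ * (Real.sqrt (w n) * ‖V n‖)) ^ 2 := pow_le_pow_left₀ hE0 e4 2
      _ ≤ (∑ n ∈ S, ‖b n‖ ^ 2) * ∑ n ∈ S, (Real.sqrt (w n) * ‖V n‖) ^ 2 :=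
        Finset.sum_mul_sq_le_sq_mul_sq _ _ _
      _ = (∑ n ∈ S, ‖b n‖ ^ 2) * ∑ n ∈ S, w n * ‖V n‖ ^ 2 := by
        congr 1
        refine Finset.sum_congr rfl fun n hn => ?_
        rw [mul_pow, Real.sq_sqrt (hw0 n hn)]
      _ ≤ _ := mul_le_mul_of_nonneg_left e3 hb0
  rcases hE0.eq_or_lt with h0 | h0
  · rw [← h0]
    positivity
  · rw [sq] at e5
    have : E * E ≤ E * ((∑ n ∈ S, ‖b n‖ ^ 2) * B) := by linarith [e5]
    exact le_of_mul_le_mul_left this h0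

lemma exists_bump_eq_one {b : ℝ} (hb : 1 < b) : ∃ w : ℝ → ℝ, IsBumpOn (1 / 2) (b + 1) (fun x => w x) ∧
    (∀ x, 0 ≤ w x) ∧ ∀ x, 1 ≤ x → x ≤ b → w x = 1 := by
  let f : ContDiffBump ((1 + b) / 2 : ℝ) := ⟨(b - 1) / 2, b / 2, by linarith, by linarith⟩
  refine ⟨f, ⟨Complex.ofRealCLM.contDiff.comp f.contDiff, fun x hx => ?_⟩, fun x => f.nonneg,
    fun x h1 h2 => f.one_of_mem_closedBall ?_⟩
  · rw [f.zero_of_le_dist, ofReal_zero]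
    by_contra h
    refine hx ?_
    rw [Real.dist_eq, not_le, abs_lt] at h
    change -(b / 2) < _ ∧ _ < b / 2 at h
    constructor <;> linarith
  · rw [Metric.mem_closedBall, Real.dist_eq, abs_le]
    change -((b - 1) / 2) ≤ _ ∧ _ ≤ (b - 1) / 2
    constructor <;> linarith

/-- Indices of the family of characters `ξψ`: a modulus `j + 1`, a character `ψ` modulo `j + 1` and
a character `ξ` modulo `k`. -/
abbrev FamilyIndex (k : ℕ) := Σ j : ℕ, DirichletCharacter ℂ (j + 1) × DirichletCharacter ℂ k

/-- The character `ξψ` modulo `k (j + 1)`. -/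
noncomputable def FamilyIndex.char {k : ℕ} (i : FamilyIndex k) : DirichletCharacter ℂ (k * (i.1 + 1)) :=
  charProd i.2.2 i.2.1

/-- The indices that enter `zeroCountSum`: `j + 1` prime to `k`, `ψ` primitive. -/
def FamilyIndex.Admissible {k : ℕ} (i : FamilyIndex k) : Prop :=
  (i.1 + 1).Coprime k ∧ i.2.1.IsPrimitive

/-- **Large values inequality.** For points `(i, ρ)` in the family of characters, a Dirichlet
polynomial supported in `(M, bM]` satisfies a mean square bound in which only pairs of points with
the same character and with ordinates within `G` of each other matter, provided that `M` exceeds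
the conductors times heights by a power. -/
lemma exists_large_values {b : ℝ} (hb : 1 < b) (A : ℕ) (hA : 2 ≤ A) : ∃ C : ℝ, 0 < C ∧
    ∀ (k : ℕ) [NeZero k] (R : Finset (FamilyIndex k × ℂ)) (P V M G N α : ℝ) (c : ℕ → ℂ),
    (∀ r ∈ R, r.1.Admissible ∧ α ≤ r.2.re ∧ r.2.re ≤ α + 1 ∧ |r.2.im| ≤ V) →
    (∀ r ∈ R, ∀ s ∈ R, (k : ℝ) * ((r.1.1 + 1) * (s.1.1 + 1)) ≤ P) →
    0 ≤ V → 1 ≤ M → 0 < G → 0 ≤ N →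
    (∀ r ∈ R, ((R.filter fun s => s.1 = r.1 ∧ |s.2.im - r.2.im| ≤ G).card : ℝ) ≤ N) →
    (∀ n : ℕ, c n ≠ 0 → M < n ∧ n ≤ b * M) →
    ∑ r ∈ R, ‖∑ n ∈ Finset.range (⌊(b + 1) * M⌋₊ + 1), c n * r.1.char n * (n : ℂ) ^ (-r.2)‖ ^ 2 ≤
      (∑ n ∈ Finset.range (⌊(b + 1) * M⌋₊ + 1), ‖c n‖ ^ 2 * ((n : ℝ) ^ (-α)) ^ 2) *
        (C * M * (N + R.card * ((P * (3 + 2 * V) / M) ^ A + 1 / G ^ A))) := by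
  obtain ⟨w, hw, hw0, hw1⟩ := exists_bump_eq_one hb
  obtain ⟨C, hC, H⟩ := exists_norm_tsum_char_twist_le (by norm_num) (by linarith) hw A hA
  refine ⟨C + 1, by linarith, ?_⟩
  intro k _ R P V M G N α c hR hP hV hM hG hN hnear hc
  have hM0 : 0 < M := by linarith
  set S := Finset.range (⌊(b + 1) * M⌋₊ + 1) with hS
  set φ : FamilyIndex k × ℂ → ℕ → ℂ := fun r n => r.1.char n * (n : ℂ) ^ (-(r.2 - α)) with hφ
  set Y : ℝ := (P * (3 + 2 * V) / M) ^ A with hY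
  by_cases hRe : R = ∅
  · subst hRe
    simp only [Finset.sum_empty, Finset.card_empty, CharP.cast_eq_zero, zero_mul, add_zero]
    refine mul_nonneg (Finset.sum_nonneg fun n _ => by positivity) (by positivity)
  have hP0 : 0 ≤ P := by
    obtain ⟨r, hr⟩ := Finset.nonempty_iff_ne_empty.mpr hRe
    exact le_trans (by positivity) (hP r hr r hr)
  have hY0 : 0 ≤ Y := by positivity
  -- Entries of the Gram matrix: only principal quotients at close ordinates contribute `C * M`.
  have hgram : ∀ r ∈ R, ∀ s ∈ R, ‖∑ n ∈ S, (w (n / M) : ℂ) * (φ r n * conj (φ s n))‖ ≤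
      C * M * (Y + 1 / G ^ A + if s.1 = r.1 ∧ |s.2.im - r.2.im| ≤ G then 1 else 0) := by
    intro r hr s hs
    obtain ⟨hra, hr1, hr2, hr3⟩ := hR r hr
    obtain ⟨hsa, hs1, hs2, hs3⟩ := hR s hs
    set z : ℂ := (r.2 - α) + conj (s.2 - α) with hz
    have hzre : z.re = (r.2.re - α) + (s.2.re - α) := by simp [hz]
    have hzim : z.im = r.2.im - s.2.im := by simp [hz]; ring
    have hz0 : 0 ≤ z.re := by rw [hzre]; linarith
    have hz2 : z.re ≤ 2 := by rw [hzre]; linarith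
    have hznorm : ‖z‖ ≤ 2 + 2 * V := by
      refine (Complex.norm_le_abs_re_add_abs_im z).trans ?_
      rw [abs_of_nonneg hz0, hzim]
      have := abs_sub r.2.im s.2.im
      linarith
    set χ := charQuot r.1.2.2 s.1.2.2 r.1.2.1 s.1.2.1 with hχ
    have hterm : ∀ n : ℕ, (w (n / M) : ℂ) * (φ r n * conj (φ s n)) =
        (M : ℂ) ^ (-z) * (χ n * twist z (fun x => w x) (n / M)) := by
      intro n
      rcases Nat.eq_zero_or_pos n with rfl | hn
      · have h0 : (w 0 : ℂ) = 0 := hw.zero 0 (by norm_num)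
        have hw00 : w 0 = 0 := by exact_mod_cast h0
        simp [twist, hw00]
      · have hn0 : (0 : ℝ) < n := by exact_mod_cast hn
        have hnc : (n : ℂ) ≠ 0 := by exact_mod_cast hn0.ne'
        have hMc : (M : ℂ) ≠ 0 := by exact_mod_cast hM0.ne'
        have e1 : conj ((n : ℂ) ^ (-(s.2 - α))) = (n : ℂ) ^ (-conj (s.2 - α)) := by
          have := Complex.cpow_conj (n : ℂ) (-(s.2 - α)) (by
            rw [Complex.natCast_arg]; exact Real.pi_pos.ne)
          rw [Complex.conj_natCast] at this
          rw [← map_neg, this]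
        have e2 : exp (-z * Real.log (n / M)) = (M : ℂ) ^ z * (n : ℂ) ^ (-z) := by
          rw [Real.log_div hn0.ne' hM0.ne', Complex.cpow_def_of_ne_zero hMc,
            Complex.cpow_def_of_ne_zero hnc, ← Complex.exp_add]
          push_cast
          congr 1
          rw [Complex.ofReal_log hM0.le]
          ring
        have e3 : (n : ℂ) ^ (-(r.2 - α)) * (n : ℂ) ^ (-conj (s.2 - α)) = (n : ℂ) ^ (-z) := by
          rw [← Complex.cpow_add _ _ hnc]
          congr 1
          rw [hz]; ring
        have e4 : (M : ℂ) ^ (-z) * (M : ℂ) ^ z = 1 := by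
          rw [← Complex.cpow_add _ _ hMc]; simp
        rw [hχ, charQuot_natCast, twist, e2]
        simp only [hφ, map_mul, e1, FamilyIndex.char]
        rw [← e3]
        linear_combination (-(charProd r.1.2.2 r.1.2.1 n * conj (charProd s.1.2.2 s.1.2.1 n) *
          (n : ℂ) ^ (-(r.2 - α)) * (n : ℂ) ^ (-conj (s.2 - α)) * w (n / M))) * e4
    have htsum : ∑ n ∈ S, χ n * twist z (fun x => w x) (n / M) =
        ∑' n : ℕ, χ n * twist z (fun x => w x) (n / M) := by
      refine (tsum_eq_sum fun n hn => ?_).symm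
      rw [hS, Finset.mem_range, not_lt] at hn
      have h1 : (b + 1) * M < n := by
        refine (Nat.lt_floor_add_one _).trans_le ?_
        exact_mod_cast hn
      rw [(hw.twist (by norm_num) z).zero, mul_zero]
      intro h
      have := h.2
      rw [div_le_iff₀ hM0] at this
      linarith
    rw [Finset.sum_congr rfl fun n _ => hterm n, ← Finset.mul_sum, htsum, norm_mul]
    have hMz : ‖(M : ℂ) ^ (-z)‖ ≤ 1 := by
      rw [Complex.norm_cpow_eq_rpow_re_of_pos hM0]
      exact Real.rpow_le_one_of_one_le_of_nonpos hM (by simpa using hz0)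
    have hb1 := H (k * ((r.1.1 + 1) * (s.1.1 + 1))) χ M z hM0 hz0 hz2
    have hkk : ((k * ((r.1.1 + 1) * (s.1.1 + 1)) : ℕ) : ℝ) * (1 + ‖z‖) ≤ P * (3 + 2 * V) := by
      have := hP r hr s hs
      push_cast
      exact mul_le_mul this (by linarith) (by positivity) hP0
    have hz00 := norm_nonneg z
    calc _ ≤ 1 * (C * M * ((((k * ((r.1.1 + 1) * (s.1.1 + 1)) : ℕ) : ℝ) * (1 + ‖z‖) / M) ^ A +
          (if χ = 1 then 1 / (1 + ‖z‖) ^ A else 0))) := by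
          gcongr
      _ ≤ C * M * (Y + (1 / G ^ A + if s.1 = r.1 ∧ |s.2.im - r.2.im| ≤ G then 1 else 0)) := by
          rw [one_mul]
          refine mul_le_mul_of_nonneg_left (add_le_add ?_ ?_) (by positivity)
          · exact pow_le_pow_left₀ (by positivity) (div_le_div_of_nonneg_right hkk hM0.le) A
          by_cases hχ1 : χ = 1
          · rw [if_pos hχ1]
            have hsr : s.1 = r.1 := by
              obtain ⟨h1, h2, h3⟩ := charQuot_eq_one hra.1 hsa.1 hra.2 hsa.2 hχ1
              obtain ⟨⟨jr, ψr, ξr⟩, ρr⟩ := r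
              obtain ⟨⟨js, ψs, ξs⟩, ρs⟩ := s
              simp only at h1 h2 h3 ⊢
              obtain rfl : jr = js := by omega
              obtain rfl := eq_of_heq h3
              rw [h1]
            by_cases hg : |s.2.im - r.2.im| ≤ G
            · rw [if_pos ⟨hsr, hg⟩]
              have : 1 / (1 + ‖z‖) ^ A ≤ 1 := by
                rw [div_le_one (by positivity)]
                exact one_le_pow₀ (by linarith)
              have : 0 ≤ 1 / G ^ A := by positivity
              linarith
            · rw [if_neg (fun h => hg h.2), add_zero]
              have hzG : G ≤ 1 + ‖z‖ := by
                have := Complex.abs_im_le_norm z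
                rw [hzim, abs_sub_comm] at this
                push Not at hg
                linarith
              gcongr
          · rw [if_neg hχ1]
            split_ifs <;> positivity
      _ = _ := by ring
  have hrow : ∀ r ∈ R, ∑ s ∈ R, ‖∑ n ∈ S, (w (n / M) : ℂ) * (φ r n * conj (φ s n))‖ ≤
      C * M * (N + R.card * (Y + 1 / G ^ A)) := by
    intro r hr
    refine (Finset.sum_le_sum fun s hs => hgram r hr s hs).trans ?_
    rw [← Finset.mul_sum, Finset.sum_add_distrib, Finset.sum_const, nsmul_eq_mul,
      Finset.sum_boole, add_comm]
    gcongr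
    exact hnear r hr
  have hGA : 0 ≤ 1 / G ^ A := by positivity
  have hmain := sum_norm_sq_le_of_gram R S (fun n => c n * (n : ℂ) ^ (-(α : ℂ))) φ
    (fun n => w (n / M)) (fun n _ => hw0 _) (fun n _ hn => by
      have hcn : c n ≠ 0 := fun h => hn (by simp [h])
      obtain ⟨h1, h2⟩ := hc n hcn
      refine (hw1 _ ?_ ?_).ge
      · rw [le_div_iff₀ hM0]; linarith
      · rw [div_le_iff₀ hM0]; linarith) (by positivity) hrow
  have hl : ∀ r : FamilyIndex k × ℂ, ∑ n ∈ S, c n * (n : ℂ) ^ (-(α : ℂ)) * φ r n =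
      ∑ n ∈ S, c n * r.1.char n * (n : ℂ) ^ (-r.2) := by
    intro r
    refine Finset.sum_congr rfl fun n _ => ?_
    by_cases hcn : c n = 0
    · simp [hcn]
    · have hnc : (n : ℂ) ≠ 0 := by
        have := (hc n hcn).1
        have : (0 : ℝ) < n := by linarith
        exact_mod_cast this.ne'
      have : (n : ℂ) ^ (-r.2) = (n : ℂ) ^ (-(α : ℂ)) * (n : ℂ) ^ (-(r.2 - α)) := by
        rw [← Complex.cpow_add _ _ hnc]; congr 1; ring
      rw [this, hφ]; ring
  simp only [hl] at hmain
  have hl2 : ∑ n ∈ S, ‖c n * (n : ℂ) ^ (-(α : ℂ))‖ ^ 2 =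
      ∑ n ∈ S, ‖c n‖ ^ 2 * ((n : ℝ) ^ (-α)) ^ 2 := by
    refine Finset.sum_congr rfl fun n _ => ?_
    by_cases hcn : c n = 0
    · simp [hcn]
    · have hn0 : (0 : ℝ) < n := by
        have := (hc n hcn).1
        linarith
      rw [norm_mul, mul_pow, show ((n : ℕ) : ℂ) = ((n : ℝ) : ℂ) by simp,
        Complex.norm_cpow_eq_rpow_re_of_pos hn0]
      simp
  rw [hl2] at hmain
  refine hmain.trans ?_
  gcongr
  linarith

/-! ### The smoothed Perron formula -/

/-- The Perron kernel `w⁻¹ (w + 1)⁻¹` is the Mellin transform of `max (1 - x) 0`. -/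
lemma hasMellin_one_sub {w : ℂ} (hw : 0 < w.re) :
    HasMellin (fun x : ℝ => ((max (1 - x) 0 : ℝ) : ℂ)) w (1 / (w * (w + 1))) := by
  have h1 := hasMellin_one_Ioc hw
  have h2 := hasMellin_cpow_Ioc 1 (s := w) (by simp; linarith)
  have h3 := hasMellin_sub h1.1 h2.1
  rw [h1.2, h2.2] at h3
  have hw0 : w ≠ 0 := by rintro rfl; simp at hw
  have hw1 : w + 1 ≠ 0 := by
    intro h
    have := congrArg Complex.re h
    simp at this; linarith
  have e : (1 : ℂ) / w - 1 / (w + 1) = 1 / (w * (w + 1)) := by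
    field_simp
    ring
  rw [e] at h3
  have hf : ∀ t ∈ Ioi (0 : ℝ), indicator (Ioc 0 1) (fun _ => 1 : ℝ → ℂ) t -
      indicator (Ioc 0 1) (fun t => (t : ℂ) ^ (1 : ℂ) : ℝ → ℂ) t = ((max (1 - t) 0 : ℝ) : ℂ) := by
    intro t ht
    by_cases h : t ≤ 1
    · have hm : t ∈ Ioc (0 : ℝ) 1 := ⟨ht, h⟩
      rw [indicator_of_mem hm, indicator_of_mem hm, cpow_one,
        max_eq_left (by linarith)]
      push_cast; rfl
    · have hm : t ∉ Ioc (0 : ℝ) 1 := fun h' => h h'.2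
      rw [indicator_of_notMem hm, indicator_of_notMem hm,
        max_eq_right (by linarith)]
      simp
  refine ⟨?_, ?_⟩
  · refine h3.1.congr_fun (fun t ht => ?_) measurableSet_Ioi
    simp only [hf t ht]
  · rw [← h3.2, mellin, mellin]
    refine setIntegral_congr_fun measurableSet_Ioi fun t ht => ?_
    simp only [hf t ht]

lemma norm_kernel_ge {a t y : ℝ} (ht0 : 0 ≤ t) (ht : t ≤ 1) (ha : t ≤ |a|) :
    t * Real.sqrt (1 + y ^ 2) ≤ ‖(a : ℂ) + y * I‖ := by
  refine abs_le_of_sq_le_sq' ?_ (norm_nonneg _) |>.2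
  rw [mul_pow, Real.sq_sqrt (by positivity), ← Complex.normSq_eq_norm_sq, Complex.normSq_apply]
  simp only [add_re, ofReal_re, mul_re, I_re, mul_zero, ofReal_im, I_im, mul_one, sub_self, add_zero,
    add_im, mul_im, zero_add]
  have h1 : t ^ 2 ≤ a ^ 2 := by
    rw [← sq_abs a]; exact pow_le_pow_left₀ ht0 ha 2
  have h2 : t ^ 2 ≤ 1 := by nlinarith
  nlinarith [mul_le_mul_of_nonneg_right h2 (sq_nonneg y)]

/-- The Perron kernel on the line `Re w = a` is at most a multiple of the Cauchy density. -/
lemma norm_kernel_le {a t u y : ℝ} (ht0 : 0 < t) (ht : t ≤ 1) (ha : t ≤ |a|) (hu0 : 0 < u)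
    (hu : u ≤ 1) (ha' : u ≤ |a + 1|) :
    ‖1 / (((a : ℂ) + y * I) * ((a : ℂ) + y * I + 1))‖ ≤ (t * u)⁻¹ * (1 + y ^ 2)⁻¹ := by
  have h1 := norm_kernel_ge (y := y) ht0.le ht ha
  have h2 := norm_kernel_ge (y := y) hu0.le hu ha'
  have e : ((a + 1 : ℝ) : ℂ) + y * I = (a : ℂ) + y * I + 1 := by push_cast; ring
  rw [e] at h2
  rw [norm_div, norm_one, norm_mul, one_div, ← mul_inv]
  have h3 : t * u * (1 + y ^ 2) ≤ ‖(a : ℂ) + y * I‖ * ‖(a : ℂ) + y * I + 1‖ := by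
    calc t * u * (1 + y ^ 2) = (t * Real.sqrt (1 + y ^ 2)) * (u * Real.sqrt (1 + y ^ 2)) := by
          have := Real.mul_self_sqrt (show (0 : ℝ) ≤ 1 + y ^ 2 by positivity)
          linear_combination -(t * u) * this
      _ ≤ _ := mul_le_mul h1 h2 (by positivity) (norm_nonneg _)
  exact inv_anti₀ (by positivity) h3

lemma perron_kernel_integrable :
    Integrable (fun y : ℝ => (1 : ℂ) / (((2 : ℂ) + y * I) * ((2 : ℂ) + y * I + 1))) := by
  refine Integrable.mono' (integrable_inv_one_add_sq) ?_ ?_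
  · refine Measurable.aestronglyMeasurable ?_
    fun_prop
  · refine Eventually.of_forall fun y => ?_
    have := norm_kernel_le (a := 2) (t := 1) (u := 1) (y := y) one_pos le_rfl (by norm_num) one_pos
      le_rfl (by norm_num)
    simpa using this

lemma perron_one_sub {x : ℝ} (hx : 0 < x) :
    (1 / (2 * Real.pi) : ℂ) * ∫ y : ℝ, (x : ℂ) ^ (-((2 : ℂ) + y * I)) *
      (1 / (((2 : ℂ) + y * I) * ((2 : ℂ) + y * I + 1))) = ((max (1 - x) 0 : ℝ) : ℂ) := by
  have hre : ∀ y : ℝ, 0 < (((2 : ℝ) : ℂ) + y * I).re := by intro y; simp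
  have hm : ∀ y : ℝ, mellin (fun x : ℝ => ((max (1 - x) 0 : ℝ) : ℂ)) (((2 : ℝ) : ℂ) + y * I) =
      1 / (((2 : ℂ) + y * I) * ((2 : ℂ) + y * I + 1)) := by
    intro y
    rw [(hasMellin_one_sub (hre y)).2]
    push_cast; rfl
  have h := mellinInv_mellin_eq 2 (fun x : ℝ => ((max (1 - x) 0 : ℝ) : ℂ)) hx
    (by simpa using (hasMellin_one_sub (hre 0)).1)
    (by
      unfold VerticalIntegrable
      simp_rw [hm]
      exact perron_kernel_integrable)
    (by fun_prop)
  rw [← h, mellinInv]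
  simp_rw [hm]
  rw [real_smul]
  push_cast
  rfl

/-- The integrand on the line `Re w = 2` in the smoothed Perron formula. -/
noncomputable def perronIntegrand (f : ℕ → ℂ) (ρ : ℂ) (Y : ℝ) (y : ℝ) : ℂ :=
  LSeries f (ρ + (2 + y * I)) * ((Y : ℂ) ^ ((2 : ℂ) + y * I) *
    (1 / (((2 : ℂ) + y * I) * ((2 : ℂ) + y * I + 1))))

/-- **Smoothed Perron formula** with the Riesz weight `max (1 - n / Y) 0`. -/
lemma perron_LSeries {f : ℕ → ℂ} {ρ : ℂ} (hf : LSeriesSummable f (ρ + 2)) {Y : ℝ} (hY : 0 < Y) :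
    Integrable (perronIntegrand f ρ Y) ∧
    (1 / (2 * Real.pi) : ℂ) * ∫ y : ℝ, perronIntegrand f ρ Y y =
      ∑ n ∈ Finset.Icc 1 ⌊Y⌋₊, f n * (n : ℂ) ^ (-ρ) * ((max (1 - n / Y) 0 : ℝ) : ℂ) := by
  have hYc : (Y : ℂ) ≠ 0 := by exact_mod_cast hY.ne'
  set K : ℝ → ℂ := fun y => (Y : ℂ) ^ ((2 : ℂ) + y * I) *
    (1 / (((2 : ℂ) + y * I) * ((2 : ℂ) + y * I + 1))) with hK
  set F : ℕ → ℝ → ℂ := fun n y => LSeries.term f (ρ + (2 + y * I)) n * K y with hF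
  have hYn : ∀ y : ℝ, ‖(Y : ℂ) ^ ((2 : ℂ) + y * I)‖ = Y ^ 2 := by
    intro y
    rw [Complex.norm_cpow_eq_rpow_re_of_pos hY]
    simp
  have hKint : Integrable K := by
    refine (perron_kernel_integrable.norm.const_mul (Y ^ 2)).mono' ?_ ?_
    · refine Measurable.aestronglyMeasurable ?_
      refine Measurable.mul ?_ (by fun_prop)
      exact Measurable.const_pow (by fun_prop) _
    · refine Eventually.of_forall fun y => ?_
      rw [hK]
      simp only [norm_mul, hYn]
      exact le_rfl
  have hterm : ∀ n (y : ℝ), ‖LSeries.term f (ρ + (2 + y * I)) n‖ = ‖LSeries.term f (ρ + 2) n‖ := by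
    intro n y
    rw [LSeries.norm_term_eq, LSeries.norm_term_eq]
    simp
  have htm : ∀ n, Measurable fun y : ℝ => LSeries.term f (ρ + (2 + y * I)) n := by
    intro n
    rcases Nat.eq_zero_or_pos n with rfl | hn
    · simp
    · have : ∀ y : ℝ, LSeries.term f (ρ + (2 + y * I)) n = f n / (n : ℂ) ^ (ρ + (2 + y * I)) :=
        fun y => LSeries.term_of_ne_zero hn.ne' _ _
      simp_rw [this]
      exact (Measurable.const_pow (by fun_prop) _).const_div _
  have hFint : ∀ n, Integrable (F n) := by
    intro n
    refine (hKint.norm.const_mul ‖LSeries.term f (ρ + 2) n‖).mono' ?_ ?_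
    · exact (htm n).aestronglyMeasurable.mul hKint.aestronglyMeasurable
    · refine Eventually.of_forall fun y => ?_
      rw [hF]
      simp only [norm_mul, hterm]
      exact le_rfl
  have hFn : ∀ n, ∫ y, ‖F n y‖ = ‖LSeries.term f (ρ + 2) n‖ * ∫ y, ‖K y‖ := by
    intro n
    rw [← integral_const_mul]
    refine integral_congr_ae (Eventually.of_forall fun y => ?_)
    simp only [hF, norm_mul, hterm]
  have hFs : Summable fun n => ∫ y, ‖F n y‖ := by
    simp_rw [hFn]
    exact hf.norm.mul_right _
  have hsum := hasSum_integral_of_summable_integral_norm hFint hFs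
  have hpt : ∀ y, ∑' n, F n y = perronIntegrand f ρ Y y := by
    intro y
    simp only [hF]
    rw [tsum_mul_right]
    rfl
  simp_rw [hpt] at hsum
  have hval : ∀ n, (1 / (2 * Real.pi) : ℂ) * ∫ y, F n y =
      if n ∈ Finset.Icc 1 ⌊Y⌋₊ then f n * (n : ℂ) ^ (-ρ) * ((max (1 - n / Y) 0 : ℝ) : ℂ) else 0 := by
    intro n
    rcases Nat.eq_zero_or_pos n with rfl | hn
    · simp [hF]
    · have hn0 : (0 : ℝ) < n := by exact_mod_cast hn
      have hnc : (n : ℂ) ≠ 0 := by exact_mod_cast hn0.ne'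
      have hx : 0 < (n : ℝ) / Y := by positivity
      have e : ∀ y : ℝ, F n y = f n * (n : ℂ) ^ (-ρ) * (((n / Y : ℝ) : ℂ) ^ (-((2 : ℂ) + y * I)) *
          (1 / (((2 : ℂ) + y * I) * ((2 : ℂ) + y * I + 1)))) := by
        intro y
        simp only [hF, hK]
        rw [LSeries.term_of_ne_zero hn.ne']
        have e1 : ((n / Y : ℝ) : ℂ) ^ (-((2 : ℂ) + y * I)) =
            (n : ℂ) ^ (-((2 : ℂ) + y * I)) * (Y : ℂ) ^ ((2 : ℂ) + y * I) := by
          rw [div_eq_mul_inv]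
          push_cast
          have := Complex.mul_cpow_ofReal_nonneg hn0.le (inv_pos.mpr hY).le (-((2 : ℂ) + y * I))
          push_cast at this
          rw [this]
          congr 1
          rw [Complex.inv_cpow _ _ (by rw [Complex.arg_ofReal_of_nonneg hY.le]; exact Real.pi_pos.ne),
            Complex.cpow_neg, inv_inv]
        rw [e1, div_eq_mul_inv, ← Complex.cpow_neg, neg_add, Complex.cpow_add _ _ hnc]
        ring
      simp_rw [e]
      rw [integral_const_mul, mul_left_comm, perron_one_sub hx]
      split_ifs with h
      · rfl
      · have : Y < n := by
          rw [Finset.mem_Icc, not_and] at h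
          exact (Nat.floor_lt hY.le).mp (not_le.mp (h hn))
        rw [max_eq_right]
        · simp
        · have : 1 ≤ n / Y := by rw [le_div_iff₀ hY]; linarith
          linarith
  refine ⟨?_, ?_⟩
  · have h1 : ∀ y, perronIntegrand f ρ Y y = LSeries f (ρ + (2 + y * I)) * K y := fun y => rfl
    refine (hKint.norm.const_mul (∑' n, ‖LSeries.term f (ρ + 2) n‖)).mono' ?_ ?_
    · refine AEStronglyMeasurable.mul ?_ hKint.aestronglyMeasurable
      refine Measurable.aestronglyMeasurable ?_
      exact Measurable.tsum htm
    · refine Eventually.of_forall fun y => ?_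
      rw [h1, norm_mul]
      refine mul_le_mul_of_nonneg_right ?_ (norm_nonneg _)
      have : Summable fun n => ‖LSeries.term f (ρ + (2 + y * I)) n‖ := by
        simp_rw [hterm]; exact hf.norm
      refine (norm_tsum_le_tsum_norm this).trans ?_
      simp_rw [hterm]
      exact le_rfl
  · have := hsum.mul_left (1 / (2 * Real.pi) : ℂ)
    rw [← this.tsum_eq]
    simp_rw [hval]
    rw [tsum_eq_sum (s := Finset.Icc 1 ⌊Y⌋₊) (fun n hn => if_neg hn)]
    exact Finset.sum_congr rfl fun n hn => if_pos hn

/-! ### Moving the line of integration -/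

lemma integral_inv_one_add_sq_le (H : ℝ) (hH : 0 ≤ H) : ∫ y in (-H)..H, (1 + y ^ 2)⁻¹ ≤ Real.pi := by
  rw [intervalIntegral.integral_of_le (by linarith), ← integral_univ_inv_one_add_sq]
  exact setIntegral_le_integral integrable_inv_one_add_sq
    (Eventually.of_forall fun y => by positivity)

/-- The integral of a function with Cauchy-type decay outside `[-H, H]`. -/
lemma norm_integral_sub_le_of_decay {h : ℝ → ℂ} (hint : Integrable h) {B H : ℝ} (hH : 0 < H)
    (hB : ∀ y, ‖h y‖ ≤ B * (1 + y ^ 2)⁻¹) :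
    ‖∫ y, h y‖ ≤ ‖∫ y in (-H)..H, h y‖ + 2 * B / H := by
  have hB0 : 0 ≤ B := by
    have := (norm_nonneg _).trans (hB 0)
    simpa using this
  have hdec : ∀ y, H ≤ |y| → ‖h y‖ ≤ B * |y| ^ (-2 : ℝ) := by
    intro y hy
    have hy0 : 0 < |y| := by linarith
    refine (hB y).trans (mul_le_mul_of_nonneg_left ?_ hB0)
    rw [Real.rpow_neg hy0.le]
    refine inv_anti₀ (by positivity) ?_
    rw [show (2 : ℝ) = ((2 : ℕ) : ℝ) by norm_num, Real.rpow_natCast, sq_abs]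
    linarith
  have hI : ∫ y in Ioi H, B * y ^ (-2 : ℝ) = B / H := by
    rw [integral_const_mul, integral_Ioi_rpow_of_lt (by norm_num) hH]
    norm_num [Real.rpow_neg_one]
    rfl
  have hIint : IntegrableOn (fun y : ℝ => B * y ^ (-2 : ℝ)) (Ioi H) :=
    (integrableOn_Ioi_rpow_of_lt (by norm_num) hH).const_mul _
  have h1 : ‖∫ y in Ioi H, h y‖ ≤ B / H := by
    rw [← hI]
    refine norm_integral_le_of_norm_le hIint ?_
    refine (ae_restrict_mem measurableSet_Ioi).mono fun y hy => ?_
    have hy' : H < y := hy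
    have := hdec y (by rw [abs_of_pos (by linarith)]; linarith)
    rwa [abs_of_pos (by linarith)] at this
  have h2 : ‖∫ y in Iic (-H), h y‖ ≤ B / H := by
    have : ∫ y in Iic (-H), h y = ∫ y in Ioi H, h (-y) := by
      rw [integral_comp_neg_Ioi]
    rw [this, ← hI]
    refine norm_integral_le_of_norm_le hIint ?_
    refine (ae_restrict_mem measurableSet_Ioi).mono fun y hy => ?_
    have hy' : H < y := hy
    have := hdec (-y) (by rw [abs_neg, abs_of_pos (by linarith)]; linarith)
    rwa [abs_neg, abs_of_pos (by linarith)] at this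
  have hsplit : ∫ y, h y = (∫ y in Iic (-H), h y) + ((∫ y in (-H)..H, h y) + ∫ y in Ioi H, h y) := by
    rw [intervalIntegral.integral_interval_add_Ioi hint.integrableOn hint.integrableOn,
      intervalIntegral.integral_Iic_add_Ioi hint.integrableOn hint.integrableOn]
  rw [hsplit]
  refine (norm_add_le _ _).trans ((add_le_add h2 ((norm_add_le _ _).trans
    (add_le_add le_rfl h1))).trans (le_of_eq ?_))
  ring

/-- Moving a vertical segment: the cost is the integral over the new segment and the two
horizontal sides. -/
lemma norm_integral_vertical_le {G : ℂ → ℂ} {a H E₁ E₂ : ℝ} (ha : a ≤ 2) (ha' : -1 / 2 ≤ a)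
    (hH : 0 < H) (hG : ∀ w : ℂ, a ≤ w.re → w.re ≤ 2 → |w.im| ≤ H → DifferentiableAt ℂ G w)
    (h1 : ∀ y, |y| ≤ H → ‖G (a + y * I)‖ ≤ E₁ * (1 + y ^ 2)⁻¹)
    (h2 : ∀ w : ℂ, a ≤ w.re → w.re ≤ 2 → |w.im| = H → ‖G w‖ ≤ E₂) :
    ‖∫ y in (-H)..H, G (2 + y * I)‖ ≤ Real.pi * E₁ + 5 * E₂ := by
  have hE1 : 0 ≤ E₁ := by
    have := (norm_nonneg _).trans (h1 0 (by simpa using hH.le))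
    simpa using this
  have hrect := integral_boundary_rect_eq_zero_of_differentiable_on_off_countable G
    (⟨a, -H⟩ : ℂ) (⟨2, H⟩ : ℂ) ∅ countable_empty
    (fun w hw => by
      rw [mem_reProdIm, uIcc_of_le (by simpa using ha), uIcc_of_le (by simp; linarith)] at hw
      simp only [mem_Icc] at hw
      exact (hG w hw.1.1 hw.1.2 (abs_le.mpr ⟨hw.2.1, hw.2.2⟩)).continuousAt.continuousWithinAt)
    (fun w hw => by
      have hw := hw.1
      rw [mem_reProdIm, min_eq_left (by simpa using ha), max_eq_right (by simpa using ha),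
        min_eq_left (by simp; linarith), max_eq_right (by simp; linarith)] at hw
      simp only [mem_Ioo] at hw
      exact hG w hw.1.1.le hw.1.2.le (abs_le.mpr ⟨hw.2.1.le, hw.2.2.le⟩))
  simp only [smul_eq_mul] at hrect
  have hE2 : 0 ≤ E₂ := (norm_nonneg _).trans (h2 (⟨a, H⟩ : ℂ) le_rfl ha (abs_of_pos hH))
  have hhor : ∀ σ : ℝ, |σ| = H → ‖∫ x in a..2, G (x + σ * I)‖ ≤ 5 / 2 * E₂ := by
    intro σ hσ
    have := intervalIntegral.norm_integral_le_of_norm_le_const (a := a) (b := 2)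
      (f := fun x : ℝ => G (x + σ * I)) (C := E₂) (fun x hx => by
        rw [uIoc_of_le ha] at hx
        exact h2 _ (by simpa using hx.1.le) (by simpa using hx.2) (by simpa using hσ))
    refine this.trans ?_
    rw [abs_of_nonneg (by linarith)]
    nlinarith
  have hleft : ‖∫ y in (-H)..H, G (a + y * I)‖ ≤ Real.pi * E₁ := by
    have hc : ∀ y : ℝ, (1 + y ^ 2 : ℝ) ≠ 0 := fun y => by positivity
    have := intervalIntegral.norm_integral_le_of_norm_le (a := -H) (b := H) (by linarith)
      (f := fun y : ℝ => G (a + y * I)) (g := fun y => E₁ * (1 + y ^ 2)⁻¹) (μ := volume)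
      (Eventually.of_forall fun y hy => h1 y (abs_le.mpr ⟨hy.1.le, hy.2⟩))
      (Continuous.intervalIntegrable (by fun_prop (disch := exact hc _)) _ _)
    refine this.trans ?_
    rw [intervalIntegral.integral_const_mul, mul_comm]
    exact mul_le_mul_of_nonneg_right (integral_inv_one_add_sq_le H hH.le) hE1
  have e : I * ∫ y in (-H)..H, G (2 + y * I) = I * (∫ y in (-H)..H, G (a + y * I)) -
      (∫ x in a..2, G (x + (-H : ℝ) * I)) + ∫ x in a..2, G (x + H * I) := by
    push_cast at hrect ⊢
    linear_combination hrect
  have e' := congrArg norm e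
  rw [norm_mul, norm_I, one_mul] at e'
  rw [e']
  refine (norm_add_le _ _).trans ((add_le_add (norm_sub_le _ _) (hhor H (abs_of_pos hH))).trans ?_)
  rw [norm_mul, norm_I, one_mul]
  have := hhor (-H) (by rw [abs_neg, abs_of_pos hH])
  linarith

/-! ### Mollification and zero detection -/

/-- The Möbius function cut off at `X`. -/
noncomputable def mollifier (X : ℕ) (n : ℕ) : ℂ :=
  if n ≤ X then (ArithmeticFunction.moebius n : ℂ) else 0

/-- The coefficients `∑_{d ∣ n, d ≤ X} μ(d)` of `ζ(s) ∑_{m ≤ X} μ(m) m ^ (-s)`. -/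
noncomputable def mollCoeff (X : ℕ) (n : ℕ) : ℂ := ∑ d ∈ n.divisors, mollifier X d

lemma norm_mollifier_le (X n : ℕ) : ‖mollifier X n‖ ≤ 1 := by
  unfold mollifier
  split_ifs
  · have := ArithmeticFunction.abs_moebius_le_one (n := n)
    rw [Complex.norm_intCast]
    exact_mod_cast this
  · simp

lemma norm_mollCoeff_le (X n : ℕ) : ‖mollCoeff X n‖ ≤ n.divisors.card := by
  refine (norm_sum_le_of_le _ fun d _ => norm_mollifier_le X d).trans ?_
  simp

lemma mollCoeff_one {X : ℕ} (hX : 1 ≤ X) : mollCoeff X 1 = 1 := by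
  simp [mollCoeff, mollifier, hX]

lemma mollCoeff_eq_zero {X n : ℕ} (hn : 1 < n) (hnX : n ≤ X) : mollCoeff X n = 0 := by
  have h1 : mollCoeff X n = ∑ d ∈ n.divisors, (ArithmeticFunction.moebius d : ℂ) := by
    refine Finset.sum_congr rfl fun d hd => ?_
    rw [mollifier, if_pos ((Nat.divisor_le hd).trans hnX)]
  rw [h1]
  have h2 := congrArg (fun f : ArithmeticFunction ℤ => f n)
    ArithmeticFunction.coe_zeta_mul_moebius
  simp only [ArithmeticFunction.coe_zeta_mul_apply, ArithmeticFunction.one_apply_ne hn.ne'] at h2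
  exact_mod_cast h2

section mollifier

variable {q : ℕ}

/-- The mollifier `∑_{m ≤ X} μ(m) χ(m) m ^ (-s)`. -/
noncomputable def mollPoly (χ : DirichletCharacter ℂ q) (X : ℕ) (s : ℂ) : ℂ :=
  ∑ m ∈ Finset.Icc 1 X, mollifier X m * χ m * (m : ℂ) ^ (-s)

lemma differentiable_mollPoly (χ : DirichletCharacter ℂ q) (X : ℕ) :
    Differentiable ℂ (mollPoly χ X) := by
  unfold mollPoly
  refine Differentiable.fun_sum fun m hm => ?_
  have hm0 : (m : ℂ) ≠ 0 := by
    have := (Finset.mem_Icc.mp hm).1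
    exact_mod_cast (by omega : m ≠ 0)
  exact (differentiable_const _).mul (differentiable_id.neg.const_cpow (Or.inl hm0))

lemma norm_mollPoly_le (χ : DirichletCharacter ℂ q) (X : ℕ) {s : ℂ} (hs : 0 ≤ s.re) :
    ‖mollPoly χ X s‖ ≤ X := by
  have : ∀ m ∈ Finset.Icc 1 X, ‖mollifier X m * χ m * (m : ℂ) ^ (-s)‖ ≤ 1 := by
    intro m hm
    have hm1 := (Finset.mem_Icc.mp hm).1
    have hm0 : (1 : ℝ) ≤ m := by exact_mod_cast hm1
    rw [norm_mul, norm_mul]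
    refine mul_le_one₀ (mul_le_one₀ (norm_mollifier_le X m) (norm_nonneg _) (χ.norm_le_one _))
      (norm_nonneg _) ?_
    rw [Complex.norm_natCast_cpow_of_pos (by omega)]
    exact Real.rpow_le_one_of_one_le_of_nonpos hm0 (by simpa using hs)
  refine (norm_sum_le_of_le _ this).trans ?_
  simp

lemma LSeries_mollifier (χ : DirichletCharacter ℂ q) (X : ℕ) (s : ℂ) :
    LSeries (fun n : ℕ => χ n * mollifier X n) s = mollPoly χ X s := by
  rw [LSeries, tsum_eq_sum (s := Finset.Icc 1 X)]
  · refine Finset.sum_congr rfl fun m hm => ?_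
    have := (Finset.mem_Icc.mp hm).1
    rw [LSeries.term_of_ne_zero (by omega), Complex.cpow_neg]
    ring
  · intro n hn
    rcases Nat.eq_zero_or_pos n with rfl | hn0
    · simp
    · rw [LSeries.term_of_ne_zero hn0.ne', mollifier, if_neg, mul_zero, zero_div]
      intro h
      exact hn (Finset.mem_Icc.mpr ⟨hn0, h⟩)

lemma norm_char_mul_mollifier_le (χ : DirichletCharacter ℂ q) (X n : ℕ) :
    ‖χ n * mollifier X n‖ ≤ 1 := by
  rw [norm_mul]
  exact mul_le_one₀ (χ.norm_le_one _) (norm_nonneg _) (norm_mollifier_le X n)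

lemma convolution_char_mollifier (χ : DirichletCharacter ℂ q) (X : ℕ) :
    LSeries.convolution (fun n : ℕ => χ n) (fun n : ℕ => χ n * mollifier X n) =
      fun n : ℕ => χ n * mollCoeff X n := by
  rw [LSeries.convolution_def]
  ext n
  rw [mollCoeff, Finset.mul_sum]
  rw [← Nat.sum_divisorsAntidiagonal' (f := fun _ j => χ n * mollifier X j)]
  refine Finset.sum_congr rfl fun p hp => ?_
  rw [← (Nat.mem_divisorsAntidiagonal.mp hp).1]
  push_cast
  rw [map_mul]
  ring

lemma LSeriesSummable_char_mollCoeff [NeZero q] (χ : DirichletCharacter ℂ q) (X : ℕ) {s : ℂ}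
    (hs : 2 ≤ s.re) : LSeriesSummable (fun n : ℕ => χ n * mollCoeff X n) s := by
  rw [← convolution_char_mollifier]
  exact (LSeriesSummable_of_norm_le_one (fun n => χ.norm_le_one _) hs).convolution
    (LSeriesSummable_of_norm_le_one (norm_char_mul_mollifier_le χ X) hs)

lemma LSeries_char_mollCoeff [NeZero q] (χ : DirichletCharacter ℂ q) (X : ℕ) {s : ℂ} (hs : 2 ≤ s.re) :
    LSeries (fun n : ℕ => χ n * mollCoeff X n) s = χ.LFunction s * mollPoly χ X s := by
  rw [← convolution_char_mollifier, LSeries_convolution'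
    (LSeriesSummable_of_norm_le_one (fun n => χ.norm_le_one _) hs)
    (LSeriesSummable_of_norm_le_one (norm_char_mul_mollifier_le χ X) hs),
    LSeries_mollifier, χ.LFunction_eq_LSeries (by linarith)]

/-- **Zero detection.** At a zero `ρ` the function `L(s, χ) M(s) / (s - ρ)` has no pole at `ρ`, so
the line of integration in the Perron formula can be moved to the critical line without picking up
a residue, and the smoothed sum of the coefficients of `L M` is small. -/
lemma norm_sum_mollCoeff_le [NeZero q] (χ : DirichletCharacter ℂ q) {ρ : ℂ} (hρ : χ.LFunction ρ = 0)
    {θ H Y Λ : ℝ} {X : ℕ} (hX : 1 ≤ X) (hθ : 0 < θ) (h1 : 1 / 2 + θ ≤ ρ.re) (h2 : ρ.re ≤ 1)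
    (hH : 1 ≤ H) (hY : 1 ≤ Y) {U : Set ℂ} (hU : IsOpen U) (hLU : DifferentiableOn ℂ χ.LFunction U)
    (hrect : ∀ s : ℂ, 1 / 2 ≤ s.re → |s.im - ρ.im| ≤ H → s ∈ U ∧ ‖χ.LFunction s‖ ≤ Λ) :
    ‖∑ n ∈ Finset.Icc 1 ⌊Y⌋₊, χ n * mollCoeff X n * (n : ℂ) ^ (-ρ) *
      ((max (1 - n / Y) 0 : ℝ) : ℂ)‖ ≤
      Λ * X * Y ^ (-θ) * (2 / θ) + Λ * X * Y ^ 2 * (5 / H ^ 2) + Y ^ 2 * (8 / H) := by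
  have hY0 : 0 < Y := by linarith
  have hH0 : 0 < H := by linarith
  have hYc : (Y : ℂ) ≠ 0 := by exact_mod_cast hY0.ne'
  have hX0 : (0 : ℝ) ≤ X := by positivity
  have hΛ : 0 ≤ Λ := (norm_nonneg _).trans (hrect ρ (by linarith) (by simpa using hH0.le)).2
  obtain ⟨hint, hP⟩ := perron_LSeries (f := fun n => χ n * mollCoeff X n) (ρ := ρ)
    (LSeriesSummable_char_mollCoeff χ X (by simp; linarith)) hY0
  rw [← hP]
  set F : ℂ → ℂ := fun s => χ.LFunction s * mollPoly χ X s with hF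
  have hFρ : F ρ = 0 := by simp [hF, hρ]
  have hFU : DifferentiableOn ℂ F U := hLU.mul (differentiable_mollPoly χ X).differentiableOn
  have hρU : ρ ∈ U := (hrect ρ (by linarith) (by simpa using hH0.le)).1
  have hFb : ∀ s : ℂ, 1 / 2 ≤ s.re → |s.im - ρ.im| ≤ H → ‖F s‖ ≤ Λ * X := by
    intro s hs hs'
    rw [hF, norm_mul]
    exact mul_le_mul (hrect s hs hs').2 (norm_mollPoly_le χ X (by linarith)) (norm_nonneg _) hΛ
  -- `F` vanishes at `ρ`, so its slope is holomorphic there and cancels the pole `w = 0` of the kernel.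
  have hds : DifferentiableOn ℂ (dslope F ρ) U := (differentiableOn_dslope (hU.mem_nhds hρU)).mpr hFU
  set G : ℂ → ℂ := fun w => dslope F ρ (ρ + w) * ((Y : ℂ) ^ w * (1 / (w + 1))) with hG
  have hGne : ∀ w, w ≠ 0 → G w = F (ρ + w) * ((Y : ℂ) ^ w * (1 / (w * (w + 1)))) := by
    intro w hw
    simp only [hG]
    rw [dslope_of_ne _ (by simpa using hw), slope_def_field, hFρ]
    simp only [add_sub_cancel_left, sub_zero]
    field_simp
  set a : ℝ := 1 / 2 - ρ.re with ha
  have haθ : θ ≤ |a| := by rw [abs_of_neg (by linarith)]; linarith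
  have ha1 : 1 / 2 ≤ |a + 1| := by rw [abs_of_pos (by linarith)]; linarith
  have hGd : ∀ w : ℂ, a ≤ w.re → w.re ≤ 2 → |w.im| ≤ H → DifferentiableAt ℂ G w := by
    intro w hw1 hw2 hw3
    have hmem : ρ + w ∈ U := (hrect (ρ + w) (by simp; linarith) (by simpa using hw3)).1
    have d1 : DifferentiableAt ℂ (fun w => dslope F ρ (ρ + w)) w :=
      DifferentiableAt.comp (g := dslope F ρ) (f := fun w => ρ + w) w
        (hds.differentiableAt (hU.mem_nhds hmem)) (by fun_prop)
    have d2 : DifferentiableAt ℂ (fun w : ℂ => (Y : ℂ) ^ w) w :=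
      differentiableAt_id.const_cpow (Or.inl hYc)
    have hw0 : w + 1 ≠ 0 := by
      intro h
      have := congrArg Complex.re h
      simp at this
      linarith
    exact d1.mul (d2.mul (by fun_prop (disch := assumption)))
  have hYw : ∀ w : ℂ, ‖(Y : ℂ) ^ w‖ = Y ^ w.re := fun w =>
    Complex.norm_cpow_eq_rpow_re_of_pos hY0 w
  have hE1 : ∀ y, |y| ≤ H → ‖G (a + y * I)‖ ≤ (Λ * X * Y ^ (-θ) * (2 / θ)) * (1 + y ^ 2)⁻¹ := by
    intro y hy
    have hne : (a : ℂ) + y * I ≠ 0 := by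
      intro h
      have := congrArg Complex.re h
      simp at this
      linarith
    rw [hGne _ hne, norm_mul (F _), norm_mul ((Y : ℂ) ^ _), hYw]
    have k1 := hFb (ρ + (a + y * I)) (by simp [ha]) (by simpa using hy)
    have k2 : Y ^ ((a : ℂ) + y * I).re ≤ Y ^ (-θ) :=
      Real.rpow_le_rpow_of_exponent_le hY (by simp [ha]; linarith)
    have k3 := norm_kernel_le (a := a) (t := θ) (u := 1 / 2) (y := y) hθ (by linarith) haθ
      (by norm_num) (by norm_num) ha1
    calc _ ≤ (Λ * X) * (Y ^ (-θ) * ((θ * (1 / 2))⁻¹ * (1 + y ^ 2)⁻¹)) := by gcongr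
      _ = _ := by
        field_simp
  have hE2 : ∀ w : ℂ, a ≤ w.re → w.re ≤ 2 → |w.im| = H → ‖G w‖ ≤ Λ * X * Y ^ 2 * (1 / H ^ 2) := by
    intro w hw1 hw2 hw3
    have hne : w ≠ 0 := by
      rintro rfl
      simp at hw3
      linarith
    rw [hGne _ hne, norm_mul (F _), norm_mul ((Y : ℂ) ^ _), hYw]
    have k1 := hFb (ρ + w) (by simp; linarith) (by simpa using hw3.le)
    have k2 : Y ^ w.re ≤ Y ^ 2 := by
      rw [← Real.rpow_natCast]
      exact Real.rpow_le_rpow_of_exponent_le hY (by simpa using hw2)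
    have k3 : ‖1 / (w * (w + 1))‖ ≤ 1 / H ^ 2 := by
      rw [norm_div, norm_one, norm_mul]
      have m1 : H ≤ ‖w‖ := hw3 ▸ Complex.abs_im_le_norm w
      have m2 : H ≤ ‖w + 1‖ := by
        have := Complex.abs_im_le_norm (w + 1)
        simp only [add_im, one_im, add_zero] at this
        rwa [hw3] at this
      rw [sq]
      gcongr
    calc _ ≤ (Λ * X) * (Y ^ 2 * (1 / H ^ 2)) := by gcongr
      _ = _ := by ring
  have hvert := norm_integral_vertical_le (by linarith) (by linarith) hH0 hGd hE1 hE2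
  have hGP : ∀ y : ℝ, perronIntegrand (fun n : ℕ => χ n * mollCoeff X n) ρ Y y = G (2 + y * I) := by
    intro y
    have hne : (2 : ℂ) + y * I ≠ 0 := by
      intro h
      have := congrArg Complex.re h
      simp at this
    rw [hGne _ hne, perronIntegrand, LSeries_char_mollCoeff χ X (by simp; linarith)]
  have hdec : ∀ y : ℝ, ‖perronIntegrand (fun n : ℕ => χ n * mollCoeff X n) ρ Y y‖ ≤
      (4 * Y ^ 2) * (1 + y ^ 2)⁻¹ := by
    intro y
    have hre : 2 ≤ (ρ + ((2 : ℂ) + y * I)).re := by simp; linarith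
    rw [perronIntegrand, LSeries_char_mollCoeff χ X hre, norm_mul, norm_mul, norm_mul, hYw]
    have k1 := norm_LFunction_le_two χ hre
    have k2 : ‖mollPoly χ X (ρ + ((2 : ℂ) + y * I))‖ ≤ 2 := by
      rw [← LSeries_mollifier]
      exact norm_LSeries_le_two (norm_char_mul_mollifier_le χ X) hre
    have k3 := norm_kernel_le (a := 2) (t := 1) (u := 1) (y := y) one_pos le_rfl (by norm_num)
      one_pos le_rfl (by norm_num)
    have k4 : Y ^ ((2 : ℂ) + y * I).re = Y ^ 2 := by
      rw [← Real.rpow_natCast]; simp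
    rw [k4]
    push_cast at k3
    calc _ ≤ (2 * 2) * (Y ^ 2 * ((1 * 1)⁻¹ * (1 + y ^ 2)⁻¹)) := by gcongr
      _ = _ := by ring
  have htail := norm_integral_sub_le_of_decay hint hH0 hdec
  simp_rw [hGP] at htail ⊢
  have hpi := Real.pi_gt_three
  have e0 : ‖(1 / (2 * Real.pi) : ℂ)‖ = 1 / (2 * Real.pi) := by
    rw [norm_div, norm_mul, norm_one, Complex.norm_real, Real.norm_of_nonneg Real.pi_pos.le]
    simp
  rw [norm_mul, e0]
  set T1 := Λ * X * Y ^ (-θ) * (2 / θ) with hT1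
  have hT10 : 0 ≤ T1 := by positivity
  set T2 := Λ * X * Y ^ 2 * (1 / H ^ 2) with hT2
  have hT20 : 0 ≤ T2 := by positivity
  have hT3 : 0 ≤ Y ^ 2 * (8 / H) := by positivity
  have e2 : Λ * X * Y ^ 2 * (5 / H ^ 2) = 5 * T2 := by rw [hT2]; ring
  have e3 : 2 * (4 * Y ^ 2) / H = Y ^ 2 * (8 / H) := by ring
  rw [e2, one_div_mul_eq_div, div_le_iff₀ (by positivity)]
  rw [e3] at htail
  nlinarith [mul_nonneg hT20 (by linarith : (0 : ℝ) ≤ Real.pi - 3),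
    mul_nonneg hT3 (by linarith : (0 : ℝ) ≤ Real.pi - 3), mul_nonneg hT10 Real.pi_pos.le]

end mollifier

/-! ### The Lindelöf bound close to `s = 1` -/

/-- For non-principal characters the disc around `s = 1` excluded from the hypothesis is filled in by
the maximum principle. -/
lemma norm_LFunction_le_of_GLH (hGLH : GeneralizedLindelofHypothesis) {l : ℝ} (hl : 0 < l) :
    ∃ C : ℝ, 0 < C ∧ ∀ (q : ℕ) [NeZero q] (χ : DirichletCharacter ℂ q) (s : ℂ), 1 / 2 ≤ s.re →
      (χ ≠ 1 ∨ 1 / 2 ≤ |s.im|) → ‖χ.LFunction s‖ ≤ C * ((q : ℝ) * (2 + |s.im|)) ^ l := by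
  obtain ⟨C, hC, H⟩ := hGLH l hl
  refine ⟨C, hC, ?_⟩
  intro q _ χ s hs hχ
  have hq : (0 : ℝ) < q := by exact_mod_cast NeZero.pos q
  by_cases h1 : 1 / 2 ≤ ‖s - 1‖
  · refine (H q χ s hs h1).trans ?_
    gcongr
    norm_num
  · push Not at h1
    have him : |s.im| < 1 / 2 := by
      have := Complex.abs_im_le_norm (s - 1)
      simp only [sub_im, one_im, sub_zero] at this
      linarith
    have hχ1 : χ ≠ 1 := hχ.resolve_right (not_le.mpr him)
    have hd : DiffContOnCl ℂ χ.LFunction (Metric.ball 1 (1 / 2)) :=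
      (DirichletCharacter.differentiable_LFunction hχ1).diffContOnCl
    refine Complex.norm_le_of_forall_mem_frontier_norm_le Metric.isBounded_ball hd ?_
      (subset_closure (by simpa [Complex.dist_eq] using h1))
    intro z hz
    rw [frontier_ball (1 : ℂ) (by norm_num : (1 / 2 : ℝ) ≠ 0), mem_sphere_iff_norm] at hz
    have hzim : |z.im| ≤ 1 / 2 := by
      have := Complex.abs_im_le_norm (z - 1)
      simp only [sub_im, one_im, sub_zero] at this
      linarith
    have hzre : 1 / 2 ≤ z.re := by
      have := (Complex.abs_re_le_norm (z - 1)).trans hz.le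
      simp only [sub_re, one_re] at this
      rw [abs_le] at this
      linarith
    refine (H q χ z hzre hz.ge).trans ?_
    have := abs_nonneg s.im
    exact mul_le_mul_of_nonneg_left (Real.rpow_le_rpow (by positivity)
      (mul_le_mul_of_nonneg_left (by linarith) hq.le) hl.le) hC.le

/-! ### Powers of Dirichlet polynomials -/

/-- **Divisor bound.** The prime factors `p ≥ 2 ^ (1 / δ)` contribute at most `p ^ (a δ)` each and
the others at most a constant multiple of it. -/
lemma exists_card_divisors_le {δ : ℝ} (hδ : 0 < δ) :
    ∃ C : ℝ, 0 < C ∧ ∀ n : ℕ, (n.divisors.card : ℝ) ≤ C * (n : ℝ) ^ δ := by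
  have hl2 : 0 < Real.log 2 := Real.log_pos one_lt_two
  set K : ℝ := 1 + 1 / (δ * Real.log 2) with hK
  have hK1 : 1 ≤ K := by
    have : 0 < 1 / (δ * Real.log 2) := by positivity
    linarith
  set P : ℕ := ⌈(2 : ℝ) ^ (1 / δ)⌉₊ with hP
  refine ⟨K ^ P, by positivity, fun n => ?_⟩
  rcases Nat.eq_zero_or_pos n with rfl | hn
  · simp
    positivity
  rw [Nat.card_divisors hn.ne']
  have hfac : ∀ p ∈ n.primeFactors, ((n.factorization p + 1 : ℕ) : ℝ) ≤
      (if p < P then K else 1) * ((p : ℝ) ^ n.factorization p) ^ δ := by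
    intro p hp
    have hp2 : (2 : ℝ) ≤ p := by exact_mod_cast (Nat.prime_of_mem_primeFactors hp).two_le
    set e := n.factorization p
    have hpe : ((p : ℝ) ^ e) ^ δ = ((p : ℝ) ^ δ) ^ e := by
      rw [← Real.rpow_natCast, ← Real.rpow_natCast, ← Real.rpow_mul (by positivity),
        ← Real.rpow_mul (by positivity), mul_comm]
    split_ifs with h
    · have h1 : ((2 : ℝ) ^ e) ^ δ ≤ ((p : ℝ) ^ e) ^ δ := by gcongr
      have h2 : 1 + δ * e * Real.log 2 ≤ ((2 : ℝ) ^ e) ^ δ := by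
        rw [← Real.rpow_natCast, ← Real.rpow_mul (by norm_num), Real.rpow_def_of_pos two_pos]
        have := Real.add_one_le_exp (Real.log 2 * (e * δ))
        linarith
      have h3 : (e : ℝ) + 1 ≤ K * (1 + δ * e * Real.log 2) := by
        have e1 : K * (1 + δ * e * Real.log 2) =
            1 + e + δ * e * Real.log 2 + 1 / (δ * Real.log 2) := by
          rw [hK]; field_simp; ring
        rw [e1]
        have : 0 ≤ δ * e * Real.log 2 := by positivity
        have : 0 < 1 / (δ * Real.log 2) := by positivity
        linarith
      push_cast
      exact h3.trans (mul_le_mul_of_nonneg_left (h2.trans h1) (by linarith))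
    · rw [one_mul, hpe]
      have h1 : (2 : ℝ) ≤ (p : ℝ) ^ δ := by
        have h2 : (2 : ℝ) ^ (1 / δ) ≤ p :=
          (Nat.le_ceil _).trans (by exact_mod_cast not_lt.mp h)
        calc (2 : ℝ) = ((2 : ℝ) ^ (1 / δ)) ^ δ := by
              rw [← Real.rpow_mul (by norm_num), one_div_mul_cancel hδ.ne', Real.rpow_one]
          _ ≤ (p : ℝ) ^ δ := by gcongr
      calc ((e + 1 : ℕ) : ℝ) ≤ (2 : ℝ) ^ e := by exact_mod_cast Nat.lt_two_pow_self
        _ ≤ _ := pow_le_pow_left₀ (by norm_num) h1 e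
  push_cast
  push_cast at hfac
  refine (Finset.prod_le_prod (fun p _ => by positivity) hfac).trans ?_
  rw [Finset.prod_mul_distrib]
  have h1 : ∏ p ∈ n.primeFactors, ((p : ℝ) ^ n.factorization p) ^ δ = (n : ℝ) ^ δ := by
    rw [Real.finsetProd_rpow _ _ (fun p _ => by positivity)]
    congr 1
    conv_rhs => rw [← Nat.prod_factorization_pow_eq_self hn.ne']
    rw [Finsupp.prod]
    push_cast
    rfl
  rw [h1]
  gcongr
  rw [Finset.prod_ite, Finset.prod_const, Finset.prod_const_one, mul_one]
  refine pow_le_pow_right₀ hK1 ?_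
  calc _ ≤ (Finset.range P).card := by
        refine Finset.card_le_card fun p hp => ?_
        exact Finset.mem_range.mpr (Finset.mem_filter.mp hp).2
    _ = P := Finset.card_range P

lemma LSeries_eq_finsetSum {f : ℕ → ℂ} {S : Finset ℕ} (h0 : f 0 = 0) (h : ∀ n, n ∉ S → f n = 0)
    (s : ℂ) : LSeriesSummable f s ∧ LSeries f s = ∑ n ∈ S, f n * (n : ℂ) ^ (-s) := by
  have hz : ∀ n ∉ S, LSeries.term f s n = 0 := by
    intro n hn
    rcases Nat.eq_zero_or_pos n with rfl | hn0
    · simp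
    · rw [LSeries.term_of_ne_zero hn0.ne', h n hn, zero_div]
  refine ⟨summable_of_ne_finset_zero hz, ?_⟩
  rw [LSeries, tsum_eq_sum hz]
  refine Finset.sum_congr rfl fun n _ => ?_
  rcases Nat.eq_zero_or_pos n with rfl | hn0
  · simp [h0]
  · rw [LSeries.term_of_ne_zero hn0.ne', Complex.cpow_neg, div_eq_mul_inv]

lemma char_mul_convolution {q : ℕ} (χ : DirichletCharacter ℂ q) (f g : ℕ → ℂ) :
    LSeries.convolution (fun n : ℕ => f n * χ n) (fun n : ℕ => g n * χ n) =
      fun n : ℕ => LSeries.convolution f g n * χ n := by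
  simp only [LSeries.convolution_def]
  ext n
  rw [Finset.sum_mul]
  refine Finset.sum_congr rfl fun p hp => ?_
  rw [← (Nat.mem_divisorsAntidiagonal.mp hp).1]
  push_cast
  rw [map_mul]
  ring

/-- The `(h + 1)`-st power of a Dirichlet polynomial over `(N, 2N]` with coefficients bounded by the
divisor function is a Dirichlet polynomial over `(N ^ (h + 1), (2N) ^ (h + 1)]` with coefficients
`O(n ^ δ)`. The new coefficients do not depend on the twisting character. -/
lemma exists_pow_dirichletPoly (h : ℕ) : ∀ {δ : ℝ}, 0 < δ → ∃ C : ℝ, 0 < C ∧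
    ∀ (N : ℝ) (a : ℕ → ℂ), 1 ≤ N → (∀ n : ℕ, a n ≠ 0 → N < n ∧ n ≤ 2 * N) →
    (∀ n : ℕ, ‖a n‖ ≤ n.divisors.card) →
    ∃ c : ℕ → ℂ, (∀ n : ℕ, c n ≠ 0 → N ^ (h + 1) < n ∧ n ≤ 2 ^ (h + 1) * N ^ (h + 1)) ∧
      (∀ n : ℕ, ‖c n‖ ≤ C * (n : ℝ) ^ δ) ∧
      ∀ (q : ℕ) (χ : DirichletCharacter ℂ q) (s : ℂ),
        LSeries (fun n : ℕ => a n * χ n) s ^ (h + 1) = LSeries (fun n : ℕ => c n * χ n) s := by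
  induction h with
  | zero =>
    intro δ hδ
    obtain ⟨C, hC, H⟩ := exists_card_divisors_le hδ
    refine ⟨C, hC, fun N a hN ha hb => ⟨a, by simpa using ha, fun n => (hb n).trans (H n),
      fun q χ s => by simp⟩⟩
  | succ h ih =>
    intro δ hδ
    obtain ⟨C₁, hC₁, H₁⟩ := ih (δ := δ / 2) (by positivity)
    obtain ⟨C₂, hC₂, H₂⟩ := exists_card_divisors_le (δ := δ / 2) (by positivity)
    refine ⟨C₁ * C₂ * C₂, by positivity, fun N a hN ha hb => ?_⟩
    obtain ⟨c, hc1, hc2, hc3⟩ := H₁ N a hN ha hb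
    have hN0 : 0 < N := by linarith
    have fin : ∀ (f : ℕ → ℂ) (B L : ℝ), 0 < B → (∀ n : ℕ, f n ≠ 0 → B < n ∧ n ≤ L) →
        ∀ (q : ℕ) (χ : DirichletCharacter ℂ q) (s : ℂ),
          LSeriesSummable (fun n : ℕ => f n * χ n) s := by
      intro f B L hB hf q χ s
      refine (LSeries_eq_finsetSum (S := Finset.Icc 1 ⌊L⌋₊) ?_ (fun n hn => ?_) s).1
      · by_contra h0
        have := (hf 0 (fun h => h0 (by simp [h]))).1
        simp at this; linarith
      · by_contra h0
        obtain ⟨h1, h2⟩ := hf n (fun h => h0 (by simp [h]))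
        have hn0 : (0 : ℝ) < n := by linarith
        exact hn (Finset.mem_Icc.mpr ⟨by exact_mod_cast hn0, Nat.le_floor h2⟩)
    refine ⟨LSeries.convolution c a, fun n hn => ?_, fun n => ?_, fun q χ s => ?_⟩
    · rw [LSeries.convolution_def] at hn
      obtain ⟨p, hp, hne⟩ := Finset.exists_ne_zero_of_sum_ne_zero hn
      obtain ⟨k1, k2⟩ := hc1 p.1 (left_ne_zero_of_mul hne)
      obtain ⟨k3, k4⟩ := ha p.2 (right_ne_zero_of_mul hne)
      rw [← (Nat.mem_divisorsAntidiagonal.mp hp).1]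
      push_cast
      constructor
      · rw [pow_succ N (h + 1)]
        exact mul_lt_mul'' k1 k3 (by positivity) hN0.le
      · calc (p.1 : ℝ) * p.2 ≤ (2 ^ (h + 1) * N ^ (h + 1)) * (2 * N) := by gcongr
          _ = _ := by ring
    · rw [LSeries.convolution_def]
      rcases Nat.eq_zero_or_pos n with rfl | hn
      · simp
        positivity
      have hterm : ∀ p ∈ n.divisorsAntidiagonal, ‖c p.1 * a p.2‖ ≤ C₁ * C₂ * (n : ℝ) ^ (δ / 2) := by
        intro p hp
        rw [norm_mul, ← (Nat.mem_divisorsAntidiagonal.mp hp).1]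
        push_cast
        rw [Real.mul_rpow (by positivity) (by positivity)]
        calc _ ≤ (C₁ * (p.1 : ℝ) ^ (δ / 2)) * (C₂ * (p.2 : ℝ) ^ (δ / 2)) := by
              gcongr
              · exact hc2 _
              · exact (hb _).trans (H₂ _)
          _ = _ := by ring
      refine (norm_sum_le_of_le _ hterm).trans ?_
      have hcard : n.divisorsAntidiagonal.card = n.divisors.card := by
        rw [Finset.card_eq_sum_ones, Nat.sum_divisorsAntidiagonal (fun _ _ => 1),
          ← Finset.card_eq_sum_ones]
      rw [Finset.sum_const, nsmul_eq_mul, hcard]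
      have hn0 : (0 : ℝ) < n := by exact_mod_cast hn
      calc _ ≤ (C₂ * (n : ℝ) ^ (δ / 2)) * (C₁ * C₂ * (n : ℝ) ^ (δ / 2)) := by
            gcongr
            exact H₂ n
        _ = C₁ * C₂ * C₂ * ((n : ℝ) ^ (δ / 2) * (n : ℝ) ^ (δ / 2)) := by ring
        _ = _ := by
            rw [← Real.rpow_add hn0, add_halves]
    · rw [pow_succ, hc3, ← LSeries_convolution' (fin c _ _ (by positivity) hc1 q χ s)
        (fin a N _ hN0 ha q χ s), char_mul_convolution]

/-! ### Zeros of the family -/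

/-- The points `(ξψ, ρ)` counted by `zeroCountSum`, without multiplicity: the character lies in the
family and `ρ ≠ 1` is a zero of its `L`-function with `Re ρ ≥ α` and `|Im ρ| ≤ T`. -/
structure IsZeroPoint {k : ℕ} [NeZero k] (Q T α : ℝ) (r : FamilyIndex k × ℂ) : Prop where
  admissible : r.1.Admissible
  modulus_le : (r.1.1 : ℝ) + 1 ≤ Q
  zero : r.1.char.LFunction r.2 = 0
  ne_one : r.2 ≠ 1
  le_re : α ≤ r.2.re
  im_le : |r.2.im| ≤ T

section bounds

variable {k : ℕ} {Q T : ℝ}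

lemma one_le_size [NeZero k] (hQ : 1 ≤ Q) (hT : 1 ≤ T) : 1 ≤ (k : ℝ) * Q ^ 2 * T := by
  have hk : (1 : ℝ) ≤ k := by exact_mod_cast NeZero.pos k
  have h1 : 1 ≤ Q ^ 2 := one_le_pow₀ hQ
  exact one_le_mul_of_one_le_of_one_le (one_le_mul_of_one_le_of_one_le hk h1) hT

lemma modulus_mul_le (hQ : 1 ≤ Q) (hT : 1 ≤ T) {j : ℕ} (hj : (j : ℝ) + 1 ≤ Q) :
    ((k * (j + 1) : ℕ) : ℝ) * T ≤ (k : ℝ) * Q ^ 2 * T := by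
  push_cast
  have : (j : ℝ) + 1 ≤ Q ^ 2 := hj.trans (by nlinarith)
  gcongr

lemma modulus_le_size (hQ : 1 ≤ Q) (hT : 1 ≤ T) {j : ℕ} (hj : (j : ℝ) + 1 ≤ Q) :
    ((k * (j + 1) : ℕ) : ℝ) ≤ (k : ℝ) * Q ^ 2 * T :=
  (le_mul_of_one_le_right (by positivity) hT).trans (modulus_mul_le hQ hT hj)

lemma height_le_size [NeZero k] (hQ : 1 ≤ Q) (hT : 1 ≤ T) : T ≤ (k : ℝ) * Q ^ 2 * T := by
  have hk : (1 : ℝ) ≤ k := by exact_mod_cast NeZero.pos k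
  have h1 : 1 ≤ Q ^ 2 := one_le_pow₀ hQ
  exact le_mul_of_one_le_left (by linarith) (one_le_mul_of_one_le_of_one_le hk h1)

end bounds

/-- The zeros of one `L`-function of the family in a segment of height `2H`. -/
lemma exists_card_zeroPoints_segment_le {τ : ℝ} (hτ : 0 < τ) : ∃ C : ℝ, 0 < C ∧
    ∀ (k : ℕ) [NeZero k] (Q T t H : ℝ) (i : FamilyIndex k) (F : Finset ℂ), 1 ≤ Q → 1 ≤ T → 1 ≤ H →
    (∀ ρ ∈ F, IsZeroPoint Q T (1 / 2) (i, ρ) ∧ |ρ.im - t| ≤ H) →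
    (F.card : ℝ) ≤ C * H * ((k : ℝ) * Q ^ 2 * T) ^ τ ∧
    ∀ ρ ∈ F, analyticOrderAt i.char.LFunction ρ ≠ ⊤ ∧
      (analyticOrderNatAt i.char.LFunction ρ : ℝ) ≤ C * ((k : ℝ) * Q ^ 2 * T) ^ τ := by
  obtain ⟨C, hC, h⟩ := exists_card_zeros_le
  refine ⟨C * (5 ^ τ / τ), by positivity, ?_⟩
  intro k _ Q T t H i F hQ hT hH hF
  rcases F.eq_empty_or_nonempty with rfl | ⟨ρ₀, hρ₀⟩
  · simp
    have := one_le_size (k := k) hQ hT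
    positivity
  have hi := (hF ρ₀ hρ₀).1.modulus_le
  have hD := one_le_size (k := k) hQ hT
  set D := (k : ℝ) * Q ^ 2 * T with hDdef
  obtain ⟨h1, h2⟩ := h _ i.char t H T F hH (by linarith) (fun ρ hρ => by
    obtain ⟨hz, him⟩ := hF ρ hρ
    exact ⟨hz.zero, hz.ne_one, hz.le_re, him, hz.im_le⟩)
  have hlog : Real.log (((k * (i.1 + 1) : ℕ) : ℝ) * (T + 4)) ≤ 5 ^ τ / τ * D ^ τ := by
    have hq : (1 : ℝ) ≤ ((k * (i.1 + 1) : ℕ) : ℝ) := by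
      exact_mod_cast NeZero.pos (k * (i.1 + 1))
    have k1 : ((k * (i.1 + 1) : ℕ) : ℝ) * (T + 4) ≤ 5 * D := by
      have := modulus_mul_le (k := k) hQ hT hi
      rw [← hDdef] at this
      nlinarith
    refine (Real.log_le_log (by nlinarith) k1).trans ?_
    refine (Real.log_le_rpow_div (by linarith) hτ).trans (le_of_eq ?_)
    rw [Real.mul_rpow (by norm_num) (by linarith)]
    ring
  refine ⟨h1.trans ?_, fun ρ hρ => ⟨(h2 ρ hρ).1, (h2 ρ hρ).2.trans ?_⟩⟩
  · calc _ ≤ C * H * (5 ^ τ / τ * D ^ τ) := by gcongr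
      _ = _ := by ring
  · calc _ ≤ C * (5 ^ τ / τ * D ^ τ) := by gcongr
      _ = _ := by ring

/-- The indices with modulus `j + 1 ≤ Q`. -/
noncomputable def familyFinset (k : ℕ) [NeZero k] (Q : ℝ) : Finset (FamilyIndex k) :=
  (Finset.range ⌊Q⌋₊).sigma fun _ => Finset.univ

lemma card_dirichletCharacter_le (n : ℕ) [NeZero n] : Fintype.card (DirichletCharacter ℂ n) ≤ n := by
  rw [← Nat.card_eq_fintype_card, DirichletCharacter.card_eq_totient_of_hasEnoughRootsOfUnity]
  exact Nat.totient_le n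

lemma card_familyFinset_le (k : ℕ) [NeZero k] {Q : ℝ} (hQ : 1 ≤ Q) :
    ((familyFinset k Q).card : ℝ) ≤ k * Q ^ 2 := by
  have h1 : (familyFinset k Q).card ≤ ∑ j ∈ Finset.range ⌊Q⌋₊, ⌊Q⌋₊ * k := by
    rw [familyFinset, Finset.card_sigma]
    refine Finset.sum_le_sum fun j hj => ?_
    rw [Finset.card_univ, Fintype.card_prod]
    have hj' := Finset.mem_range.mp hj
    exact Nat.mul_le_mul ((card_dirichletCharacter_le (j + 1)).trans hj')
      (card_dirichletCharacter_le k)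
  rw [Finset.sum_const, Finset.card_range, smul_eq_mul] at h1
  have h2 : ((⌊Q⌋₊ : ℕ) : ℝ) ≤ Q := Nat.floor_le (by linarith)
  calc ((familyFinset k Q).card : ℝ) ≤ (⌊Q⌋₊ : ℝ) * ((⌊Q⌋₊ : ℝ) * k) := by exact_mod_cast h1
    _ ≤ Q * (Q * k) := by gcongr
    _ = k * Q ^ 2 := by ring

lemma IsZeroPoint.mem_familyFinset {k : ℕ} [NeZero k] {Q T α : ℝ} {r : FamilyIndex k × ℂ}
    (hr : IsZeroPoint Q T α r) : r.1 ∈ familyFinset k Q := by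
  rw [familyFinset, Finset.mem_sigma]
  refine ⟨Finset.mem_range.mpr ?_, Finset.mem_univ _⟩
  have : r.1.1 + 1 ≤ ⌊Q⌋₊ := Nat.le_floor (by exact_mod_cast hr.modulus_le)
  omega

lemma IsZeroPoint.mono {k : ℕ} [NeZero k] {Q T α β : ℝ} {r : FamilyIndex k × ℂ}
    (hr : IsZeroPoint Q T α r) (h : β ≤ α) : IsZeroPoint Q T β r :=
  ⟨hr.admissible, hr.modulus_le, hr.zero, hr.ne_one, h.trans hr.le_re, hr.im_le⟩

lemma IsZeroPoint.re_lt_one {k : ℕ} [NeZero k] {Q T α : ℝ} {r : FamilyIndex k × ℂ}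
    (hr : IsZeroPoint Q T α r) : r.2.re < 1 := by
  by_contra h
  exact r.1.char.LFunction_ne_zero_of_one_le_re (Or.inr hr.ne_one) (not_lt.mp h) hr.zero

/-- The number of points of a set that lie over one given index, by projection to `ℂ`. -/
lemma card_filter_fst_eq {k : ℕ} [DecidableEq ℂ] (R : Finset (FamilyIndex k × ℂ))
    (i : FamilyIndex k) [DecidablePred fun r : FamilyIndex k × ℂ => r.1 = i] :
    (R.filter fun r => r.1 = i).card = ((R.filter fun r => r.1 = i).image Prod.snd).card := by
  refine (Finset.card_image_of_injOn fun r hr s hs h => ?_).symm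
  rw [Finset.mem_coe, Finset.mem_filter] at hr hs
  exact Prod.ext (hr.2.trans hs.2.symm) h

/-- **Riemann–von Mangoldt type bound** for the whole family. -/
lemma exists_card_zeroPoints_le {τ : ℝ} (hτ : 0 < τ) : ∃ C : ℝ, 0 < C ∧
    ∀ (k : ℕ) [NeZero k] (Q T : ℝ) (R : Finset (FamilyIndex k × ℂ)), 1 ≤ Q → 1 ≤ T →
    (∀ r ∈ R, IsZeroPoint Q T (1 / 2) r) →
    (R.card : ℝ) ≤ C * ((k : ℝ) * Q ^ 2 * T) ^ (1 + τ) := by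
  classical
  obtain ⟨C, hC, h⟩ := exists_card_zeroPoints_segment_le hτ
  refine ⟨C, hC, ?_⟩
  intro k _ Q T R hQ hT hR
  have hD := one_le_size (k := k) hQ hT
  set D := (k : ℝ) * Q ^ 2 * T with hDdef
  have hfib : ∀ i ∈ familyFinset k Q, ((R.filter fun r => r.1 = i).card : ℝ) ≤ C * T * D ^ τ := by
    intro i _
    rw [card_filter_fst_eq]
    refine (h k Q T 0 T i _ hQ hT hT fun ρ hρ => ?_).1
    obtain ⟨r, hr, rfl⟩ := Finset.mem_image.mp hρ
    obtain ⟨hr1, rfl⟩ := Finset.mem_filter.mp hr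
    exact ⟨hR r hr1, by simpa using (hR r hr1).im_le⟩
  have hcard : R.card = ∑ i ∈ familyFinset k Q, (R.filter fun r => r.1 = i).card :=
    Finset.card_eq_sum_card_fiberwise fun r hr => (hR r hr).mem_familyFinset
  rw [hcard]
  push_cast
  refine (Finset.sum_le_sum hfib).trans ?_
  rw [Finset.sum_const, nsmul_eq_mul, Real.rpow_add (by linarith), Real.rpow_one]
  calc _ ≤ ((k : ℝ) * Q ^ 2) * (C * T * D ^ τ) := by
        have := card_familyFinset_le k hQ
        gcongr
    _ = C * (D * D ^ τ) := by rw [hDdef]; ring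

/-- The principal character occurs at most once in the family. -/
lemma FamilyIndex.eq_of_char_eq_one {k : ℕ} [NeZero k] {i i' : FamilyIndex k} (hi : i.Admissible)
    (hi' : i'.Admissible) (h : i.char = 1) (h' : i'.char = 1) : i = i' := by
  obtain ⟨j, ψ, ξ⟩ := i
  obtain ⟨j', ψ', ξ'⟩ := i'
  have hq : charQuot ξ ξ' ψ ψ' = 1 := by
    rw [charQuot]
    have e1 : charProd ξ ψ = 1 := h
    have e2 : charProd ξ' ψ' = 1 := h'
    rw [e1, e2]
    simp
  obtain ⟨h1, h2, h3⟩ := charQuot_eq_one hi.1 hi'.1 hi.2 hi'.2 hq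
  have h2' : j + 1 = j' + 1 := h2
  obtain rfl : j = j' := by omega
  obtain rfl := eq_of_heq h3
  rw [h1]

/-! ### Large values at the zeros -/

/-- **Mean value bound at zeros.** If a polynomial over `(N, 2N]` is at least `v` at every point of
`R` and its `(h + 1)`-st power has length a little beyond the size `k Q² T` of the family, then
`R` is as small as the density hypothesis predicts. -/
lemma exists_card_mul_pow_le {g : ℝ} (hg : 0 < g) {Hm : ℕ} (hHm : 1 ≤ Hm) : ∃ C : ℝ, 0 < C ∧
    ∀ (k : ℕ) [NeZero k] (Q T α N v : ℝ) (a : ℕ → ℂ) (R : Finset (FamilyIndex k × ℂ)) (h : ℕ),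
    1 ≤ Q → 1 ≤ T → 1 / 2 ≤ α → 1 ≤ N → 0 ≤ v → h + 1 ≤ Hm →
    ((k : ℝ) * Q ^ 2 * T) ^ (1 + g) ≤ N ^ (h + 1) →
    (∀ r ∈ R, IsZeroPoint Q T α r) →
    (∀ n : ℕ, a n ≠ 0 → N < n ∧ n ≤ 2 * N) → (∀ n : ℕ, ‖a n‖ ≤ n.divisors.card) →
    (∀ r ∈ R, v ≤ ‖LSeries (fun n : ℕ => a n * r.1.char n) r.2‖) →
    (R.card : ℝ) * v ^ (2 * (h + 1)) ≤
      C * (N ^ (h + 1)) ^ (2 - 2 * α + 2 * g) * ((k : ℝ) * Q ^ 2 * T) ^ (2 * g) := by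
  classical
  -- With this `A` the off-diagonal saving `D ^ (-g A)` beats the trivial count `O(D ^ 2)` of the points.
  set A : ℕ := ⌈2 / g⌉₊ + 2 with hA
  have hgA : 2 ≤ g * A := by
    have : 2 / g ≤ A := (Nat.le_ceil _).trans (by rw [hA]; push_cast; linarith)
    rw [div_le_iff₀ hg] at this
    linarith
  set b : ℝ := 2 ^ Hm with hb
  have hb1 : 1 < b := one_lt_pow₀ (by norm_num) (by omega)
  obtain ⟨C₁, hC₁, hLV⟩ := exists_large_values hb1 A (by omega)
  obtain ⟨C₂, hC₂, hseg⟩ := exists_card_zeroPoints_segment_le hg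
  obtain ⟨C₃, hC₃, htot⟩ := exists_card_zeroPoints_le one_pos
  choose C₄ hC₄ hpow using fun h : ℕ => exists_pow_dirichletPoly h hg
  set C₅ : ℝ := ∑ h ∈ Finset.range Hm, C₄ h with hC₅
  have hC₅0 : 0 ≤ C₅ := Finset.sum_nonneg fun h _ => (hC₄ h).le
  refine ⟨b * (C₅ ^ 2 * b ^ (2 * g)) * (C₁ * (C₂ + C₃ * (5 ^ A + 1))) + 1, by positivity, ?_⟩
  intro k _ Q T α N v a R h hQ hT hα hN hv hh hND hR ha hab hv'
  have hD := one_le_size (k := k) hQ hT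
  have hkQ : (k : ℝ) * Q ^ 2 * (3 + 2 * T) ≤ 5 * ((k : ℝ) * Q ^ 2 * T) := by
    have : (0 : ℝ) ≤ (k : ℝ) * Q ^ 2 := by positivity
    nlinarith
  set D := (k : ℝ) * Q ^ 2 * T with hDdef
  have hD0 : 0 < D := by linarith
  set M : ℝ := N ^ (h + 1) with hMdef
  have hM1 : 1 ≤ M := one_le_pow₀ hN
  have hM0 : 0 < M := by linarith
  obtain ⟨c, hc1, hc2, hc3⟩ := hpow h N a hN ha hab
  have hC45 : C₄ h ≤ C₅ :=
    Finset.single_le_sum (f := C₄) (fun h _ => (hC₄ h).le) (Finset.mem_range.mpr (by omega))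
  have hcb : ∀ n : ℕ, c n ≠ 0 → M < n ∧ n ≤ b * M := by
    intro n hn
    obtain ⟨k1, k2⟩ := hc1 n hn
    refine ⟨k1, k2.trans ?_⟩
    have : (2 : ℝ) ^ (h + 1) ≤ b := pow_le_pow_right₀ (by norm_num) hh
    gcongr
  have hDg1 : 1 ≤ D ^ g := Real.one_le_rpow hD hg.le
  have hRα : ∀ r ∈ R, r.1.Admissible ∧ α ≤ r.2.re ∧ r.2.re ≤ α + 1 ∧ |r.2.im| ≤ T := by
    intro r hr
    have := (hR r hr).re_lt_one
    exact ⟨(hR r hr).admissible, (hR r hr).le_re, by linarith, (hR r hr).im_le⟩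
  have hmain := hLV k R (k * Q ^ 2) T M (D ^ g) (C₂ * D ^ g * D ^ g) α c hRα
    (fun r hr s hs => by
      have h1 := (hR r hr).modulus_le
      have h2 := (hR s hs).modulus_le
      rw [sq]
      gcongr)
    (by linarith) hM1 (by linarith) (by positivity) (fun r hr => by
      have e : (R.filter fun s => s.1 = r.1 ∧ |s.2.im - r.2.im| ≤ D ^ g) =
          ((R.filter fun s => |s.2.im - r.2.im| ≤ D ^ g).filter fun s => s.1 = r.1) := by
        ext s
        simp only [Finset.mem_filter]
        tauto
      rw [e, card_filter_fst_eq]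
      refine (hseg k Q T r.2.im (D ^ g) r.1 _ hQ hT hDg1 fun ρ hρ => ?_).1
      obtain ⟨s, hs, rfl⟩ := Finset.mem_image.mp hρ
      obtain ⟨hs1, hs2⟩ := Finset.mem_filter.mp hs
      obtain ⟨hs3, hs4⟩ := Finset.mem_filter.mp hs1
      refine ⟨?_, hs4⟩
      rw [← hs2]
      exact (hR s hs3).mono hα) hcb
  set S := Finset.range (⌊(b + 1) * M⌋₊ + 1) with hS
  have hleft : (R.card : ℝ) * v ^ (2 * (h + 1)) ≤
      ∑ r ∈ R, ‖∑ n ∈ S, c n * r.1.char n * (n : ℂ) ^ (-r.2)‖ ^ 2 := by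
    rw [← nsmul_eq_mul]
    refine Finset.card_nsmul_le_sum _ _ _ fun r hr => ?_
    have e1 : ∑ n ∈ S, c n * r.1.char n * (n : ℂ) ^ (-r.2) =
        LSeries (fun n : ℕ => c n * r.1.char n) r.2 := by
      refine (LSeries_eq_finsetSum (S := S) ?_ (fun n hn => ?_) r.2).2.symm
      · by_contra h0
        have := (hcb 0 (fun h => h0 (by simp [h]))).1
        simp at this; linarith
      · by_contra h0
        have := (hcb n (fun h => h0 (by simp [h]))).2
        rw [hS, Finset.mem_range, not_lt] at hn
        have h2 : (b + 1) * M < n := (Nat.lt_floor_add_one _).trans_le (by exact_mod_cast hn)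
        nlinarith
    rw [e1, ← hc3, norm_pow, ← pow_mul, mul_comm (h + 1) 2]
    exact pow_le_pow_left₀ hv (hv' r hr) _
  have hcoef : ∑ n ∈ S, ‖c n‖ ^ 2 * ((n : ℝ) ^ (-α)) ^ 2 ≤
      (b * M) * ((C₅ * (b * M) ^ g) ^ 2 * (M ^ (-α)) ^ 2) := by
    have e1 : ∑ n ∈ S, ‖c n‖ ^ 2 * ((n : ℝ) ^ (-α)) ^ 2 ≤
        ∑ n ∈ Finset.Icc 1 ⌊b * M⌋₊, (C₅ * (b * M) ^ g) ^ 2 * (M ^ (-α)) ^ 2 := by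
      rw [← Finset.sum_filter_of_ne (s := S) (p := fun n => c n ≠ 0)
        (fun n _ hne h0 => hne (by simp [h0]))]
      refine (Finset.sum_le_sum (g := fun _ => (C₅ * (b * M) ^ g) ^ 2 * (M ^ (-α)) ^ 2)
        fun n hn => ?_).trans ?_
      · obtain ⟨k1, k2⟩ := hcb n (Finset.mem_filter.mp hn).2
        have hn0 : (0 : ℝ) < n := by linarith
        have k3 : ‖c n‖ ≤ C₅ * (b * M) ^ g :=
          (hc2 n).trans (mul_le_mul hC45 (Real.rpow_le_rpow hn0.le k2 hg.le)
            (by positivity) hC₅0)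
        have k4 : (n : ℝ) ^ (-α) ≤ M ^ (-α) :=
          Real.rpow_le_rpow_of_nonpos hM0 k1.le (by linarith)
        gcongr
      · refine Finset.sum_le_sum_of_subset_of_nonneg (fun n hn => ?_) fun n _ _ => by positivity
        obtain ⟨k1, k2⟩ := hcb n (Finset.mem_filter.mp hn).2
        have hn0 : (0 : ℝ) < n := by linarith
        exact Finset.mem_Icc.mpr ⟨by exact_mod_cast hn0, Nat.le_floor k2⟩
    refine e1.trans ?_
    rw [Finset.sum_const, nsmul_eq_mul, Nat.card_Icc, Nat.add_sub_cancel]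
    gcongr
    exact Nat.floor_le (by positivity)
  have hoff : (R.card : ℝ) * ((k * Q ^ 2 * (3 + 2 * T) / M) ^ A + 1 / (D ^ g) ^ A) ≤
      C₃ * (5 ^ A + 1) := by
    have hR2 : (R.card : ℝ) ≤ C₃ * D ^ 2 := by
      have := htot k Q T R hQ hT (fun r hr => (hR r hr).mono hα)
      rw [← hDdef, show (1 : ℝ) + 1 = (2 : ℕ) by norm_num, Real.rpow_natCast] at this
      exact this
    have hDA : D ^ 2 ≤ (D ^ g) ^ A := by
      rw [← Real.rpow_natCast (D ^ g), ← Real.rpow_mul hD0.le, ← Real.rpow_natCast D]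
      exact Real.rpow_le_rpow_of_exponent_le hD (by exact_mod_cast hgA)
    have k1 : k * Q ^ 2 * (3 + 2 * T) / M ≤ 5 / D ^ g := by
      rw [div_le_div_iff₀ hM0 (by positivity)]
      calc _ ≤ 5 * D * D ^ g := by gcongr
        _ = 5 * D ^ (1 + g) := by rw [Real.rpow_add hD0, Real.rpow_one]; ring
        _ ≤ 5 * M := by gcongr
    calc _ ≤ (C₃ * D ^ 2) * ((5 / D ^ g) ^ A + 1 / (D ^ g) ^ A) := by gcongr
      _ = C₃ * (5 ^ A + 1) * (D ^ 2 / (D ^ g) ^ A) := by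
        rw [div_pow]; ring
      _ ≤ C₃ * (5 ^ A + 1) * 1 := by
        gcongr
        exact div_le_one_of_le₀ hDA (by positivity)
      _ = _ := mul_one _
  have hD2g : D ^ (2 * g) = D ^ g * D ^ g := by rw [two_mul, Real.rpow_add hD0]
  have hD2g1 : 1 ≤ D ^ (2 * g) := Real.one_le_rpow hD (by linarith)
  have hMexp : M * (M * ((M ^ g) ^ 2 * (M ^ (-α)) ^ 2)) = M ^ (2 - 2 * α + 2 * g) := by
    rw [← Real.rpow_natCast, ← Real.rpow_natCast, ← Real.rpow_mul hM0.le, ← Real.rpow_mul hM0.le,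
      ← Real.rpow_add hM0]
    nth_rewrite 1 [← Real.rpow_one M]
    nth_rewrite 2 [← Real.rpow_one M]
    rw [← Real.rpow_add hM0, ← Real.rpow_add hM0]
    congr 1
    push_cast
    ring
  calc (R.card : ℝ) * v ^ (2 * (h + 1)) ≤ _ := hleft.trans hmain
    _ ≤ ((b * M) * ((C₅ * (b * M) ^ g) ^ 2 * (M ^ (-α)) ^ 2)) *
        (C₁ * M * (C₂ * D ^ g * D ^ g + C₃ * (5 ^ A + 1))) := by
      gcongr
    _ ≤ ((b * M) * ((C₅ * (b * M) ^ g) ^ 2 * (M ^ (-α)) ^ 2)) *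
        (C₁ * M * (C₂ * D ^ (2 * g) + C₃ * (5 ^ A + 1) * D ^ (2 * g))) := by
      have e : C₂ * D ^ g * D ^ g = C₂ * D ^ (2 * g) := by rw [hD2g]; ring
      rw [e]
      exact mul_le_mul_of_nonneg_left (mul_le_mul_of_nonneg_left
        (add_le_add le_rfl (le_mul_of_one_le_right (by positivity) hD2g1))
        (by positivity)) (by positivity)
    _ = b * (C₅ ^ 2 * b ^ (2 * g)) * (C₁ * (C₂ + C₃ * (5 ^ A + 1))) *
        (M * (M * ((M ^ g) ^ 2 * (M ^ (-α)) ^ 2))) * D ^ (2 * g) := by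
      rw [Real.mul_rpow (by positivity) hM0.le, two_mul g, Real.rpow_add (by positivity : 0 < b)]
      ring
    _ ≤ _ := by
      rw [hMexp]
      gcongr
      linarith

/-! ### The detecting polynomial -/

/-- Splitting a Dirichlet polynomial over `(X, 2 ^ J X]` into dyadic blocks, one of which carries at
least the average. -/
lemma exists_dyadic_block {q : ℕ} (χ : DirichletCharacter ℂ q) {a : ℕ → ℂ} {X v : ℝ} {J : ℕ}
    (hX : 0 ≤ X) (hJ : 0 < J) (ha : ∀ n : ℕ, a n ≠ 0 → X < n ∧ n ≤ 2 ^ J * X) {s : ℂ}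
    (hv : v ≤ ‖LSeries (fun n : ℕ => a n * χ n) s‖) :
    ∃ j < J, v / J ≤ ‖LSeries (fun n : ℕ =>
      (if 2 ^ j * X < n ∧ n ≤ 2 ^ (j + 1) * X then a n else 0) * χ n) s‖ := by
  set f : ℕ → ℕ → ℂ := fun j n => if 2 ^ j * X < n ∧ n ≤ 2 ^ (j + 1) * X then a n else 0 with hf
  -- The blocks partition `(X, 2 ^ J X]`.
  have hsplit : ∀ (J : ℕ) (n : ℕ), ∑ j ∈ Finset.range J, f j n =
      if X < n ∧ n ≤ 2 ^ J * X then a n else 0 := by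
    intro J n
    induction J with
    | zero =>
      rw [Finset.sum_range_zero, if_neg]
      rintro ⟨h1, h2⟩
      simp at h2
      linarith
    | succ J ih =>
      have h1 : (1 : ℝ) ≤ 2 ^ J := one_le_pow₀ (by norm_num)
      have h2 : X ≤ 2 ^ J * X := le_mul_of_one_le_left hX h1
      have h3 : 2 ^ (J + 1) * X = 2 * (2 ^ J * X) := by ring
      rw [Finset.sum_range_succ, ih, hf]
      by_cases c1 : (n : ℝ) ≤ 2 ^ J * X
      · have c2 : (n : ℝ) ≤ 2 ^ (J + 1) * X := by linarith
        simp [c1, c2, c1.not_gt]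
      · have c3 : X < n := by linarith
        simp [c1, c3, not_le.mp c1]
  set S := Finset.range (⌊2 ^ J * X⌋₊ + 1) with hS
  have hmem : ∀ n : ℕ, a n ≠ 0 → n ∈ S := fun n hn =>
    Finset.mem_range.mpr (Nat.lt_succ_of_le (Nat.le_floor (ha n hn).2))
  have ha0 : a 0 = 0 := by
    by_contra h
    have := (ha 0 h).1
    simp at this
    linarith
  have hfa : ∀ j n, a n = 0 → f j n = 0 := by
    intro j n h
    simp [hf, h]
  have hL : LSeries (fun n : ℕ => a n * χ n) s =
      ∑ j ∈ Finset.range J, LSeries (fun n : ℕ => f j n * χ n) s := by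
    rw [(LSeries_eq_finsetSum (S := S) (by simp [ha0]) (fun n hn => by
      rw [not_ne_iff.mp (mt (hmem n) hn), zero_mul]) s).2]
    rw [Finset.sum_congr rfl fun j _ => (LSeries_eq_finsetSum (f := fun n : ℕ => f j n * χ n)
      (S := S) (by simp [hfa j 0 ha0]) (fun n hn => by
        rw [hfa j n (not_ne_iff.mp (mt (hmem n) hn)), zero_mul]) s).2]
    rw [Finset.sum_comm]
    refine Finset.sum_congr rfl fun n _ => ?_
    rw [← Finset.sum_mul, ← Finset.sum_mul, hsplit J n]
    by_cases h : a n = 0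
    · simp [h]
    · rw [if_pos (ha n h)]
  by_contra! hcon
  have hJ' : (0 : ℝ) < J := by exact_mod_cast hJ
  have : ‖LSeries (fun n : ℕ => a n * χ n) s‖ < ∑ j ∈ Finset.range J, v / J := by
    rw [hL]
    refine (norm_sum_le _ _).trans_lt (Finset.sum_lt_sum_of_nonempty ⟨0, Finset.mem_range.mpr hJ⟩
      fun j hj => hcon j (Finset.mem_range.mp hj))
  rw [Finset.sum_const, Finset.card_range, nsmul_eq_mul, mul_div_cancel₀ _ hJ'.ne'] at this
  linarith

/-- The coefficients of the zero-detecting polynomial: the smoothed coefficients of `ζ` times the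
mollifier, without the leading `1`. -/
noncomputable def detectCoeff (X : ℕ) (Y : ℝ) (n : ℕ) : ℂ :=
  if X < n then mollCoeff X n * ((max (1 - n / Y) 0 : ℝ) : ℂ) else 0

lemma norm_detectCoeff_le (X : ℕ) {Y : ℝ} (hY : 0 < Y) (n : ℕ) :
    ‖detectCoeff X Y n‖ ≤ n.divisors.card := by
  unfold detectCoeff
  split_ifs
  · rw [norm_mul, Complex.norm_real, Real.norm_of_nonneg (le_max_right _ _)]
    have : max (1 - (n : ℝ) / Y) 0 ≤ 1 := by
      refine max_le ?_ zero_le_one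
      have : 0 ≤ (n : ℝ) / Y := by positivity
      linarith
    exact (mul_le_of_le_one_right (norm_nonneg _) this).trans (norm_mollCoeff_le X n)
  · simp

lemma detectCoeff_ne_zero {X : ℕ} {Y : ℝ} (hY : 0 < Y) {n : ℕ} (h : detectCoeff X Y n ≠ 0) :
    X < n ∧ (n : ℝ) < Y := by
  unfold detectCoeff at h
  split_ifs at h with h1
  · refine ⟨h1, ?_⟩
    by_contra h2
    refine h ?_
    rw [max_eq_right, Complex.ofReal_zero, mul_zero]
    have : 1 ≤ (n : ℝ) / Y := by rw [le_div_iff₀ hY]; linarith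
    linarith
  · exact absurd rfl h

lemma sum_mollCoeff_eq {q : ℕ} (χ : DirichletCharacter ℂ q) {X : ℕ} (hX : 1 ≤ X) {Y : ℝ}
    (hY : 1 ≤ Y) (s : ℂ) :
    ∑ n ∈ Finset.Icc 1 ⌊Y⌋₊, χ n * mollCoeff X n * (n : ℂ) ^ (-s) *
      ((max (1 - n / Y) 0 : ℝ) : ℂ) =
    ((1 - 1 / Y : ℝ) : ℂ) + LSeries (fun n : ℕ => detectCoeff X Y n * χ n) s := by
  have hY0 : 0 < Y := by linarith
  have h1 : 1 ∈ Finset.Icc 1 ⌊Y⌋₊ := Finset.mem_Icc.mpr ⟨le_rfl, Nat.le_floor (by simpa using hY)⟩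
  rw [(LSeries_eq_finsetSum (S := Finset.Icc 1 ⌊Y⌋₊) (by simp [detectCoeff]) (fun n hn => by
    have : detectCoeff X Y n = 0 := by
      by_contra h
      obtain ⟨k1, k2⟩ := detectCoeff_ne_zero hY0 h
      exact hn (Finset.mem_Icc.mpr ⟨by omega, Nat.le_floor k2.le⟩)
    rw [this, zero_mul]) s).2]
  rw [← Finset.add_sum_erase _ _ h1, ← Finset.add_sum_erase _ (fun n : ℕ =>
    detectCoeff X Y n * χ n * (n : ℂ) ^ (-s)) h1]
  have e1 : detectCoeff X Y 1 = 0 := if_neg (by omega)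
  have e2 : 0 ≤ 1 - 1 / Y := by
    have : 1 / Y ≤ 1 := (div_le_one hY0).mpr hY
    linarith
  rw [e1, mollCoeff_one hX]
  simp only [Nat.cast_one, map_one, Complex.one_cpow, max_eq_left e2]
  rw [zero_mul, zero_mul, zero_add, one_mul, one_mul, one_mul]
  congr 1
  refine Finset.sum_congr rfl fun n hn => ?_
  obtain ⟨k1, k2⟩ := Finset.mem_erase.mp hn
  have k3 := (Finset.mem_Icc.mp k2).1
  unfold detectCoeff
  split_ifs with h
  · ring
  · rw [mollCoeff_eq_zero (by omega) (by omega)]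
    ring

/-- **Zeros make the detecting polynomial large.** Under the Lindelöf hypothesis the polynomial of
length `D ^ y`, with mollifier of length `D ^ (y θ / 4)`, is at least `1 / 2` at every zero to the right
of `1 / 2 + θ`, except for zeros of the principal character close to the pole. -/
lemma exists_half_le_norm_LSeries (hGLH : GeneralizedLindelofHypothesis) {θ y : ℝ} (hθ : 0 < θ)
    (hθ1 : θ ≤ 1) (hy : 0 < y) (hy1 : 3 * y ≤ 1) : ∃ D₀ : ℝ, 1 ≤ D₀ ∧
    ∀ (k : ℕ) [NeZero k] (Q T D : ℝ) (r : FamilyIndex k × ℂ), 1 ≤ Q → 1 ≤ T →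
    D = (k : ℝ) * Q ^ 2 * T → D₀ ≤ D →
    IsZeroPoint Q T (1 / 2 + θ) r → (r.1.char ≠ 1 ∨ 2 * D ^ (3 * y) ≤ |r.2.im|) →
    1 / 2 ≤ ‖LSeries (fun n : ℕ =>
      detectCoeff ⌊D ^ (y * θ / 4)⌋₊ (D ^ y) n * r.1.char n) r.2‖ := by
  -- Each of the mollifier and the Lindelöf bound loses `D ^ x`, while moving the line gains
  -- `Y ^ θ = D ^ (4 x)`.
  set x := y * θ / 4 with hx
  have hx0 : 0 < x := by positivity
  obtain ⟨C, hC, hL⟩ := norm_LFunction_le_of_GLH hGLH (l := x / 2) (by positivity)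
  set K := 2 * (C * 2 ^ x) * (2 / θ + 5) + 9 with hK
  have hlim : Tendsto (fun D : ℝ => K * D ^ (-(2 * x))) atTop (𝓝 0) := by
    simpa using (tendsto_rpow_neg_atTop (show 0 < 2 * x by positivity)).const_mul K
  obtain ⟨D₁, hD₁⟩ := eventually_atTop.mp (hlim.eventually (gt_mem_nhds (show (0 : ℝ) < 1 / 2 by norm_num)))
  refine ⟨max D₁ 1, le_max_right _ _, ?_⟩
  intro k _ Q T D r hQ hT hDdef hD hr hexc
  have hDerr := hD₁ D ((le_max_left _ _).trans hD)
  have hD1 : 1 ≤ D := (le_max_right _ _).trans hD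
  have hD0 : 0 < D := by linarith
  set Y := D ^ y with hY
  -- The truncation height must exceed `Y ^ 2`, the size of `Y ^ w` on the line `Re w = 2`.
  set H := D ^ (3 * y) with hH
  set X := ⌊D ^ x⌋₊ with hX
  have hY1 : 1 ≤ Y := Real.one_le_rpow hD1 hy.le
  have hH1 : 1 ≤ H := Real.one_le_rpow hD1 (by linarith)
  have hHD : H ≤ D := by
    calc H ≤ D ^ (1 : ℝ) := Real.rpow_le_rpow_of_exponent_le hD1 hy1
      _ = D := Real.rpow_one D
  have hX1 : 1 ≤ X := Nat.le_floor (by simpa using Real.one_le_rpow hD1 hx0.le)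
  have hXle : (X : ℝ) ≤ D ^ x := Nat.floor_le (by positivity)
  have hTD : T ≤ D := by rw [hDdef]; exact height_le_size hQ hT
  have hqD := modulus_le_size (k := k) hQ hT hr.modulus_le
  rw [← hDdef] at hqD
  have hΛ : ∀ s : ℂ, 1 / 2 ≤ s.re → |s.im - r.2.im| ≤ H →
      s ∈ (if r.1.char = 1 then ({1}ᶜ : Set ℂ) else univ) ∧
        ‖r.1.char.LFunction s‖ ≤ C * 2 ^ x * D ^ x := by
    intro s hs hsH
    have him : r.1.char = 1 → 1 ≤ |s.im| := by
      intro h1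
      have h2 := hexc.resolve_left (not_not.mpr h1)
      have h3 : |r.2.im| ≤ |s.im| + |s.im - r.2.im| := by
        have := abs_sub_abs_le_abs_sub r.2.im s.im
        rw [abs_sub_comm] at this
        linarith
      linarith
    constructor
    · split_ifs with h1
      · intro h2
        have := him h1
        rw [mem_singleton_iff.mp h2] at this
        simp at this
        linarith
      · trivial
    · refine (hL _ _ s hs ?_).trans ?_
      · by_cases h1 : r.1.char = 1
        · exact Or.inr (by linarith [him h1])
        · exact Or.inl h1
      · have h4 : |s.im| ≤ 2 * D := by
          have := abs_sub_abs_le_abs_sub s.im r.2.im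
          linarith [hr.im_le]
        have h5 : ((k * (r.1.1 + 1) : ℕ) : ℝ) * (2 + |s.im|) ≤ (2 * D) ^ 2 := by
          calc _ ≤ D * (2 * D + 2 * D) := by gcongr; linarith
            _ = (2 * D) ^ 2 := by ring
        rw [mul_assoc, ← Real.mul_rpow (by norm_num) hD0.le]
        gcongr
        calc _ ≤ ((2 * D) ^ 2) ^ (x / 2) := by gcongr
          _ = (2 * D) ^ x := by
            rw [← Real.rpow_natCast, ← Real.rpow_mul (by positivity)]
            congr 1
            push_cast
            ring
  have hdet := norm_sum_mollCoeff_le r.1.char hr.zero hX1 hθ hr.le_re hr.re_lt_one.le hH1 hY1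
    (U := if r.1.char = 1 then ({1}ᶜ : Set ℂ) else univ)
    (by split_ifs; exacts [isOpen_compl_singleton, isOpen_univ])
    (by
      split_ifs with h1
      · exact fun s hs => (DirichletCharacter.differentiableAt_LFunction _ _
          (Or.inl hs)).differentiableWithinAt
      · exact (DirichletCharacter.differentiable_LFunction h1).differentiableOn) hΛ
  rw [sum_mollCoeff_eq _ hX1 hY1] at hdet
  have hexp : ∀ e : ℝ, e ≤ -(2 * x) → D ^ e ≤ D ^ (-(2 * x)) := fun e he =>
    Real.rpow_le_rpow_of_exponent_le hD1 he
  have hyx : 2 * x ≤ y := by rw [hx]; nlinarith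
  have t1 : C * 2 ^ x * D ^ x * X * Y ^ (-θ) * (2 / θ) ≤ C * 2 ^ x * (2 / θ) * D ^ (-(2 * x)) := by
    calc _ ≤ C * 2 ^ x * D ^ x * D ^ x * Y ^ (-θ) * (2 / θ) := by gcongr
      _ = C * 2 ^ x * (2 / θ) * (D ^ x * D ^ x * Y ^ (-θ)) := by ring
      _ = C * 2 ^ x * (2 / θ) * D ^ (-(2 * x)) := by
        rw [hY, ← Real.rpow_mul hD0.le, ← Real.rpow_add hD0, ← Real.rpow_add hD0]
        congr 2
        rw [hx]
        ring
  have t2 : C * 2 ^ x * D ^ x * X * Y ^ 2 * (5 / H ^ 2) ≤ C * 2 ^ x * 5 * D ^ (-(2 * x)) := by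
    calc _ ≤ C * 2 ^ x * D ^ x * D ^ x * Y ^ 2 * (5 / H ^ 2) := by gcongr
      _ = C * 2 ^ x * 5 * (D ^ x * D ^ x * Y ^ 2 * (H ^ 2)⁻¹) := by ring
      _ = C * 2 ^ x * 5 * D ^ (2 * x - 4 * y) := by
        rw [hY, hH, ← Real.rpow_natCast, ← Real.rpow_natCast, ← Real.rpow_mul hD0.le,
          ← Real.rpow_mul hD0.le, ← Real.rpow_neg hD0.le, ← Real.rpow_add hD0,
          ← Real.rpow_add hD0, ← Real.rpow_add hD0]
        congr 2
        push_cast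
        ring
      _ ≤ _ := by
        gcongr
        linarith
  have t3 : Y ^ 2 * (8 / H) ≤ 8 * D ^ (-(2 * x)) := by
    calc _ = 8 * (Y ^ 2 * H⁻¹) := by ring
      _ = 8 * D ^ (-y) := by
        rw [hY, hH, ← Real.rpow_natCast, ← Real.rpow_mul hD0.le, ← Real.rpow_neg hD0.le,
          ← Real.rpow_add hD0]
        congr 2
        push_cast
        ring
      _ ≤ _ := by
        have := hexp (-y) (by linarith)
        gcongr
  have t4 : 1 / Y ≤ D ^ (-(2 * x)) := by
    rw [one_div, hY, ← Real.rpow_neg hD0.le]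
    exact hexp _ (by linarith)
  set Lv := LSeries (fun n : ℕ => detectCoeff X Y n * r.1.char n) r.2 with hLv
  have hY0 : 0 ≤ 1 - 1 / Y := by
    have : 1 / Y ≤ 1 := (div_le_one (by linarith)).mpr hY1
    linarith
  have htri : 1 - 1 / Y ≤ ‖((1 - 1 / Y : ℝ) : ℂ) + Lv‖ + ‖Lv‖ := by
    have := norm_sub_le (((1 - 1 / Y : ℝ) : ℂ) + Lv) Lv
    rw [add_sub_cancel_right, Complex.norm_real, Real.norm_of_nonneg hY0] at this
    exact this
  have hE : 0 ≤ D ^ (-(2 * x)) := by positivity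
  have hCE : 0 ≤ C * 2 ^ x * (2 / θ + 5) * D ^ (-(2 * x)) := by positivity
  rw [hK] at hDerr
  nlinarith

/-! ### Density of distinct zeros -/

/-- A short polynomial is raised to the first power whose length exceeds `D ^ (1 + g)`, which is then at
most `D ^ (1 + 2g)`. The number of factors stays bounded when the polynomial is not too short. -/
lemma exists_card_mul_pow_le_of_short {g x : ℝ} (hg : 0 < g) (hg1 : g ≤ 1) (hx : 0 < x) :
    ∃ Hm : ℕ, ∃ C : ℝ, 0 < C ∧
    ∀ (k : ℕ) [NeZero k] (Q T D α N v : ℝ) (a : ℕ → ℂ) (R : Finset (FamilyIndex k × ℂ)),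
    1 ≤ Q → 1 ≤ T → D = (k : ℝ) * Q ^ 2 * T → 1 / 2 ≤ α → 0 ≤ v → v ≤ 1 →
    D ^ x ≤ N → N ≤ D ^ g →
    (∀ r ∈ R, IsZeroPoint Q T α r) →
    (∀ n : ℕ, a n ≠ 0 → N < n ∧ n ≤ 2 * N) → (∀ n : ℕ, ‖a n‖ ≤ n.divisors.card) →
    (∀ r ∈ R, v ≤ ‖LSeries (fun n : ℕ => a n * r.1.char n) r.2‖) →
    (R.card : ℝ) * v ^ (2 * Hm) ≤ C * D ^ (2 - 2 * α + 10 * g) := by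
  set Hm : ℕ := ⌈(1 + g) / x⌉₊ + 1 with hHm
  obtain ⟨C, hC, h⟩ := exists_card_mul_pow_le hg (Hm := Hm) (by omega)
  refine ⟨Hm, C, hC, ?_⟩
  intro k _ Q T D α N v a R hQ hT hDdef hα hv hv1 hN hNg hR ha hab hL
  have hD : 1 ≤ D := hDdef ▸ one_le_size (k := k) hQ hT
  have hD0 : 0 < D := by linarith
  have hN1 : 1 ≤ N := (Real.one_le_rpow hD hx.le).trans hN
  rcases R.eq_empty_or_nonempty with rfl | ⟨r₀, hr₀⟩
  · simp
    positivity
  have hα1 : α < 1 := (hR r₀ hr₀).le_re.trans_lt (hR r₀ hr₀).re_lt_one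
  have hbig : D ^ (1 + g) ≤ N ^ (⌈(1 + g) / x⌉₊ + 1) := by
    have h1 : (1 + g) / x ≤ (⌈(1 + g) / x⌉₊ : ℝ) := Nat.le_ceil _
    rw [div_le_iff₀ hx] at h1
    calc D ^ (1 + g) ≤ D ^ (x * ((⌈(1 + g) / x⌉₊ + 1 : ℕ) : ℝ)) := by
          refine Real.rpow_le_rpow_of_exponent_le hD ?_
          push_cast
          nlinarith
      _ = (D ^ x) ^ (⌈(1 + g) / x⌉₊ + 1) := by
          rw [Real.rpow_mul hD0.le, Real.rpow_natCast]
      _ ≤ _ := by gcongr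
  classical
  have hex : ∃ h : ℕ, D ^ (1 + g) ≤ N ^ (h + 1) := ⟨_, hbig⟩
  -- Minimality of `h₀` keeps the length below `D ^ (1 + 2 g)`.
  set h₀ := Nat.find hex with hh₀
  have hlow : D ^ (1 + g) ≤ N ^ (h₀ + 1) := Nat.find_spec hex
  have hle : h₀ + 1 ≤ Hm := Nat.succ_le_succ (Nat.find_min' hex hbig)
  have hup : N ^ (h₀ + 1) ≤ D ^ (1 + 2 * g) := by
    rcases Nat.eq_zero_or_pos h₀ with h0 | h0
    · rw [h0, zero_add, pow_one]
      exact hNg.trans (Real.rpow_le_rpow_of_exponent_le hD (by linarith))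
    · have h1 : N ^ h₀ < D ^ (1 + g) := by
        have := Nat.find_min hex (m := h₀ - 1) (by omega)
        rwa [Nat.sub_add_cancel h0, not_le] at this
      calc N ^ (h₀ + 1) = N ^ h₀ * N := pow_succ _ _
        _ ≤ D ^ (1 + g) * D ^ g := by gcongr
        _ = D ^ (1 + 2 * g) := by rw [← Real.rpow_add hD0]; congr 1; ring
  have hmain := h k Q T α N v a R h₀ hQ hT hα hN1 hv hle (hDdef ▸ hlow) hR ha hab hL
  rw [← hDdef] at hmain
  calc (R.card : ℝ) * v ^ (2 * Hm) ≤ R.card * v ^ (2 * (h₀ + 1)) := by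
        have := pow_le_pow_of_le_one hv hv1 (show 2 * (h₀ + 1) ≤ 2 * Hm by omega)
        gcongr
    _ ≤ C * (N ^ (h₀ + 1)) ^ (2 - 2 * α + 2 * g) * D ^ (2 * g) := hmain
    _ ≤ C * (D ^ (1 + 2 * g)) ^ (2 - 2 * α + 2 * g) * D ^ (2 * g) := by
        have : 0 ≤ 2 - 2 * α + 2 * g := by linarith
        gcongr
    _ = C * D ^ ((1 + 2 * g) * (2 - 2 * α + 2 * g) + 2 * g) := by
        rw [← Real.rpow_mul hD0.le, mul_assoc, ← Real.rpow_add hD0]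
    _ ≤ C * D ^ (2 - 2 * α + 10 * g) := by
        have : (1 + 2 * g) * (2 - 2 * α + 2 * g) + 2 * g ≤ 2 - 2 * α + 10 * g := by nlinarith
        have := Real.rpow_le_rpow_of_exponent_le hD this
        gcongr

/-- The density bound for the zeros at which the detecting polynomial is large. -/
lemma exists_card_detected_le {g x : ℝ} (hg : 0 < g) (hg1 : g ≤ 1) (hx : 0 < x) :
    ∃ D₀ C : ℝ, 1 ≤ D₀ ∧ 0 < C ∧
    ∀ (k : ℕ) [NeZero k] (Q T D α : ℝ) (R : Finset (FamilyIndex k × ℂ)),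
    1 ≤ Q → 1 ≤ T → D = (k : ℝ) * Q ^ 2 * T → D₀ ≤ D → 1 / 2 ≤ α →
    (∀ r ∈ R, IsZeroPoint Q T α r) →
    (∀ r ∈ R, 1 / 2 ≤ ‖LSeries (fun n : ℕ =>
      detectCoeff ⌊D ^ x⌋₊ (D ^ g) n * r.1.char n) r.2‖) →
    (R.card : ℝ) ≤ C * D ^ (2 - 2 * α + 11 * g) := by
  classical
  obtain ⟨Hm, C, hC, hshort⟩ := exists_card_mul_pow_le_of_short hg hg1 (x := x / 2) (by positivity)
  -- The number `J` of blocks is `O(log D)`; it enters to the power `2 Hm + 1`, which costs `D ^ g`.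
  set τ := g / (2 * Hm + 1 : ℕ) with hτ
  have hτ0 : 0 < τ := by positivity
  set B := g / τ / Real.log 2 + 2 with hB
  have hl2 : 0 < Real.log 2 := Real.log_pos (by norm_num)
  have hB0 : 0 < B := by positivity
  refine ⟨2 ^ (2 / x), (2 * B) ^ (2 * Hm + 1) * C, Real.one_le_rpow (by norm_num) (by positivity),
    by positivity, ?_⟩
  intro k _ Q T D α R hQ hT hDdef hD₀ hα hR hL
  have hD : 1 ≤ D := hDdef ▸ one_le_size (k := k) hQ hT
  have hD0 : 0 < D := by linarith
  set X := ⌊D ^ x⌋₊ with hX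
  set Y := D ^ g with hY
  have hY1 : 1 ≤ Y := Real.one_le_rpow hD hg.le
  have hY0 : 0 < Y := by linarith
  have hXlow : D ^ (x / 2) ≤ X := by
    have h2 : 2 ≤ D ^ (x / 2) := by
      calc (2 : ℝ) = (2 ^ (2 / x)) ^ (x / 2) := by
            rw [← Real.rpow_mul (by norm_num), show 2 / x * (x / 2) = 1 by field_simp,
              Real.rpow_one]
        _ ≤ _ := by gcongr
    have h3 : D ^ x = D ^ (x / 2) * D ^ (x / 2) := by rw [← Real.rpow_add hD0, add_halves]
    have h4 : D ^ x < X + 1 := Nat.lt_floor_add_one _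
    nlinarith
  set J := ⌈Real.logb 2 Y⌉₊ + 1 with hJ
  have hJ1 : (1 : ℝ) ≤ J := by rw [hJ]; push_cast; linarith [Nat.cast_nonneg (α := ℝ) ⌈Real.logb 2 Y⌉₊]
  have hlogY : Real.log Y = g * Real.log D := Real.log_rpow hD0 g
  have hlog0 : 0 ≤ Real.logb 2 Y := Real.logb_nonneg (by norm_num) hY1
  have hJle : (J : ℝ) ≤ B * D ^ τ := by
    have h1 : (J : ℝ) ≤ Real.logb 2 Y + 2 := by
      have := Nat.ceil_lt_add_one hlog0
      rw [hJ]; push_cast; linarith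
    have h2 : Real.logb 2 Y ≤ g / τ / Real.log 2 * D ^ τ := by
      rw [Real.logb, hlogY, div_le_iff₀ hl2]
      calc g * Real.log D ≤ g * (D ^ τ / τ) := by
            have := Real.log_le_rpow_div hD0.le hτ0
            gcongr
        _ = _ := by field_simp
    have h3 : 1 ≤ D ^ τ := Real.one_le_rpow hD hτ0.le
    rw [hB, add_mul]
    linarith
  have hYJ : Y ≤ 2 ^ J := by
    rw [← Real.rpow_natCast]
    calc Y = 2 ^ Real.logb 2 Y := (Real.rpow_logb (by norm_num) (by norm_num) hY0).symm
      _ ≤ _ := by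
        refine Real.rpow_le_rpow_of_exponent_le (by norm_num) ((Nat.le_ceil _).trans ?_)
        rw [hJ]; push_cast; linarith
  have hX1 : (1 : ℝ) ≤ X := (Real.one_le_rpow hD (by positivity)).trans hXlow
  set a := detectCoeff X Y with ha
  set f : ℕ → ℕ → ℂ := fun j n =>
    if 2 ^ j * (X : ℝ) < n ∧ (n : ℝ) ≤ 2 ^ (j + 1) * X then a n else 0 with hf
  set v : ℝ := 1 / 2 / J with hv
  have hv0 : 0 < v := by positivity
  have hv1 : v ≤ 1 := by
    rw [hv, div_le_one (by linarith)]
    linarith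
  have hsupp : ∀ n : ℕ, a n ≠ 0 → (X : ℝ) < n ∧ (n : ℝ) ≤ 2 ^ J * X := by
    intro n hn
    obtain ⟨h1, h2⟩ := detectCoeff_ne_zero hY0 hn
    refine ⟨by exact_mod_cast h1, h2.le.trans (hYJ.trans ?_)⟩
    exact le_mul_of_one_le_right (by positivity) hX1
  set Rj : ℕ → Finset (FamilyIndex k × ℂ) := fun j =>
    R.filter fun r => v ≤ ‖LSeries (fun n : ℕ => f j n * r.1.char n) r.2‖ with hRj
  have hcover : R ⊆ (Finset.range J).biUnion Rj := by
    intro r hr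
    obtain ⟨j, hj, hj'⟩ := exists_dyadic_block r.1.char (Nat.cast_nonneg X) (by omega) hsupp (hL r hr)
    exact Finset.mem_biUnion.mpr ⟨j, Finset.mem_range.mpr hj, Finset.mem_filter.mpr ⟨hr, hj'⟩⟩
  have hblock : ∀ j ∈ Finset.range J, ((Rj j).card : ℝ) * v ^ (2 * Hm) ≤
      C * D ^ (2 - 2 * α + 10 * g) := by
    intro j _
    rcases (Rj j).eq_empty_or_nonempty with he | ⟨r₀, hr₀⟩
    · rw [he]
      simp
      positivity
    -- A block that is large somewhere has a term, so it starts below `Y`.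
    have hne : ∃ n, f j n ≠ 0 := by
      by_contra! hz
      have h1 := (Finset.mem_filter.mp hr₀).2
      have h2 : (fun n : ℕ => f j n * r₀.1.char n) = 0 := by
        ext n
        simp [hz n]
      rw [h2, LSeries_zero] at h1
      simp at h1
      linarith
    obtain ⟨n₀, hn₀⟩ := hne
    have hfj : ∀ n, f j n ≠ 0 →
        (2 ^ j * (X : ℝ) < n ∧ (n : ℝ) ≤ 2 ^ (j + 1) * X) ∧ a n ≠ 0 := by
      intro n hn
      rw [hf] at hn
      simpa [and_assoc] using hn
    have hXj : D ^ (x / 2) ≤ 2 ^ j * (X : ℝ) :=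
      hXlow.trans (le_mul_of_one_le_left (by positivity) (one_le_pow₀ (by norm_num)))
    refine hshort k Q T D α (2 ^ j * X) v (f j) (Rj j) hQ hT hDdef hα hv0.le hv1 hXj ?_
      (fun r hr => hR r (Finset.mem_filter.mp hr).1) (fun n hn => ?_) (fun n => ?_)
      (fun r hr => (Finset.mem_filter.mp hr).2)
    · obtain ⟨h1, h2⟩ := hfj n₀ hn₀
      exact h1.1.le.trans (detectCoeff_ne_zero hY0 h2).2.le
    · obtain ⟨h1, h2⟩ := (hfj n hn).1
      exact ⟨h1, h2.trans (le_of_eq (by ring))⟩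
    · rw [hf]
      dsimp only
      split_ifs
      · exact norm_detectCoeff_le X hY0 n
      · simp
  have hsum : (R.card : ℝ) ≤ ∑ j ∈ Finset.range J, ((Rj j).card : ℝ) := by
    exact_mod_cast (Finset.card_le_card hcover).trans Finset.card_biUnion_le
  have hprod : (R.card : ℝ) * v ^ (2 * Hm) ≤ J * (C * D ^ (2 - 2 * α + 10 * g)) := by
    calc _ ≤ (∑ j ∈ Finset.range J, ((Rj j).card : ℝ)) * v ^ (2 * Hm) := by gcongr
      _ = ∑ j ∈ Finset.range J, ((Rj j).card : ℝ) * v ^ (2 * Hm) := Finset.sum_mul _ _ _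
      _ ≤ ∑ j ∈ Finset.range J, C * D ^ (2 - 2 * α + 10 * g) := Finset.sum_le_sum hblock
      _ = _ := by rw [Finset.sum_const, Finset.card_range, nsmul_eq_mul]
  have hvJ : v ^ (2 * Hm) * (2 * J : ℝ) ^ (2 * Hm) = 1 := by
    rw [← mul_pow, hv, show 1 / 2 / (J : ℝ) * (2 * J) = 1 by field_simp, one_pow]
  calc (R.card : ℝ) = R.card * v ^ (2 * Hm) * (2 * J : ℝ) ^ (2 * Hm) := by
        rw [mul_assoc, hvJ, mul_one]
    _ ≤ J * (C * D ^ (2 - 2 * α + 10 * g)) * (2 * J : ℝ) ^ (2 * Hm) := by gcongr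
    _ ≤ (2 * J) * (C * D ^ (2 - 2 * α + 10 * g)) * (2 * J : ℝ) ^ (2 * Hm) := by
        gcongr
        linarith
    _ = (2 * J : ℝ) ^ (2 * Hm + 1) * (C * D ^ (2 - 2 * α + 10 * g)) := by ring
    _ ≤ (2 * (B * D ^ τ)) ^ (2 * Hm + 1) * (C * D ^ (2 - 2 * α + 10 * g)) := by gcongr
    _ = (2 * B) ^ (2 * Hm + 1) * C * ((D ^ τ) ^ (2 * Hm + 1) * D ^ (2 - 2 * α + 10 * g)) := by
        rw [← mul_assoc 2, mul_pow]
        ring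
    _ = _ := by
        rw [← Real.rpow_natCast (D ^ τ), ← Real.rpow_mul hD0.le, ← Real.rpow_add hD0, hτ,
          div_mul_cancel₀ _ (by positivity)]
        congr 2
        ring

/-- The density bound for the number of distinct zeros to the right of `1 / 2 + θ`: detected zeros,
low zeros of the principal character, and bounded `D` are treated separately. -/
lemma exists_card_le_of_half_add_le (hGLH : GeneralizedLindelofHypothesis) {g θ : ℝ} (hg : 0 < g)
    (hg1 : 3 * g ≤ 1) (hθ : 0 < θ) (hθ1 : θ ≤ 1) : ∃ C : ℝ, 0 < C ∧
    ∀ (k : ℕ) [NeZero k] (Q T D α : ℝ) (R : Finset (FamilyIndex k × ℂ)),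
    1 ≤ Q → 1 ≤ T → D = (k : ℝ) * Q ^ 2 * T → 1 / 2 + θ ≤ α → α ≤ 1 →
    (∀ r ∈ R, IsZeroPoint Q T α r) → (R.card : ℝ) ≤ C * D ^ (2 - 2 * α + 11 * g) := by
  classical
  obtain ⟨D₁, hD₁, hdet⟩ := exists_half_le_norm_LSeries hGLH hθ hθ1 hg hg1
  obtain ⟨D₂, C₂, hD₂, hC₂, hcount⟩ := exists_card_detected_le hg (by linarith)
    (x := g * θ / 4) (by positivity)
  obtain ⟨C₃, hC₃, htot⟩ := exists_card_zeroPoints_le one_pos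
  obtain ⟨C₄, hC₄, hseg⟩ := exists_card_zeroPoints_segment_le hg
  refine ⟨C₂ + C₃ * (max D₁ D₂) ^ (2 : ℝ) + C₄ * 2, by positivity, ?_⟩
  intro k _ Q T D α R hQ hT hDdef hα hα1 hR
  have hD : 1 ≤ D := hDdef ▸ one_le_size (k := k) hQ hT
  have hD0 : 0 < D := by linarith
  have hDe : 1 ≤ D ^ (2 - 2 * α + 11 * g) := Real.one_le_rpow hD (by linarith)
  rcases lt_or_ge D (max D₁ D₂) with hsmall | hlarge
  · have h1 := htot k Q T R hQ hT fun r hr => (hR r hr).mono (by linarith)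
    rw [← hDdef] at h1
    have h2 : D ^ ((1 : ℝ) + 1) ≤ (max D₁ D₂) ^ (2 : ℝ) := by
      rw [show (1 : ℝ) + 1 = 2 by norm_num]
      gcongr
    calc (R.card : ℝ) ≤ C₃ * (max D₁ D₂) ^ (2 : ℝ) := h1.trans (by gcongr)
      _ ≤ C₂ + C₃ * (max D₁ D₂) ^ (2 : ℝ) + C₄ * 2 := by linarith
      _ ≤ _ := le_mul_of_one_le_right (by positivity) hDe
  set p : FamilyIndex k × ℂ → Prop := fun r => r.1.char ≠ 1 ∨ 2 * D ^ (3 * g) ≤ |r.2.im| with hp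
  have hdetected : ((R.filter p).card : ℝ) ≤ C₂ * D ^ (2 - 2 * α + 11 * g) := by
    refine hcount k Q T D α _ hQ hT hDdef ((le_max_right _ _).trans hlarge) (by linarith)
      (fun r hr => hR r (Finset.mem_filter.mp hr).1) fun r hr => ?_
    obtain ⟨h1, h2⟩ := Finset.mem_filter.mp hr
    exact hdet k Q T D r hQ hT hDdef ((le_max_left _ _).trans hlarge) ((hR r h1).mono hα) h2
  have hexc : ((R.filter fun r => ¬ p r).card : ℝ) ≤ C₄ * 2 * D ^ (2 - 2 * α + 11 * g) := by
    rcases (R.filter fun r => ¬ p r).eq_empty_or_nonempty with he | ⟨r₀, hr₀⟩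
    · rw [he]
      simp
      positivity
    obtain ⟨m₀, n₀⟩ := Finset.mem_filter.mp hr₀
    -- The principal character appears once, so all these zeros belong to one `L`-function.
    have hone : ∀ r ∈ R.filter fun r => ¬ p r, r.1 = r₀.1 := by
      intro r hr
      obtain ⟨m, n⟩ := Finset.mem_filter.mp hr
      exact FamilyIndex.eq_of_char_eq_one (hR r m).admissible (hR r₀ m₀).admissible
        (not_not.mp (not_or.mp n).1) (not_not.mp (not_or.mp n₀).1)
    have hD3 : 1 ≤ D ^ (3 * g) := Real.one_le_rpow hD (by linarith)
    rw [← Finset.filter_true_of_mem hone, card_filter_fst_eq]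
    refine (hseg k Q T 0 (2 * D ^ (3 * g)) r₀.1 _ hQ hT (by linarith) fun ρ hρ => ?_).1.trans ?_
    · obtain ⟨r, hr, rfl⟩ := Finset.mem_image.mp hρ
      obtain ⟨hr1, hr2⟩ := Finset.mem_filter.mp hr
      obtain ⟨m, n⟩ := Finset.mem_filter.mp hr1
      refine ⟨?_, ?_⟩
      · rw [← hr2]
        exact (hR r m).mono (by linarith)
      · rw [sub_zero]
        exact (not_le.mp (not_or.mp n).2).le
    · rw [← hDdef]
      calc _ = C₄ * 2 * D ^ (3 * g + g) := by rw [Real.rpow_add hD0]; ring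
        _ ≤ _ := by
          have := Real.rpow_le_rpow_of_exponent_le hD
            (show 3 * g + g ≤ 2 - 2 * α + 11 * g by linarith)
          gcongr
  have hcard : (R.card : ℝ) = (R.filter p).card + (R.filter fun r => ¬ p r).card := by
    exact_mod_cast (Finset.card_filter_add_card_filter_not p).symm
  rw [hcard]
  have : 0 ≤ C₃ * (max D₁ D₂) ^ (2 : ℝ) * D ^ (2 - 2 * α + 11 * g) := by positivity
  linarith

/-- The density bound for the number of distinct zeros. Close to the critical line the trivial bound
suffices. -/
lemma exists_card_le_density (hGLH : GeneralizedLindelofHypothesis) {ε : ℝ} (hε : 0 < ε) :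
    ∃ C : ℝ, 0 < C ∧
    ∀ (k : ℕ) [NeZero k] (Q T α : ℝ) (R : Finset (FamilyIndex k × ℂ)),
    1 ≤ Q → 1 ≤ T → 1 / 2 ≤ α → α ≤ 1 → (∀ r ∈ R, IsZeroPoint Q T α r) →
    (R.card : ℝ) ≤ C * ((k : ℝ) * Q ^ 2 * T) ^ (2 * (1 - α) + ε) := by
  set δ := min ε 1 with hδ
  have hδ0 : 0 < δ := lt_min hε one_pos
  have hδ1 : δ ≤ 1 := min_le_right _ _
  have hδε : δ ≤ ε := min_le_left _ _
  obtain ⟨C₁, hC₁, h₁⟩ := exists_card_le_of_half_add_le hGLH (g := δ / 11) (θ := δ / 4)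
    (by positivity) (by linarith) (by positivity) (by linarith)
  obtain ⟨C₂, hC₂, h₂⟩ := exists_card_zeroPoints_le (τ := δ / 2) (by positivity)
  refine ⟨C₁ + C₂, by positivity, ?_⟩
  intro k _ Q T α R hQ hT hα hα1 hR
  have hD := one_le_size (k := k) hQ hT
  rcases le_or_gt (1 / 2 + δ / 4) α with h | h
  · refine (h₁ k Q T _ α R hQ hT rfl h hα1 hR).trans ?_
    have := Real.rpow_le_rpow_of_exponent_le hD
      (show 2 - 2 * α + 11 * (δ / 11) ≤ 2 * (1 - α) + ε by linarith)
    gcongr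
    linarith
  · refine (h₂ k Q T R hQ hT fun r hr => (hR r hr).mono hα).trans ?_
    have := Real.rpow_le_rpow_of_exponent_le hD
      (show 1 + δ / 2 ≤ 2 * (1 - α) + ε by linarith)
    gcongr
    linarith

/-! ### Counting with multiplicity -/

/-- The point `s = 1` never contributes to `zeroCount`: the `L`-function does not vanish there when the
character is non-principal, and is not analytic there when it is principal. -/
lemma analyticOrderAt_LFunction_one {q : ℕ} [NeZero q] (χ : DirichletCharacter ℂ q) :
    analyticOrderAt χ.LFunction 1 = 0 := by
  by_cases hχ : χ = 1
  · subst hχ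
    refine analyticOrderAt_of_not_analyticAt fun h => ?_
    have h1 : Tendsto (fun s : ℂ => (s - 1) * DirichletCharacter.LFunctionTrivChar q s) (𝓝[≠] 1)
        (𝓝 0) := by
      have h2 : ContinuousAt (fun s : ℂ => (s - 1) * DirichletCharacter.LFunctionTrivChar q s) 1 :=
        (continuousAt_id.sub continuousAt_const).mul h.continuousAt
      have h3 := h2.tendsto
      rw [sub_self, zero_mul] at h3
      exact h3.mono_left nhdsWithin_le_nhds
    have h4 := tendsto_nhds_unique h1 DirichletCharacter.LFunctionTrivChar_residue_one
    refine Finset.prod_ne_zero_iff.mpr (fun p hp => ?_) h4.symm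
    have hp2 : (2 : ℝ) ≤ p := by exact_mod_cast (Nat.prime_of_mem_primeFactors hp).two_le
    rw [sub_ne_zero]
    intro h5
    have h6 : (p : ℂ) = 1 := by
      rw [← inv_inv (p : ℂ), ← h5, inv_one]
    have h7 : (p : ℝ) = 1 := by exact_mod_cast h6
    linarith
  · exact analyticOrderAt_eq_zero.mpr
      (Or.inr (DirichletCharacter.LFunction_apply_one_ne_zero hχ))

lemma zeroCount_le_card_mul {q : ℕ} [NeZero q] (χ : DirichletCharacter ℂ q) {α T M : ℝ} {F : Finset ℂ}
    (hmult : ∀ ρ ∈ F, analyticOrderAt χ.LFunction ρ ≠ ⊤ ∧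
      (analyticOrderNatAt χ.LFunction ρ : ℝ) ≤ M)
    (hF : ∀ ρ : ℂ, χ.LFunction ρ = 0 → ρ ≠ 1 → α ≤ ρ.re → |ρ.im| ≤ T → ρ ∈ F) :
    zeroCount α T χ ≤ F.card * ENNReal.ofReal M := by
  refine (tsum_subtype {ρ : ℂ | χ.LFunction ρ = 0 ∧ α ≤ ρ.re ∧ |ρ.im| ≤ T}
    (fun ρ => (analyticOrderAt χ.LFunction ρ : ℝ≥0∞))).trans_le ?_
  rw [tsum_eq_sum (s := F)]
  · rw [← nsmul_eq_mul]
    refine Finset.sum_le_card_nsmul _ _ _ fun ρ hρ => ?_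
    refine (Set.indicator_le_self' (fun _ _ => zero_le) ρ).trans ?_
    obtain ⟨h1, h2⟩ := hmult ρ hρ
    rw [← Nat.cast_analyticOrderNatAt h1, ENat.toENNReal_coe, ← ENNReal.ofReal_natCast]
    exact ENNReal.ofReal_le_ofReal h2
  · intro ρ hρ
    by_cases hz : χ.LFunction ρ = 0 ∧ α ≤ ρ.re ∧ |ρ.im| ≤ T
    · have h1 : ρ = 1 := by
        by_contra h1
        exact hρ (hF ρ hz.1 h1 hz.2.1 hz.2.2)
      rw [Set.indicator_of_mem (by exact hz), h1, analyticOrderAt_LFunction_one]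
      simp
    · exact Set.indicator_of_notMem (by exact hz) _

open scoped Classical in
/-- The index set of the sum `zeroCountSum`. -/
noncomputable def admissibleFinset (k : ℕ) [NeZero k] (Q : ℝ) : Finset (FamilyIndex k) :=
  ((Finset.range ⌊Q⌋₊).filter fun j => (j + 1).Coprime k).sigma fun j =>
    (Finset.univ.filter fun ψ : DirichletCharacter ℂ (j + 1) => ψ.IsPrimitive) ×ˢ Finset.univ

lemma mem_admissibleFinset {k : ℕ} [NeZero k] {Q : ℝ} (hQ : 0 ≤ Q) {i : FamilyIndex k}
    (hi : i ∈ admissibleFinset k Q) : i.Admissible ∧ (i.1 : ℝ) + 1 ≤ Q := by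
  simp only [admissibleFinset, Finset.mem_sigma, Finset.mem_filter, Finset.mem_product] at hi
  refine ⟨⟨hi.1.2, hi.2.1.2⟩, ?_⟩
  have := Finset.mem_range.mp hi.1.1
  exact_mod_cast (Nat.le_floor_iff hQ).mp (show i.1 + 1 ≤ ⌊Q⌋₊ by omega)

lemma zeroCountSum_eq (α : ℝ) (k : ℕ) [NeZero k] (Q T : ℝ) :
    zeroCountSum α k Q T = ∑ i ∈ admissibleFinset k Q, zeroCount α T i.char := by
  rw [zeroCountSum, admissibleFinset, Finset.sum_sigma]
  refine Finset.sum_congr rfl fun j _ => ?_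
  rw [Finset.sum_product]
  rfl

/-- If every finite set of points counted has at most `B` elements, each of multiplicity at most `M`, then
the count with multiplicity is at most `B * M`. -/
lemma zeroCountSum_le_mul {k : ℕ} [NeZero k] {Q T α B M : ℝ} (hQ : 0 ≤ Q) (hB : 0 ≤ B)
    (hcard : ∀ R : Finset (FamilyIndex k × ℂ), (∀ r ∈ R, IsZeroPoint Q T α r) → (R.card : ℝ) ≤ B)
    (hmult : ∀ r : FamilyIndex k × ℂ, IsZeroPoint Q T α r →
      analyticOrderAt r.1.char.LFunction r.2 ≠ ⊤ ∧
        (analyticOrderNatAt r.1.char.LFunction r.2 : ℝ) ≤ M) :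
    zeroCountSum α k Q T ≤ ENNReal.ofReal (B * M) := by
  classical
  have hfin : {r : FamilyIndex k × ℂ | IsZeroPoint Q T α r}.Finite := by
    by_contra hinf
    obtain ⟨R, hR, hRc⟩ := Set.Infinite.exists_subset_card_eq hinf (⌊B⌋₊ + 1)
    have h1 := hcard R fun r hr => hR hr
    rw [hRc] at h1
    push_cast at h1
    linarith [Nat.lt_floor_add_one B]
  set W := hfin.toFinset with hW
  have hmem : ∀ r, r ∈ W ↔ IsZeroPoint Q T α r := fun r => hfin.mem_toFinset
  have hone : ∀ i ∈ admissibleFinset k Q, zeroCount α T i.char ≤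
      ((W.filter fun r => r.1 = i).card : ℝ≥0∞) * ENNReal.ofReal M := by
    intro i hi
    obtain ⟨hadm, hmod⟩ := mem_admissibleFinset hQ hi
    rw [card_filter_fst_eq]
    set F := (W.filter fun r => r.1 = i).image Prod.snd with hF
    have hFmem : ∀ ρ ∈ F, IsZeroPoint Q T α (i, ρ) := by
      intro ρ hρ
      obtain ⟨r, hr, rfl⟩ := Finset.mem_image.mp hρ
      obtain ⟨h1, rfl⟩ := Finset.mem_filter.mp hr
      exact (hmem r).mp h1
    refine zeroCount_le_card_mul i.char (fun ρ hρ => hmult (i, ρ) (hFmem ρ hρ))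
      fun ρ h0 h1 h2 h3 => ?_
    exact Finset.mem_image.mpr ⟨(i, ρ), Finset.mem_filter.mpr
      ⟨(hmem _).mpr ⟨hadm, hmod, h0, h1, h2, h3⟩, rfl⟩, rfl⟩
  rw [zeroCountSum_eq]
  refine (Finset.sum_le_sum hone).trans ?_
  rw [← Finset.sum_mul, ENNReal.ofReal_mul hB]
  gcongr
  have h1 : ∑ i ∈ admissibleFinset k Q, (W.filter fun r => r.1 = i).card ≤ W.card := by
    rw [← Finset.card_biUnion]
    · exact Finset.card_le_card (Finset.biUnion_subset.mpr fun i _ => Finset.filter_subset _ _)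
    · intro i _ i' _ hne
      refine Finset.disjoint_left.mpr fun r hr hr' => hne ?_
      exact (Finset.mem_filter.mp hr).2.symm.trans (Finset.mem_filter.mp hr').2
  calc ∑ i ∈ admissibleFinset k Q, ((W.filter fun r => r.1 = i).card : ℝ≥0∞) ≤ (W.card : ℝ≥0∞) := by
        exact_mod_cast h1
    _ = ENNReal.ofReal (W.card : ℝ) := (ENNReal.ofReal_natCast _).symm
    _ ≤ ENNReal.ofReal B := ENNReal.ofReal_le_ofReal (hcard W fun r hr => (hmem r).mp hr)

theorem mainTheorem2 (hGLH : GeneralizedLindelofHypothesis) :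
    ∀ ε : ℝ, 0 < ε → ∃ C : ℝ, 0 < C ∧
      ∀ (k : ℕ) [NeZero k] (Q T α : ℝ), 1 ≤ Q → 1 ≤ T → 1 / 2 ≤ α → α ≤ 1 →
        zeroCountSum α k Q T ≤
          ENNReal.ofReal (C * ((k : ℝ) * Q ^ 2 * T) ^ (2 * (1 - α) + ε)) := by
  intro ε hε
  obtain ⟨C₁, hC₁, h₁⟩ := exists_card_le_density hGLH (half_pos hε)
  obtain ⟨C₂, hC₂, h₂⟩ := exists_card_zeroPoints_segment_le (half_pos hε)
  refine ⟨C₁ * C₂, by positivity, ?_⟩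
  intro k _ Q T α hQ hT hα hα1
  have hD := one_le_size (k := k) hQ hT
  have hD0 : 0 < (k : ℝ) * Q ^ 2 * T := by linarith
  refine (zeroCountSum_le_mul (by linarith) (by positivity) (fun R => h₁ k Q T α R hQ hT hα hα1)
    fun r hr => (h₂ k Q T r.2.im 1 r.1 {r.2} hQ hT le_rfl fun ρ hρ => ?_).2 r.2
      (Finset.mem_singleton_self _)).trans (le_of_eq ?_)
  · rw [Finset.mem_singleton.mp hρ]
    exact ⟨hr.mono hα, by simp⟩
  · rw [show 2 * (1 - α) + ε = (2 * (1 - α) + ε / 2) + ε / 2 by ring, Real.rpow_add hD0 (_ + _)]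
    congr 1
    ring
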